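/- Let $0<r<n$ be integers. **Data.** Let $B$ be a smooth projective variety with line bundles $L_1,\dots,L_n$, $M_1,\dots,M_n$, let $A=H^{\mathrm{ev}}(B;\mathbb C)$, and let the torus $(\mathbb C^*)^{2n}$ act with equivariant parameters $\lambda_1,\dots,\lambda_n,\mu_1,\dots,\mu_n$, regarded as complex numbers with $\lambda_i-\lambda_j\notin 2\pi\mathrm i\mathbb Z$ and $\mu_i-\mu_j\notin 2\pi\mathrm i\mathbb Z$ for $i\ne j$. Put $x_j=c_1^{\mathbb T}(L_j^\vee)=\lambda_j+c_1(L_j^\vee)$ and $z_j=c_1^{\mathbb T}(M_j^\vee)=\mu_j+c_1(M_j^\vee)$ in $A$, and for a curve class $\beta$ put $l_j=\beta\cdot L_j$, $m_j=\beta\cdot M_j\in\mathbb Z$. More generally, $A$ may be any finite-dimensional commutative $\mathbb C$-algebra, $x_j-\lambda_j$ and $z_j-\mu_j$ any nilpotent elements of $A$, and $l,m\in\mathbb Z^n$ arbitrary. The functions $1/\Gamma$, $\sin$, $\exp$ are evaluated on elements of $A$ by their power series. **Functions.** For $y\in A^r$ let $$\rho(y)=\frac{\pi^{r(r-1)/2}}{\prod_{i<k}\sin((y_k-y_i)/2\mathrm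 i)}.$$ For an injective map $\delta\colon\{1,\dots,r\}\to\{1,\dots,n\}$, with $q_k^{s}=e^{s\log q_k}$, the function $H^+_{\beta,\delta}(q_{1,+},\dots,q_{r,+})$ is the value at $y_k=-x_{\delta_k}$ of $$\rho(y)\sum_{e\in\mathbb Z^r}(-1)^{(r-1)\sum_k e_k}\prod_{k=1}^r\frac{q_{k,+}^{-y_k/2\pi\mathrm i+e_k}\prod_{i<k}\bigl(\tfrac{y_k-y_i}{2\pi\mathrm i}-e_k+e_i\bigr)}{\prod_{j=1}^n\Gamma\bigl(1+\tfrac{-y_k-x_j}{2\pi\mathrm i}+l_j+e_k\bigr)\Gamma\bigl(1+\tfrac{y_k+z_j}{2\pi\mathrm i}-m_j-e_k\bigr)},$$ and $H^-_{\beta,\delta}(q_{1,-},\dots,q_{r,-})$ is the value at $y_k=-z_{\delta_k}$ of $$\rho(y)\sum_{d\in\mathbb Z^r}(-1)^{(r-1)\sum_k d_k}\prod_{k=1}^r\frac{q_{k,-}^{y_k/2\pi\mathrm i+d_k}\prod_{i<k}\bigl(\tfrac{y_k-y_i}{2\pi\mathrm i}+d_k-d_i\bigr)}{\prod_{j=1}^n\Gamma\bigl(1+\tfrac{-y_k-x_j}{2\pi\mathrm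 i}+l_j-d_k\bigr)\Gamma\bigl(1+\tfrac{y_k+z_j}{2\pi\mathrm i}-m_j+d_k\bigr)}.$$ For injective $\delta^\pm$ let $$C^H_{\delta^-,\delta^+}=\prod_{i=1}^r e^{(n-r)(x_{\delta^+_i}-z_{\delta^-_i})/2}\prod_{j\ne\delta^-_i}\frac{\sin((-z_j+x_{\delta^+_i})/2\mathrm i)}{\sin((-z_j+z_{\delta^-_i})/2\mathrm i)}\cdot\prod_{i<k\le r}\frac{\sin((z_{\delta^-_i}-z_{\delta^-_k})/2\mathrm i)}{\sin((x_{\delta^+_i}-x_{\delta^+_k})/2\mathrm i)}.$$ **Paths.** Let $a<0<b$ be real and let $\gamma$ be a path from $a$ to $b$ in the $\log q$ plane such that $\operatorname{Im}=(n-r)\pi$ whenever $\operatorname{Re}$ is close to $0$. In the coordinates $(\log q_{1,+},\dots,\log q_{r,+})$ on $\mathbb C^r$, let $\gamma_k$ be the path that follows $\gamma$ in the $k$-th coordinate, with the $i$-th coordinate constantly $b$ for $i<k$ and constantly $a$ for $i>k$. **Proposition.** There are a path $\hat\gamma$ lying in the diagonal $\log q_{1,+}=\dots=\log q_{r,+}$,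 whose common coordinate is again a path from $a$ to $b$ with $\operatorname{Im}=(n-r)\pi$ for $\operatorname{Re}$ close to $0$, and a homotopy with fixed end points from $\gamma_1\star\cdots\star\gamma_r$ to $\hat\gamma$, both independent of $\beta$, $\delta^+$ and of all the data above other than $n,r,\gamma$, such that the homotopy avoids the locus where some $\log q_{k,+}\in(n-r+1)\pi\mathrm i+2\pi\mathrm i\mathbb Z$, and for all data as above and all injective $\delta^+$: 1. the series defining $H^+_{\beta,\delta^+}$ and all $H^-_{\beta,\delta^-}$ converge absolutely when all $|q_{k,+}|<1$, respectively all $|q_{k,-}|<1$; 2. $H^+_{\beta,\delta^+}$ continues analytically along every path of the homotopy, with the same resulting germ $\widetilde{H^+_{\beta,\delta^+}}$ at $(b,\dots,b)$; 3. on the diagonal $q_{1,+}=\dots=q_{r,+}=q_+$, with $q_-=q_+^{-1}$, $$\widetilde{H^+_{\beta,\delta^+}}\Big|_{q_{1,+}=\cdots=q_{r,+}=q_+}=\sum_{\delta^-}C^H_{\delta^-,\delta^+}\,H^-_{\beta,\delta^-}\Big|_{q_{1,-}=\cdots=q_{r,-}=q_-},$$ the sum being over injective maps $\delta^-\colon\{1,\dots,r\}\to\{1,\dots,n\}$;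 and the right-hand side is also the analytic continuation along $\hat\gamma$ of the one-variable function $H^+_{\beta,\delta^+}|_{q_{1,+}=\cdots=q_{r,+}=q_+}$. -/

import Mathlib

open Complex Filter Topology

namespace GrassmannFlop

noncomputable section

/-! ### Functional calculus in a finite-dimensional commutative algebra -/

section Calculus

variable {A : Type*} [NormedCommRing A] [NormedAlgebra ℂ A]

/-- The value `F(a) = ∑ F⁽ᵏ⁾(0)/k! · aᵏ` of an entire function `F` at an element `a`. -/
def entireEval (F : ℂ → ℂ) (a : A) : A :=
  ∑' k : ℕ, (iteratedDeriv k F 0 / (k.factorial : ℂ)) • a ^ k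

/-- `1 / Γ(1 + a + N)` for an integer `N`; the function `1/Γ` is entire. -/
def recipGamma (N : ℤ) (a : A) : A :=
  entireEval (fun s : ℂ => (Complex.Gamma (1 + s + (N : ℂ)))⁻¹) a

/-- `sin(a / 2i)`. -/
def sinHalf (a : A) : A :=
  entireEval Complex.sin ((2 * I : ℂ)⁻¹ • a)

/-- `a / 2πi`. -/
def twoPiIDiv (a : A) : A := (2 * (Real.pi : ℂ) * I)⁻¹ • a

/-- `q ^ (a / 2πi + e) = exp ((a / 2πi + e) · log q)`, as a function of `w = log q`. -/
def qPow (w : ℂ) (a : A) (e : ℤ) : A :=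
  NormedSpace.exp (w • (twoPiIDiv a + algebraMap ℂ A (e : ℂ)))

end Calculus

/-! ### The hypergeometric functions and the connection coefficients

`x j`, `z j` are the classes `c₁(L_j^∨)`, `c₁(M_j^∨)`, the integers `l j`, `m j` are the degrees
`β · L_j`, `β · M_j`, and `y k` are the Chern roots. -/

section Functions

variable {A : Type*} [NormedCommRing A] [NormedAlgebra ℂ A] {n r : ℕ}

/-- `π^{r(r-1)/2} / ∏_{i<k} sin((y_k - y_i)/2i)`. -/
def rootFactor (y : Fin r → A) : A :=
  ((Real.pi : ℂ) ^ (r * (r - 1) / 2)) •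
    Ring.inverse (∏ k : Fin r, ∏ i ∈ Finset.Iio k, sinHalf (y k - y i))

/-- The summand of index `(e_1, …, e_r)` of `H_{X_+, β}`, where `w k = log q_{k,+}`. -/
def termPlus (x z : Fin n → A) (l m : Fin n → ℤ) (y : Fin r → A) (w : Fin r → ℂ)
    (e : Fin r → ℤ) : A :=
  ((-1 : ℂ) ^ (((r : ℤ) - 1) * ∑ k, e k)) •
    ∏ k : Fin r,
      (qPow (w k) (-y k) (e k)
        * (∏ i ∈ Finset.Iio k,
            (twoPiIDiv (y k - y i) + algebraMap ℂ A (-(e k : ℂ) + (e i : ℂ))))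
        * ∏ j : Fin n,
            (recipGamma (l j + e k) (twoPiIDiv (-y k - x j))
              * recipGamma (-m j - e k) (twoPiIDiv (y k + z j))))

/-- The summand of index `(d_1, …, d_r)` of `H_{X_-, β}`, where `v k = log q_{k,-}`. -/
def termMinus (x z : Fin n → A) (l m : Fin n → ℤ) (y : Fin r → A) (v : Fin r → ℂ)
    (d : Fin r → ℤ) : A :=
  ((-1 : ℂ) ^ (((r : ℤ) - 1) * ∑ k, d k)) •
    ∏ k : Fin r,
      (qPow (v k) (y k) (d k)
        * (∏ i ∈ Finset.Iio k,
            (twoPiIDiv (y k - y i) + algebraMap ℂ A ((d k : ℂ) - (d i : ℂ))))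
        * ∏ j : Fin n,
            (recipGamma (l j - d k) (twoPiIDiv (-y k - x j))
              * recipGamma (-m j + d k) (twoPiIDiv (y k + z j))))

/-- The summands of `H⁺_{β,δ}`, the restriction of `H_{X_+, β}` to the fixed locus of `δ`,
where `y k` restricts to `-x_{δ k}`. -/
def HplusTerm (x z : Fin n → A) (l m : Fin n → ℤ) (δ : Fin r → Fin n) (w : Fin r → ℂ)
    (e : Fin r → ℤ) : A :=
  termPlus x z l m (fun k => -x (δ k)) w e

/-- `H⁺_{β,δ}` as a function of `w k = log q_{k,+}`. -/
def Hplus (x z : Fin n → A) (l m : Fin n → ℤ) (δ : Fin r → Fin n) (w : Fin r → ℂ) : A :=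
  rootFactor (fun k => -x (δ k)) * ∑' e : Fin r → ℤ, HplusTerm x z l m δ w e

/-- The summands of `H⁻_{β,δ}`, the restriction of `H_{X_-, β}` to the fixed locus of `δ`,
where `y k` restricts to `-z_{δ k}`. -/
def HminusTerm (x z : Fin n → A) (l m : Fin n → ℤ) (δ : Fin r → Fin n) (v : Fin r → ℂ)
    (d : Fin r → ℤ) : A :=
  termMinus x z l m (fun k => -z (δ k)) v d

/-- `H⁻_{β,δ}` as a function of `v k = log q_{k,-}`. -/
def Hminus (x z : Fin n → A) (l m : Fin n → ℤ) (δ : Fin r → Fin n) (v : Fin r → ℂ) : A :=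
  rootFactor (fun k => -z (δ k)) * ∑' d : Fin r → ℤ, HminusTerm x z l m δ v d

/-- The coefficient `C^K_{f⁻, f⁺}`. -/
def CK (x z : Fin n → A) (fm fp : Fin r → Fin n) : A :=
  ∏ i : Fin r,
    (NormedSpace.exp ((((n : ℂ) - (r : ℂ)) / 2) • (x (fp i) - z (fm i)))
      * (∏ j ∈ Finset.univ.erase (fm i), sinHalf (-z j + x (fp i)))
      * Ring.inverse (∏ j ∈ Finset.univ.erase (fm i), sinHalf (-z j + z (fm i))))

/-- The coefficient `C^H_{f⁻, f⁺}`. -/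
def CH (x z : Fin n → A) (fm fp : Fin r → Fin n) : A :=
  CK x z fm fp *
    ∏ k : Fin r, ∏ i ∈ Finset.Iio k,
      (sinHalf (z (fm i) - z (fm k)) * Ring.inverse (sinHalf (x (fp i) - x (fp k))))

end Functions

/-! ### Paths of analytic continuation -/

section Paths

/-- The points `(n - r + 1)πi + 2πiℤ` of the `log q` plane. -/
def poles (n r : ℕ) : Set ℂ :=
  {w | ∃ N : ℤ, w = ((n : ℂ) - (r : ℂ) + 1) * (Real.pi : ℂ) * I + 2 * (Real.pi : ℂ) * I * (N : ℂ)}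

/-- `γ`, a path in the `log q` plane between two real points (where `arg q = 0`), goes through
`Im (log q) = (n - r)π` whenever `Re (log q)` is close to `0`. -/
def IsContinuationPath (n r : ℕ) {a b : ℝ} (γ : Path (a : ℂ) (b : ℂ)) : Prop :=
  ∃ ε > 0, ∀ t, |(γ t).re| < ε → (γ t).im = ((n : ℝ) - (r : ℝ)) * Real.pi

variable (r : ℕ) {a b : ℂ} (γ : Path a b)

/-- The point `(b, …, b, a, …, a)` with `k` entries `b`. -/
def corner (a b : ℂ) (k : Fin (r + 1)) : Fin r → ℂ :=
  fun i => if i.castSucc < k then b else a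

/-- The path that follows `γ` in the `k`-th coordinate, with the earlier coordinates constantly
equal to the end point of `γ` and the later ones to its starting point. -/
def edgePath (k : Fin r) : Path (corner r a b k.castSucc) (corner r a b k.succ) where
  toFun t := fun i => if i < k then b else if i = k then γ t else a
  continuous_toFun := by
    refine continuous_pi fun i => ?_
    split_ifs
    · exact continuous_const
    · exact γ.continuous
    · exact continuous_const
  source' := by
    funext i
    by_cases h : i < k
    · simp [corner, h]
    · simp [corner, h]
  target' := by
    funext i
    rcases lt_trichotomy i k with h | h | h
    · simp [corner, h, h.le, Fin.castSucc_lt_succ_iff]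
    · simp [corner, h]
    · simp [corner, h.not_gt, h.ne', not_le.mpr h, Fin.castSucc_lt_succ_iff]

/-- The concatenation `γ_1 ⋆ ⋯ ⋆ γ_r` of these paths, from `(a, …, a)` to `(b, …, b)`. -/
def concatPath : Path (fun _ : Fin r => a) (fun _ : Fin r => b) :=
  (Path.concat (corner r a b) (edgePath r γ)).cast
    (by funext i; simp [corner])
    (by funext i; simp [corner, Fin.castSucc_lt_last])

/-- The path that follows `γ` inside the diagonal. -/
def diagPath : Path (fun _ : Fin r => a) (fun _ : Fin r => b) where
  toFun t := fun _ => γ t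
  continuous_toFun := continuous_pi fun _ => γ.continuous
  source' := by funext _; simp
  target' := by funext _; simp

/-- The germ of `f` at the starting point of the path `p` has an analytic continuation along `p`,
and the resulting germ at the end point is that of `g`. -/
def ContinuesAlong {E A : Type*} [NormedAddCommGroup E] [NormedSpace ℂ E]
    [NormedAddCommGroup A] [NormedSpace ℂ A] {u v : E} (p : Path u v) (f g : E → A) : Prop :=
  ∃ Φ : unitInterval → E → A,
    (∀ t, AnalyticAt ℂ (Φ t) (p t)) ∧
    (∀ t, ∀ᶠ s in 𝓝 t, Φ s =ᶠ[𝓝 (p s)] Φ t) ∧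
    Φ 0 =ᶠ[𝓝 u] f ∧ Φ 1 =ᶠ[𝓝 v] g

end Paths

end

end GrassmannFlop

/-!
The continuation and the connection formula reduce to one variable. Put `t_k = y_k/2πi + d_k`, with
`w = log q_+`, `d = -e` for `H⁺` and `w = -log q_-` for `H⁻`. Then `H⁺` and `H⁻` are
sums over `d ∈ ℤʳ` of the same expression: the Vandermonde product `∏_{i<k} (t_k - t_i)` times
`∏_k (-1)^{(r-1) d_k} e^{-w_k t_k} h(t_k)`, where
`h(t) = ∏_j 1/Γ(1 - x_j/2πi + l_j - t) · 1/Γ(1 + z_j/2πi - m_j + t)`. Expanding the Vandermonde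
determinant, each series is the determinant of a matrix of one-variable series
`S_p(s, w) = ∑_d (-1)^{(r-1)d} e^{-w(s+d)} (s+d)^p h(s+d)` (`hasSum_detTerm`), taken at
`s_k = -x_{δ k}/2πi` for `H⁺` and at `b_j = -z_j/2πi` for `H⁻`. At these points `1/Γ` vanishes on
one half of `ℤ`, so that `S_p(s_k, w)` converges for `Re w < 0` and `S_p(b_j, w)` for `Re w > 0`.

One variable (`continues_pow_mul_gammaProd`). After raising the parameters `P_j` of `h` by a large
integer, `h` decays quadratically along `ℤ`, and both series converge up to `Re w = 0`. There the
two-sided series is defined for every complex `s`; it is entire in `s`, quasi-periodic under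
`s ↦ s + 1`, and by the bound `|1/Γ(p) · 1/Γ(q)| = O(e^{π |Im p|})`, valid for bounded `p + q`
with real part at least `2`, it has exponential type at most `nπ`, up to the factor
`e^{Im w · Im s}`. If `|Im w - (n - r)π| < π`,
Liouville's theorem shows that it is an exponential `e^{-κs}` times a polynomial of degree less than
`n` in `X = e^{2πis}` (`exists_eq_sum_wave`). Taylor expansion in nilpotent directions carries this
over to `s ∈ A`, and Lagrange interpolation at the `n` nodes `X(b_j)` expresses the value at `s_k`
through the values at the `b_j`, with the coefficients of `C^K`
(`tsum_seriesTerm_eq_of_re_eq_zero`, `connection_eq`). So the sums over the two half planes agree on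
the gap of the imaginary axis and glue to a holomorphic function on the slit plane
`{Re w ≠ 0} ∪ {|Im w - (n - r)π| < π}`. The general case follows by applying differential operators
`κ - e · d/dw`, which multiply `h(t)` by `κ + e t`.

Several variables (`exists_analytic_extension_Hplus`). The determinant of the one-variable
continuations is analytic on the `r`-th power of the slit plane. On the diagonal over `Re u > 0` it
is the determinant of a product of an `r × n` and an `n × r` matrix, and the Cauchy-Binet formula
(`det_sum_mul`) gives the sum over injective `δ⁻`; the sines of the roots turn the prefactor of `H⁺`
into that of `H⁻` (`CH_mul_rootFactor`).

Topology. The power of the slit plane is star convex, avoids the poles and contains both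
`γ_1 ⋆ ⋯ ⋆ γ_r` and the diagonal path along `γ`, so these are homotopic in it, and one global
analytic function provides the continuation along all paths of the homotopy.
-/

namespace GrassmannFlop

noncomputable section

/-! ### Locally dominated families of holomorphic functions -/

section LocallyDominated

variable {ι E : Type*} [NormedAddCommGroup E] {U : Set ℂ} {f : ι → ℂ → E}

/-- Near every point of `U`, the family `f` is bounded in norm by a summable family of constants. -/
def LocallyDominated (U : Set ℂ) (f : ι → ℂ → E) : Prop :=
  ∀ w ∈ U, ∃ ρ > 0, ∃ b : ι → ℝ, Summable b ∧ ∀ i, ∀ v ∈ Metric.ball w ρ, ‖f i v‖ ≤ b i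

theorem LocallyDominated.exists_ball (h : LocallyDominated U f) (hU : IsOpen U) {w : ℂ}
    (hw : w ∈ U) : ∃ ρ > 0, Metric.ball w ρ ⊆ U ∧
      ∃ b : ι → ℝ, Summable b ∧ ∀ i, ∀ v ∈ Metric.ball w ρ, ‖f i v‖ ≤ b i := by
  obtain ⟨ρ, hρ, b, hb, hfb⟩ := h w hw
  obtain ⟨ρ', hρ', hsub⟩ := Metric.isOpen_iff.1 hU w hw
  exact ⟨min ρ ρ', lt_min hρ hρ', (Metric.ball_subset_ball (min_le_right _ _)).trans hsub, b, hb,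
    fun i v hv => hfb i v (Metric.ball_subset_ball (min_le_left _ _) hv)⟩

theorem LocallyDominated.summable_norm (h : LocallyDominated U f) {w : ℂ} (hw : w ∈ U) :
    Summable fun i => ‖f i w‖ := by
  obtain ⟨ρ, hρ, b, hb, hfb⟩ := h w hw
  exact Summable.of_nonneg_of_le (fun _ => norm_nonneg _)
    (fun i => hfb i w (Metric.mem_ball_self hρ)) hb

variable [NormedSpace ℂ E]

/-- The derivatives are dominated on smaller balls, by Cauchy's estimate. -/
theorem LocallyDominated.of_deriv (h : LocallyDominated U f) (hU : IsOpen U)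
    (hf : ∀ i, DifferentiableOn ℂ (f i) U) : LocallyDominated U fun i => deriv (f i) := by
  intro w hw
  obtain ⟨ρ, hρ, hsub, b, hb, hfb⟩ := h.exists_ball hU hw
  refine ⟨ρ / 2, by positivity, fun i => b i / (ρ / 4), hb.div_const _, fun i v hv => ?_⟩
  have hball : Metric.closedBall v (ρ / 4) ⊆ Metric.ball w ρ := by
    intro y hy
    rw [Metric.mem_closedBall] at hy
    rw [Metric.mem_ball] at hv ⊢
    linarith [dist_triangle y v w]
  refine norm_deriv_le_of_forall_mem_sphere_norm_le (by positivity) ?_ ?_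
  · refine DifferentiableOn.diffContOnCl ?_
    rw [closure_ball v (by positivity)]
    exact (hf i).mono (hball.trans hsub)
  · exact fun z hz => hfb i z (hball (Metric.sphere_subset_closedBall hz))

variable [CompleteSpace E]

theorem LocallyDominated.differentiableOn_tsum (h : LocallyDominated U f) (hU : IsOpen U)
    (hf : ∀ i, DifferentiableOn ℂ (f i) U) : DifferentiableOn ℂ (fun w => ∑' i, f i w) U := by
  intro w hw
  obtain ⟨ρ, hρ, hsub, b, hb, hfb⟩ := h.exists_ball hU hw
  exact ((differentiableOn_tsum_of_summable_norm hb (fun i => (hf i).mono hsub)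
    Metric.isOpen_ball hfb).differentiableAt (Metric.ball_mem_nhds w hρ)).differentiableWithinAt

theorem LocallyDominated.hasSum_deriv (h : LocallyDominated U f) (hU : IsOpen U)
    (hf : ∀ i, DifferentiableOn ℂ (f i) U) {w : ℂ} (hw : w ∈ U) :
    HasSum (fun i => deriv (f i) w) (deriv (fun w => ∑' i, f i w) w) := by
  obtain ⟨ρ, hρ, hsub, b, hb, hfb⟩ := h.exists_ball hU hw
  exact hasSum_deriv_of_summable_norm hb (fun i => (hf i).mono hsub)
    Metric.isOpen_ball hfb (Metric.mem_ball_self hρ)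

theorem LocallyDominated.hasSum_iteratedDeriv {f : ι → ℂ → E} (k : ℕ)
    (h : LocallyDominated Set.univ f) (hf : ∀ i, Differentiable ℂ (f i)) (w : ℂ) :
    HasSum (fun i => iteratedDeriv k (f i) w) (iteratedDeriv k (fun w => ∑' i, f i w) w) := by
  induction k generalizing f with
  | zero => simpa using (h.summable_norm (Set.mem_univ w)).of_norm.hasSum
  | succ k ih =>
    have h' := h.of_deriv isOpen_univ fun i => (hf i).differentiableOn
    have hd : ∀ i, Differentiable ℂ (_root_.deriv (f i)) := fun i =>
      ((hf i).contDiff (n := 2)).differentiable_deriv_two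
    simp only [iteratedDeriv_succ']
    have := ih h' hd
    convert this using 2
    funext v
    exact ((h.hasSum_deriv isOpen_univ (fun i => (hf i).differentiableOn)
      (Set.mem_univ v)).tsum_eq).symm

end LocallyDominated

/-! ### Translation by a nilpotent element -/

section NilShift

variable {A : Type*} [NormedCommRing A] [NormedAlgebra ℂ A]

/-- The Taylor series `∑ f⁽ᵏ⁾(u) νᵏ / k!`, which for nilpotent `ν` is the value at `u + ν` of the
extension to `A` of the function `f`. -/
def nilShift (ν : A) (f : ℂ → A) (u : ℂ) : A :=
  ∑' k : ℕ, ((k.factorial : ℂ)⁻¹) • (ν ^ k * iteratedDeriv k f u)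

theorem nilShift_eq_sum {ν : A} {N : ℕ} (hN : ν ^ N = 0) (f : ℂ → A) (u : ℂ) :
    nilShift ν f u =
      ∑ k ∈ Finset.range N, ((k.factorial : ℂ)⁻¹) • (ν ^ k * iteratedDeriv k f u) := by
  refine tsum_eq_sum fun k hk => ?_
  rw [Finset.mem_range, not_lt] at hk
  rw [pow_eq_zero_of_le hk hN, zero_mul, smul_zero]

/-- A double sum over a square equals the sum over antidiagonals, for a summand vanishing outside
the square. -/
theorem sum_antidiagonal_eq_sum_square {M : Type*} [AddCommMonoid M] {N : ℕ} (g : ℕ → ℕ → M)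
    (h1 : ∀ i j, N ≤ i → g i j = 0) (h2 : ∀ i j, N ≤ j → g i j = 0) :
    ∑ m ∈ Finset.range (2 * N), ∑ p ∈ Finset.HasAntidiagonal.antidiagonal m, g p.1 p.2 =
      ∑ i ∈ Finset.range N, ∑ j ∈ Finset.range N, g i j := by
  rw [Finset.sum_sigma', ← Finset.sum_product']
  symm
  refine Finset.sum_of_injOn (fun p => ⟨p.1 + p.2, p⟩) ?_ ?_ ?_ ?_
  · intro p _ q _ hpq
    simpa using (Sigma.mk.inj_iff.1 hpq).2
  · intro p hp
    simp at hp ⊢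
    lia
  · rintro ⟨m, p⟩ hp hn
    simp only [Finset.mem_sigma, Finset.mem_range,
      Finset.HasAntidiagonal.mem_antidiagonal] at hp
    by_contra hne
    have hp1 : p.1 < N := by
      by_contra! hc
      exact hne (h1 _ _ hc)
    have hp2 : p.2 < N := by
      by_contra! hc
      exact hne (h2 _ _ hc)
    refine hn ⟨p, by simp [hp1, hp2], ?_⟩
    simp only [hp.2]
  · intros; rfl

theorem nilShift_const (ν a : A) (u : ℂ) : nilShift ν (fun _ => a) u = a := by
  rw [nilShift, tsum_eq_single 0]
  · simp
  · intro k hk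
    simp [iteratedDeriv_const, hk]

theorem nilShift_algebraMap (ν : A) (u : ℂ) :
    nilShift ν (fun v => algebraMap ℂ A v) u = algebraMap ℂ A u + ν := by
  have hd : deriv (fun v => algebraMap ℂ A v) = fun _ => (1 : A) := by
    funext v
    simpa [Algebra.algebraMap_eq_smul_one] using
      ((hasDerivAt_id v).smul_const (1 : A)).deriv
  rw [nilShift, tsum_eq_sum (s := {0, 1})]
  · simp [hd]
  · intro k hk
    obtain ⟨k, rfl⟩ : ∃ j, k = j + 2 := ⟨k - 2, by simp at hk; lia⟩
    rw [iteratedDeriv_succ', hd]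
    simp [iteratedDeriv_const]

theorem differentiable_algebraMap {F : ℂ → ℂ} (hF : Differentiable ℂ F) :
    Differentiable ℂ fun v => algebraMap ℂ A (F v) := by
  simp only [Algebra.algebraMap_eq_smul_one]
  exact hF.smul_const 1

theorem locallyDominated_taylor {F : ℂ → ℂ} (hF : Differentiable ℂ F) :
    LocallyDominated Set.univ fun (m : ℕ) (v : ℂ) =>
      algebraMap ℂ A (iteratedDeriv m F 0 / (m.factorial : ℂ) * v ^ m) := by
  intro w _
  have hs := (Complex.hasSum_taylorSeries_of_entire hF 0 ((‖w‖ + 1 : ℝ) : ℂ)).summable.norm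
  refine ⟨1, one_pos, _, hs.mul_right ‖(1 : A)‖, fun m v hv => ?_⟩
  rw [norm_algebraMap]
  refine mul_le_mul_of_nonneg_right ?_ (norm_nonneg _)
  have hv' : ‖v‖ ≤ ‖w‖ + 1 := by
    rw [mem_ball_iff_norm] at hv
    linarith [norm_le_norm_add_norm_sub' v w]
  simp only [sub_zero, smul_eq_mul, norm_mul, norm_div, norm_pow, norm_inv, Complex.norm_real,
    Real.norm_eq_abs, abs_of_nonneg (by positivity : 0 ≤ ‖w‖ + 1)]
  calc _ = ‖(m.factorial : ℂ)‖⁻¹ * (‖v‖ ^ m * ‖iteratedDeriv m F 0‖) := by ring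
    _ ≤ _ := by gcongr

variable [CompleteSpace A]

theorem differentiable_iteratedDeriv {f : ℂ → A} (hf : Differentiable ℂ f) (k : ℕ) :
    Differentiable ℂ (iteratedDeriv k f) := by
  induction k with
  | zero => simpa using hf
  | succ k ih => simpa only [iteratedDeriv_succ] using ih.deriv

/-- Multiplicativity of the translation by a nilpotent element, from the Leibniz rule. -/
theorem nilShift_mul {ν : A} (hν : IsNilpotent ν) {f g : ℂ → A} (hf : Differentiable ℂ f)
    (hg : Differentiable ℂ g) (u : ℂ) :
    nilShift ν (fun v => f v * g v) u = nilShift ν f u * nilShift ν g u := by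
  obtain ⟨N, hN⟩ := hν
  have hN2 : ν ^ (2 * N) = 0 := pow_eq_zero_of_le (by lia) hN
  rw [nilShift_eq_sum hN2, nilShift_eq_sum hN, nilShift_eq_sum hN, Finset.sum_mul_sum,
    ← sum_antidiagonal_eq_sum_square]
  · refine Finset.sum_congr rfl fun m _ => ?_
    have : iteratedDeriv m (fun v => f v * g v) u = ∑ i ∈ Finset.range (m + 1),
        m.choose i * iteratedDeriv i f u * iteratedDeriv (m - i) g u :=
      iteratedDeriv_mul hf.contDiff.contDiffAt hg.contDiff.contDiffAt
    rw [this, Finset.Nat.sum_antidiagonal_eq_sum_range_succ_mk, Finset.mul_sum, Finset.smul_sum]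
    refine Finset.sum_congr rfl fun i hi => ?_
    have hi' : i ≤ m := by simpa [Nat.lt_succ_iff] using hi
    have hc : (m.choose i : A) = algebraMap ℂ A (m.choose i : ℂ) := by simp
    have hfac : ((m.factorial : ℂ)⁻¹) * (m.choose i : ℂ) =
        ((i.factorial : ℂ)⁻¹) * (((m - i).factorial : ℂ)⁻¹) := by
      rw [Nat.cast_choose ℂ hi']
      have h1 : (m.factorial : ℂ) ≠ 0 := by exact_mod_cast m.factorial_ne_zero
      field_simp
    rw [hc, show ν ^ m = ν ^ i * ν ^ (m - i) by rw [← pow_add]; congr 1; lia]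
    rw [← Algebra.smul_def, smul_mul_assoc, mul_smul_comm, smul_smul, hfac, smul_mul_smul_comm]
    congr 1
    ring
  · intro i j hi
    simp [pow_eq_zero_of_le hi hN]
  · intro i j hj
    simp [pow_eq_zero_of_le hj hN]

theorem nilShift_algebraMap_pow {ν : A} (hν : IsNilpotent ν) (m : ℕ) (u : ℂ) :
    nilShift ν (fun v => algebraMap ℂ A (v ^ m)) u = (algebraMap ℂ A u + ν) ^ m := by
  induction m with
  | zero => simpa using nilShift_const ν 1 u
  | succ m ih =>
    simp only [pow_succ, map_mul] at ih ⊢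
    rw [nilShift_mul hν, ih, nilShift_algebraMap]
    · exact differentiable_algebraMap (differentiable_id.pow m)
    · exact differentiable_algebraMap differentiable_id

theorem nilShift_const_mul {ν : A} (hν : IsNilpotent ν) (a : A) {f : ℂ → A}
    (hf : Differentiable ℂ f) (u : ℂ) :
    nilShift ν (fun v => a * f v) u = a * nilShift ν f u := by
  rw [nilShift_mul hν (differentiable_const a) hf, nilShift_const]

theorem nilShift_prod {κ : Type*} {ν : A} (hν : IsNilpotent ν) (s : Finset κ) {f : κ → ℂ → A}
    (hf : ∀ i, Differentiable ℂ (f i)) (u : ℂ) :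
    nilShift ν (fun v => ∏ i ∈ s, f i v) u = ∏ i ∈ s, nilShift ν (f i) u := by
  classical
  induction s using Finset.induction_on with
  | empty => simpa using nilShift_const ν 1 u
  | insert i s hi ih =>
    simp only [Finset.prod_insert hi]
    rw [nilShift_mul hν (hf i) (Differentiable.fun_finsetProd fun j _ => hf j), ih]

theorem nilShift_sum {κ : Type*} {ν : A} (hν : IsNilpotent ν) (s : Finset κ) {f : κ → ℂ → A}
    (hf : ∀ i, Differentiable ℂ (f i)) (u : ℂ) :
    nilShift ν (fun v => ∑ i ∈ s, f i v) u = ∑ i ∈ s, nilShift ν (f i) u := by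
  obtain ⟨N, hN⟩ := hν
  simp only [nilShift_eq_sum hN]
  rw [Finset.sum_comm]
  refine Finset.sum_congr rfl fun k _ => ?_
  rw [iteratedDeriv_fun_sum fun i _ => (hf i).contDiff.contDiffAt, Finset.mul_sum, Finset.smul_sum]

/-- Translations compose additively, from the binomial theorem. -/
theorem nilShift_nilShift {ν μ : A} (hν : IsNilpotent ν) (hμ : IsNilpotent μ) {f : ℂ → A}
    (hf : Differentiable ℂ f) (u : ℂ) :
    nilShift ν (nilShift μ f) u = nilShift (ν + μ) f u := by
  obtain ⟨N₁, hN₁⟩ := hν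
  obtain ⟨N₂, hN₂⟩ := hμ
  set N := max N₁ N₂
  have h1 : ν ^ N = 0 := pow_eq_zero_of_le (le_max_left _ _) hN₁
  have h2 : μ ^ N = 0 := pow_eq_zero_of_le (le_max_right _ _) hN₂
  have h3 : (ν + μ) ^ (2 * N) = 0 := by
    refine (Commute.all ν μ).add_pow_eq_zero_of_add_le_succ_of_pow_eq_zero h1 h2 ?_
    lia
  have hfun : nilShift μ f = fun u =>
      ∑ k ∈ Finset.range N, ((k.factorial : ℂ)⁻¹) • (μ ^ k * iteratedDeriv k f u) :=
    funext fun u => nilShift_eq_sum h2 f u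
  have hcd := differentiable_iteratedDeriv hf
  have hder : ∀ i, iteratedDeriv i (nilShift μ f) u = ∑ k ∈ Finset.range N,
      ((k.factorial : ℂ)⁻¹) • (μ ^ k * iteratedDeriv (i + k) f u) := by
    intro i
    rw [hfun, iteratedDeriv_fun_sum]
    · refine Finset.sum_congr rfl fun k _ => ?_
      rw [iteratedDeriv_fun_const_smul (contDiff_const.mul (hcd k).contDiff).contDiffAt,
        iteratedDeriv_const_mul _ (hcd k).contDiff.contDiffAt]
      simp only [iteratedDeriv_eq_iterate, ← Function.iterate_add_apply]
    · intro k _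
      exact ((contDiff_const.mul (hcd k).contDiff).const_smul _).contDiffAt
  rw [nilShift_eq_sum h1, nilShift_eq_sum h3]
  simp only [hder, Finset.mul_sum, Finset.smul_sum]
  rw [← sum_antidiagonal_eq_sum_square]
  · refine Finset.sum_congr rfl fun m _ => ?_
    rw [(Commute.all ν μ).add_pow', Finset.sum_mul, Finset.smul_sum]
    refine Finset.sum_congr rfl fun p hp => ?_
    rw [Finset.HasAntidiagonal.mem_antidiagonal] at hp
    subst hp
    have hfac : (((p.1 + p.2).factorial : ℂ)⁻¹) * ((p.1 + p.2).choose p.1 : ℂ) =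
        ((p.1.factorial : ℂ)⁻¹) * ((p.2.factorial : ℂ)⁻¹) := by
      rw [Nat.cast_add_choose ℂ]
      have h1 : ((p.1 + p.2).factorial : ℂ) ≠ 0 := by exact_mod_cast Nat.factorial_ne_zero _
      field_simp
    rw [← Nat.cast_smul_eq_nsmul ℂ, smul_mul_assoc, smul_smul, hfac, mul_smul_comm, smul_smul,
      mul_assoc]
  · intro i j hi
    simp [pow_eq_zero_of_le hi h1]
  · intro i j hj
    simp [pow_eq_zero_of_le hj h2]

theorem differentiable_nilShift {ν : A} (hν : IsNilpotent ν) {f : ℂ → A}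
    (hf : Differentiable ℂ f) : Differentiable ℂ (nilShift ν f) := by
  obtain ⟨N, hN⟩ := hν
  rw [show nilShift ν f = _ from funext fun u => nilShift_eq_sum hN f u]
  exact Differentiable.fun_sum fun k _ =>
    Differentiable.fun_const_smul ((differentiable_iteratedDeriv hf k).const_mul _) _

theorem nilShift_comp_affine {ν : A} {f : ℂ → A} (hf : Differentiable ℂ f) (c p u : ℂ) :
    nilShift ν (fun v => f (c * v + p)) u = nilShift (c • ν) f (c * u + p) := by
  refine tsum_congr fun k => ?_
  have h1 := congrFun (iteratedDeriv_comp_const_smul (n := k) (f := fun v => f (v + p))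
    (hf.comp (differentiable_id.add_const p)).contDiff c) u
  rw [iteratedDeriv_comp_add_const] at h1
  simp only at h1
  rw [h1, smul_pow, mul_smul_comm, smul_mul_assoc]

/-- A translation by a nilpotent element is a differential operator of finite order, so it can be
applied termwise to a locally dominated series. -/
theorem nilShift_tsum {ι : Type*} {ν : A} (hν : IsNilpotent ν) {f : ι → ℂ → A}
    (hf : ∀ i, Differentiable ℂ (f i)) (h : LocallyDominated Set.univ f) (u : ℂ) :
    HasSum (fun i => nilShift ν (f i) u) (nilShift ν (fun v => ∑' i, f i v) u) := by
  obtain ⟨N, hN⟩ := hν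
  simp only [nilShift_eq_sum hN]
  exact hasSum_sum fun k _ => ((h.hasSum_iteratedDeriv k hf u).mul_left _).const_smul _

/-- The norm of `F(u + ν)` is controlled by the values of `F` on the unit disc around `u`. -/
theorem exists_norm_nilShift_le {ν : A} (hν : IsNilpotent ν) :
    ∃ C : ℝ, 0 ≤ C ∧ ∀ F : ℂ → ℂ, Differentiable ℂ F → ∀ (u : ℂ) (M : ℝ),
      (∀ v ∈ Metric.sphere u 1, ‖F v‖ ≤ M) →
        ‖nilShift ν (fun v => algebraMap ℂ A (F v)) u‖ ≤ C * M := by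
  obtain ⟨N, hN⟩ := hν
  refine ⟨∑ k ∈ Finset.range N, ‖ν ^ k‖ * ‖(1 : A)‖,
    Finset.sum_nonneg fun _ _ => by positivity, fun F hF u M hM => ?_⟩
  rw [nilShift_eq_sum hN, Finset.sum_mul]
  refine norm_sum_le_of_le _ fun k _ => ?_
  have hd : ‖iteratedDeriv k (fun v => algebraMap ℂ A (F v)) u‖ ≤
      k.factorial * (M * ‖(1 : A)‖) / 1 ^ k := by
    refine norm_iteratedDeriv_le_of_forall_mem_sphere_norm_le k one_pos
      (differentiable_algebraMap hF).diffContOnCl fun z hz => ?_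
    rw [norm_algebraMap]
    exact mul_le_mul_of_nonneg_right (hM z hz) (norm_nonneg _)
  rw [one_pow, div_one] at hd
  have hk : (0 : ℝ) < k.factorial := by exact_mod_cast k.factorial_pos
  calc ‖((k.factorial : ℂ)⁻¹) • (ν ^ k * iteratedDeriv k (fun v => algebraMap ℂ A (F v)) u)‖
      ≤ (k.factorial : ℝ)⁻¹ * (‖ν ^ k‖ * (k.factorial * (M * ‖(1 : A)‖))) := by
        rw [norm_smul, norm_inv, Complex.norm_natCast]
        gcongr
        exact (norm_mul_le _ _).trans (by gcongr)
    _ = ‖ν ^ k‖ * ‖(1 : A)‖ * M := by field_simp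

/-- Re-expansion of `F` at a point `p` of the complex plane: `F(p + ν)` is a finite sum. -/
theorem entireEval_add_nilpotent {F : ℂ → ℂ} (hF : Differentiable ℂ F) {ν : A}
    (hν : IsNilpotent ν) (p : ℂ) :
    entireEval F (algebraMap ℂ A p + ν) = nilShift ν (fun v => algebraMap ℂ A (F v)) p := by
  have hsum : (fun v => algebraMap ℂ A (F v)) = fun v => ∑' m : ℕ,
      algebraMap ℂ A (iteratedDeriv m F 0 / (m.factorial : ℂ) * v ^ m) := by
    funext v
    have h := (Complex.hasSum_taylorSeries_of_entire hF 0 v).smul_const (1 : A)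
    rw [Algebra.algebraMap_eq_smul_one, ← h.tsum_eq]
    refine tsum_congr fun m => ?_
    rw [Algebra.algebraMap_eq_smul_one]
    congr 1
    simp only [sub_zero, smul_eq_mul]
    ring
  rw [hsum, ← (nilShift_tsum hν (fun m => differentiable_algebraMap (by fun_prop))
    (locallyDominated_taylor hF) p).tsum_eq]
  refine tsum_congr fun m => ?_
  simp only [map_mul (algebraMap ℂ A)]
  rw [nilShift_const_mul hν _ (differentiable_algebraMap (by fun_prop)),
    nilShift_algebraMap_pow hν, ← Algebra.smul_def]

section Affine

variable {F : ℂ → ℂ} {P : A} {p : ℂ}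

theorem entireEval_affine_eq (hF : Differentiable ℂ F) (hP : IsNilpotent (P - algebraMap ℂ A p))
    (c u : ℂ) :
    entireEval F (P + algebraMap ℂ A (c * u)) =
      nilShift (P - algebraMap ℂ A p) (fun v => algebraMap ℂ A (F v)) (c * u + p) := by
  rw [← entireEval_add_nilpotent hF hP, map_add]
  congr 1
  ring

theorem differentiable_entireEval_affine (hF : Differentiable ℂ F)
    (hP : IsNilpotent (P - algebraMap ℂ A p)) (c : ℂ) :
    Differentiable ℂ fun u => entireEval F (P + algebraMap ℂ A (c * u)) := by
  simp only [entireEval_affine_eq hF hP]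
  exact (differentiable_nilShift hP (differentiable_algebraMap hF)).comp (by fun_prop)

/-- The map `u ↦ F(P + cu)` from `ℂ` to `A` extends to `A` as expected. -/
theorem nilShift_entireEval_affine (hF : Differentiable ℂ F)
    (hP : IsNilpotent (P - algebraMap ℂ A p)) {ν : A} (hν : IsNilpotent ν) (c u : ℂ) :
    nilShift ν (fun v => entireEval F (P + algebraMap ℂ A (c * v))) u =
      entireEval F (P + c • (algebraMap ℂ A u + ν)) := by
  have hF' := differentiable_algebraMap (A := A) hF
  have hcν : IsNilpotent (c • ν) := hν.smul c
  simp only [entireEval_affine_eq hF hP]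
  rw [nilShift_comp_affine (differentiable_nilShift hP hF'), nilShift_nilShift hcν hP hF',
    ← entireEval_add_nilpotent hF ((Commute.all _ _).isNilpotent_add hcν hP)]
  congr 1
  rw [map_add, map_mul, smul_add, ← Algebra.smul_def]
  ring

end Affine

end NilShift

/-! ### The growth of the reciprocal Gamma function -/

section GammaBounds

theorem norm_betaIntegral_le_one {u v : ℂ} (hu : 1 ≤ u.re) (hv : 1 ≤ v.re) :
    ‖betaIntegral u v‖ ≤ 1 := by
  have h := intervalIntegral.norm_integral_le_of_norm_le_const (a := 0) (b := 1) (C := 1)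
    (f := fun x : ℝ => (x : ℂ) ^ (u - 1) * (1 - (x : ℂ)) ^ (v - 1)) fun x hx => by
      rw [Set.uIoc_of_le zero_le_one] at hx
      rw [norm_mul]
      have h1 : ‖(x : ℂ) ^ (u - 1)‖ ≤ 1 := by
        rw [Complex.norm_cpow_eq_rpow_re_of_pos hx.1]
        exact Real.rpow_le_one hx.1.le hx.2 (by simpa using hu)
      have h2 : ‖(1 - (x : ℂ)) ^ (v - 1)‖ ≤ 1 := by
        rcases hx.2.eq_or_lt with rfl | hlt
        · by_cases hv1 : v = 1
          · simp [hv1]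
          · simp [Complex.zero_cpow (sub_ne_zero.2 hv1)]
        · rw [show (1 - (x : ℂ)) = ((1 - x : ℝ) : ℂ) by push_cast; rfl,
            Complex.norm_cpow_eq_rpow_re_of_pos (by linarith)]
          exact Real.rpow_le_one (by linarith) (by linarith [hx.1]) (by simpa using hv)
      exact mul_le_one₀ h1 (norm_nonneg _) h2
  simpa [betaIntegral] using h

theorem norm_sin_le_exp (z : ℂ) : ‖sin z‖ ≤ Real.exp |z.im| := by
  have h1 : ‖exp (-z * I)‖ ≤ Real.exp |z.im| := by
    rw [Complex.norm_exp]
    exact Real.exp_le_exp.2 (by simpa using le_abs_self z.im)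
  have h2 : ‖exp (z * I)‖ ≤ Real.exp |z.im| := by
    rw [Complex.norm_exp]
    exact Real.exp_le_exp.2 (by simpa using neg_le_abs z.im)
  rw [Complex.sin, norm_div, norm_mul, norm_I, mul_one, Complex.norm_ofNat]
  linarith [norm_sub_le (exp (-z * I)) (exp (z * I))]

theorem inv_Gamma_eq_mul_sin {q : ℂ} (hq : q.re ≤ 0) :
    (Gamma q)⁻¹ = Gamma (1 - q) * (sin (Real.pi * q) / Real.pi) := by
  have h := Complex.Gamma_mul_Gamma_one_sub q
  have hpi : (Real.pi : ℂ) ≠ 0 := by exact_mod_cast Real.pi_ne_zero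
  have hG' : Gamma (1 - q) ≠ 0 := Gamma_ne_zero_of_re_pos (by simp; linarith)
  by_cases hs : sin (Real.pi * q) = 0
  · rw [hs] at h ⊢
    -- at the poles of `Γ`, Mathlib's convention `Γ(-m) = 0` makes both sides vanish
    simpa [hG'] using h
  · have hG : Gamma q ≠ 0 := by
      intro h0
      rw [h0, zero_mul] at h
      exact div_ne_zero hpi hs h.symm
    rw [eq_div_iff hs] at h
    rw [← mul_div_assoc, eq_div_iff hpi, inv_mul_eq_iff_eq_mul₀ hG]
    linear_combination -h

/-- By the reflection formula,
`1/Γ(p) · 1/Γ(q) = sin(πq)/π · B(1 - q, p + q - 1) / Γ(p + q - 1)`. -/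
theorem norm_inv_Gamma_mul_le {p q : ℂ} (hq : q.re ≤ 0) (hs : 2 ≤ (p + q).re) :
    ‖(Gamma p)⁻¹ * (Gamma q)⁻¹‖ ≤ Real.exp (Real.pi * |q.im|) * ‖(Gamma (p + q - 1))⁻¹‖ := by
  rw [add_re] at hs
  have hB := Complex.Gamma_mul_Gamma_eq_betaIntegral (s := 1 - q) (t := p + q - 1)
    (by simp; linarith) (by simp; linarith)
  rw [show 1 - q + (p + q - 1) = p by ring] at hB
  have hp : Gamma p ≠ 0 := Gamma_ne_zero_of_re_pos (by linarith)
  have hpq : Gamma (p + q - 1) ≠ 0 := Gamma_ne_zero_of_re_pos (by simp; linarith)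
  have hpi : (Real.pi : ℂ) ≠ 0 := by exact_mod_cast Real.pi_ne_zero
  have key : (Gamma p)⁻¹ * (Gamma q)⁻¹ =
      sin (Real.pi * q) * ((Real.pi : ℂ)⁻¹ * betaIntegral (1 - q) (p + q - 1)) *
        (Gamma (p + q - 1))⁻¹ := by
    rw [inv_Gamma_eq_mul_sin hq, mul_comm (Real.pi : ℂ) q]
    field_simp
    linear_combination sin (q * Real.pi) * hB
  rw [key, norm_mul, norm_mul, norm_mul]
  refine mul_le_mul_of_nonneg_right ?_ (norm_nonneg _)
  have h1 : ‖sin (Real.pi * q)‖ ≤ Real.exp (Real.pi * |q.im|) := by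
    refine (norm_sin_le_exp _).trans_eq ?_
    simp [abs_mul, abs_of_pos Real.pi_pos]
  have h2 : ‖betaIntegral (1 - q) (p + q - 1)‖ ≤ 1 :=
    norm_betaIntegral_le_one (by simp; linarith) (by simp; linarith)
  have h3 : ‖(Real.pi : ℂ)⁻¹‖ ≤ 1 := by
    rw [norm_inv, Complex.norm_real, Real.norm_of_nonneg Real.pi_pos.le]
    exact inv_le_one_of_one_le₀ (by linarith [Real.pi_gt_three])
  calc _ ≤ Real.exp (Real.pi * |q.im|) * (1 * 1) := by gcongr
    _ = _ := by ring

theorem inv_Gamma_eq_mul (p : ℂ) : (Gamma p)⁻¹ = p * (Gamma (p + 1))⁻¹ :=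
  one_div_Gamma_eq_self_mul_one_div_Gamma_add_one p

theorem exists_bound_of_bounded {g : ℂ × ℂ → ℂ} (hg : Continuous g) (R : ℝ) :
    ∃ C : ℝ, 0 ≤ C ∧ ∀ p q : ℂ, ‖p‖ ≤ R → ‖q‖ ≤ R → ‖g (p, q)‖ ≤ C := by
  obtain ⟨C, hC⟩ := ((isCompact_closedBall (0 : ℂ) R).prod
    (isCompact_closedBall (0 : ℂ) R)).exists_bound_of_continuousOn hg.continuousOn
  refine ⟨max C 0, le_max_right _ _, fun p q hp hq => (hC (p, q) ⟨?_, ?_⟩).trans (le_max_left _ _)⟩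
  · simpa using hp
  · simpa using hq

/-- The reflection formula and the beta integral treat `Re q ≤ 0`; the recurrence
`1/Γ(p) · 1/Γ(q) = p/(q - 1) · 1/Γ(p + 1) · 1/Γ(q - 1)` extends the bound to the right. -/
theorem exists_norm_inv_Gamma_mul_le_of_re_le (M : ℝ) (N : ℕ) :
    ∃ C : ℝ, 0 ≤ C ∧ ∀ p q : ℂ, q.re ≤ N → 2 ≤ (p + q).re → ‖p + q‖ ≤ M →
      ‖(Gamma p)⁻¹ * (Gamma q)⁻¹‖ ≤ C * Real.exp (Real.pi * |q.im|) := by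
  have hcont : Continuous fun s : ℂ => (Gamma s)⁻¹ := differentiable_one_div_Gamma.continuous
  induction N with
  | zero =>
    obtain ⟨C, hC0, hC⟩ := exists_bound_of_bounded (g := fun x => (Gamma x.1)⁻¹)
      (hcont.comp continuous_fst) (M + 1)
    refine ⟨C, hC0, fun p q hq hs hM => ?_⟩
    refine (norm_inv_Gamma_mul_le (by simpa using hq) hs).trans ?_
    rw [mul_comm]
    have := hC (p + q - 1) 0 ((norm_sub_le _ _).trans (by simpa using hM))
      (by rw [norm_zero]; linarith [norm_nonneg (p + q)])
    gcongr
  | succ N ih =>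
    obtain ⟨C, hC0, hC⟩ := ih
    obtain ⟨C', hC0', hC'⟩ := exists_bound_of_bounded
      (g := fun x => (Gamma x.1)⁻¹ * (Gamma x.2)⁻¹)
      ((hcont.comp continuous_fst).mul (hcont.comp continuous_snd)) (M + N + 2)
    refine ⟨C * (|M| + 2) + C', by positivity, fun p q hq hs hM => ?_⟩
    have hM0 : 0 ≤ M := (norm_nonneg _).trans hM
    rw [abs_of_nonneg hM0]
    have hexp : 1 ≤ Real.exp (Real.pi * |q.im|) := Real.one_le_exp (by positivity)
    rcases le_or_gt q.re N with hqN | hqN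
    · refine (hC p q hqN hs hM).trans ?_
      gcongr
      nlinarith
    -- the recurrence is used away from its pole `q = 1`; near the real axis `p` and `q` are bounded
    rcases le_or_gt 1 |q.im| with him | him
    · have hq1 : 1 ≤ ‖q - 1‖ := by
        have := Complex.abs_im_le_norm (q - 1)
        simp at this
        linarith
      have hq0 : q - 1 ≠ 0 := by
        intro h
        rw [h, norm_zero] at hq1
        linarith
      have hrec : (Gamma p)⁻¹ * (Gamma q)⁻¹ =
          (p / (q - 1)) * ((Gamma (p + 1))⁻¹ * (Gamma (q - 1))⁻¹) := by
        rw [inv_Gamma_eq_mul p, inv_Gamma_eq_mul (q - 1), sub_add_cancel]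
        field_simp
      have hp : ‖p‖ ≤ (M + 2) * ‖q - 1‖ := by
        have : p = (p + q) - (q - 1) - 1 := by ring
        calc ‖p‖ = ‖(p + q) - (q - 1) - 1‖ := by rw [← this]
          _ ≤ ‖p + q‖ + ‖q - 1‖ + ‖(1 : ℂ)‖ :=
            (norm_sub_le _ _).trans (by gcongr; exact norm_sub_le _ _)
          _ ≤ _ := by rw [norm_one]; nlinarith
      have hpq : ‖p / (q - 1)‖ ≤ M + 2 := by
        rw [norm_div, div_le_iff₀ (by linarith)]
        exact hp
      have hI := hC (p + 1) (q - 1) (by simp; push_cast at hq; linarith)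
        (by rwa [show p + 1 + (q - 1) = p + q by ring])
        (by rwa [show p + 1 + (q - 1) = p + q by ring])
      rw [hrec, norm_mul]
      have him' : (q - 1).im = q.im := by simp
      rw [him'] at hI
      calc _ ≤ (M + 2) * (C * Real.exp (Real.pi * |q.im|)) := by gcongr
        _ ≤ _ := by nlinarith
    · have hqn : ‖q‖ ≤ N + 2 := by
        refine (Complex.norm_le_abs_re_add_abs_im q).trans ?_
        rw [abs_of_nonneg (by linarith [(Nat.cast_nonneg N : (0 : ℝ) ≤ N)])]
        push_cast at hq
        linarith
      have hpn : ‖p‖ ≤ M + N + 2 := by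
        have : p = (p + q) - q := by ring
        rw [this]
        exact (norm_sub_le _ _).trans (by linarith)
      refine (hC' p q hpn (by linarith)).trans ?_
      nlinarith [mul_nonneg hC0 (by linarith : 0 ≤ M + 2)]

theorem exists_norm_inv_Gamma_mul_le (M : ℝ) :
    ∃ C : ℝ, 0 ≤ C ∧ ∀ p q : ℂ, 2 ≤ (p + q).re → ‖p + q‖ ≤ M →
      ‖(Gamma p)⁻¹ * (Gamma q)⁻¹‖ ≤ C * Real.exp (Real.pi * |q.im|) := by
  obtain ⟨N, hN⟩ := exists_nat_ge M
  obtain ⟨C₁, hC₁, h₁⟩ := exists_norm_inv_Gamma_mul_le_of_re_le M N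
  obtain ⟨C₂, hC₂, h₂⟩ := exists_norm_inv_Gamma_mul_le_of_re_le M 0
  refine ⟨C₁ + C₂ * Real.exp (Real.pi * M), by positivity, fun p q hs hM => ?_⟩
  rcases le_or_gt q.re N with hq | hq
  · refine (h₁ p q hq hs hM).trans ?_
    gcongr
    linarith [show 0 ≤ C₂ * Real.exp (Real.pi * M) by positivity]
  · -- far to the right in `q`, exchange the roles of `p` and `q`
    have hp : p.re ≤ 0 := by
      have := (Complex.abs_re_le_norm (p + q)).trans hM
      rw [add_re] at this
      linarith [le_abs_self (p.re + q.re)]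
    have h := h₂ q p (by simpa using hp) (by rwa [add_comm]) (by rwa [add_comm])
    rw [mul_comm]
    refine h.trans ?_
    have him : |p.im| ≤ M + |q.im| := by
      have h3 := (Complex.abs_im_le_norm (p + q)).trans hM
      rw [add_im] at h3
      have : p.im = (p.im + q.im) - q.im := by ring
      rw [this]
      exact (abs_sub _ _).trans (by linarith)
    have he : Real.exp (Real.pi * |p.im|) ≤
        Real.exp (Real.pi * M) * Real.exp (Real.pi * |q.im|) := by
      rw [← Real.exp_add, ← mul_add]
      gcongr
    calc _ ≤ C₂ * (Real.exp (Real.pi * M) * Real.exp (Real.pi * |q.im|)) := by gcongr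
      _ ≤ _ := by
        have : 0 ≤ C₁ * Real.exp (Real.pi * |q.im|) := by positivity
        nlinarith

theorem one_add_sq_le_mul (p : ℂ) : 1 + ‖p‖ ^ 2 ≤ 20 * (1 + ‖(p - 1) * (p - 2)‖) := by
  have h1 : ‖p‖ - 1 ≤ ‖p - 1‖ := by simpa using norm_sub_norm_le p 1
  have h2 : ‖p‖ - 2 ≤ ‖p - 2‖ := by simpa using norm_sub_norm_le p 2
  rw [norm_mul]
  rcases le_or_gt ‖p‖ 4 with h | h
  · have : 0 ≤ ‖p - 1‖ * ‖p - 2‖ := by positivity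
    nlinarith [norm_nonneg p]
  · nlinarith [mul_le_mul h1 h2 (by linarith) (norm_nonneg _)]

/-- For `p + q` in a bounded set with large real part, `1/Γ(p) · 1/Γ(q)` has exponential type `π`
and decays quadratically in horizontal directions. -/
theorem exists_norm_inv_Gamma_mul_le_decay (M : ℝ) :
    ∃ C : ℝ, 0 ≤ C ∧ ∀ p q : ℂ, 4 ≤ (p + q).re → ‖p + q‖ ≤ M →
      ‖(Gamma p)⁻¹‖ * ‖(Gamma q)⁻¹‖ ≤ C * Real.exp (Real.pi * |q.im|) / (1 + ‖p‖ ^ 2) := by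
  -- the bound is applied at `p` and at `p - 2`, where `1/Γ(p - 2) = (p - 1)(p - 2)/Γ(p)`
  obtain ⟨C, hC0, hC⟩ := exists_norm_inv_Gamma_mul_le (M + 2)
  refine ⟨20 * (C + C), by positivity, fun p q hs hM => ?_⟩
  rw [← norm_mul, le_div_iff₀ (by positivity)]
  have h1 := hC p q (by linarith) (by linarith)
  have hshift : p - 2 + q = p + q - 2 := by ring
  have h2 := hC (p - 2) q (by rw [hshift, sub_re, re_ofNat]; linarith)
    (by rw [hshift]; exact (norm_sub_le _ _).trans (by simpa using hM))
  have hrec : (Gamma (p - 2))⁻¹ = (p - 1) * (p - 2) * (Gamma p)⁻¹ := by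
    rw [inv_Gamma_eq_mul (p - 2), show p - 2 + 1 = p - 1 by ring, inv_Gamma_eq_mul (p - 1),
      show p - 1 + 1 = p by ring]
    ring
  rw [hrec, mul_assoc, norm_mul] at h2
  have h3 := one_add_sq_le_mul p
  set x := ‖(Gamma p)⁻¹ * (Gamma q)⁻¹‖
  have hx : 0 ≤ x := norm_nonneg _
  calc x * (1 + ‖p‖ ^ 2) ≤ x * (20 * (1 + ‖(p - 1) * (p - 2)‖)) := by gcongr
    _ = 20 * (x + ‖(p - 1) * (p - 2)‖ * x) := by ring
    _ ≤ 20 * (C * Real.exp (Real.pi * |q.im|) + C * Real.exp (Real.pi * |q.im|)) := by gcongr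
    _ = _ := by ring

end GammaBounds

/-! ### Interpolation -/

section Interpolation

variable {R : Type*} [CommRing R] {n : ℕ} {X : Fin n → R}

theorem isUnit_det_vandermonde (hX : ∀ i j, i ≠ j → IsUnit (X i - X j)) :
    IsUnit (Matrix.vandermonde X).det := by
  rw [Matrix.det_vandermonde]
  refine IsUnit.prod_univ_iff.2 fun i => (IsUnit.prod_iff).2 fun j hj => hX j i ?_
  exact (Finset.mem_Ioi.1 hj).ne'

theorem exists_interpolation (hX : ∀ i j, i ≠ j → IsUnit (X i - X j)) (v : Fin n → R) :
    ∃ c : Fin n → R, ∀ j, ∑ k : Fin n, c k * X j ^ (k : ℕ) = v j := by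
  have hu := (Matrix.isUnit_iff_isUnit_det _).2 (isUnit_det_vandermonde hX)
  obtain ⟨c, hc⟩ := Matrix.mulVec_surjective_iff_isUnit.2 hu v
  refine ⟨c, fun j => ?_⟩
  rw [← hc]
  simp [Matrix.mulVec, dotProduct, Matrix.vandermonde_apply, mul_comm]

theorem eq_zero_of_interpolation (hX : ∀ i j, i ≠ j → IsUnit (X i - X j)) {c : Fin n → R}
    (hc : ∀ j, ∑ k : Fin n, c k * X j ^ (k : ℕ) = 0) : c = 0 := by
  have hu := (Matrix.isUnit_iff_isUnit_det _).2 (isUnit_det_vandermonde hX)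
  refine Matrix.mulVec_injective_of_isUnit hu ?_
  funext j
  simpa [Matrix.mulVec, dotProduct, Matrix.vandermonde_apply, mul_comm] using hc j

/-- Lagrange interpolation over a commutative ring, at nodes whose differences are units. -/
theorem lagrange_interpolation (hX : ∀ i j, i ≠ j → IsUnit (X i - X j)) (c : Fin n → R) (y : R) :
    ∑ k : Fin n, c k * y ^ (k : ℕ) = ∑ j : Fin n, (∑ k : Fin n, c k * X j ^ (k : ℕ)) *
      ∏ i ∈ Finset.univ.erase j, ((y - X i) * Ring.inverse (X j - X i)) := by
  classical
  open Polynomial in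
  let p : R[X] := ∑ k : Fin n, Polynomial.C (c k) * Polynomial.X ^ (k : ℕ) -
    ∑ j : Fin n, Polynomial.C (∑ k : Fin n, c k * X j ^ (k : ℕ)) *
      ∏ i ∈ Finset.univ.erase j,
        ((Polynomial.X - Polynomial.C (X i)) * Polynomial.C (Ring.inverse (X j - X i)))
  have heval : ∀ y, p.eval y = ∑ k : Fin n, c k * y ^ (k : ℕ) -
      ∑ j : Fin n, (∑ k : Fin n, c k * X j ^ (k : ℕ)) *
        ∏ i ∈ Finset.univ.erase j, ((y - X i) * Ring.inverse (X j - X i)) := by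
    intro y
    simp [p, Polynomial.eval_finsetSum, Polynomial.eval_prod]
  rcases Nat.eq_zero_or_pos n with rfl | hn
  · simp
  have hdeg : p.natDegree < n := by
    refine lt_of_le_of_lt (b := n - 1) ?_ (by lia)
    refine (Polynomial.natDegree_sub_le _ _).trans (max_le ?_ ?_)
    · refine Polynomial.natDegree_sum_le_of_forall_le _ _ fun k _ => ?_
      exact (Polynomial.natDegree_C_mul_X_pow_le _ _).trans (by lia)
    · refine Polynomial.natDegree_sum_le_of_forall_le _ _ fun j _ => ?_
      refine (Polynomial.natDegree_C_mul_le _ _).trans ?_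
      refine (Polynomial.natDegree_prod_le _ _).trans ?_
      refine (Finset.sum_le_card_nsmul _ _ 1 fun i _ => ?_).trans ?_
      · exact (Polynomial.natDegree_mul_C_le _ _).trans (Polynomial.natDegree_X_sub_C_le _)
      · simp [Finset.card_erase_of_mem]
  have hsum : ∀ y, p.eval y = ∑ k : Fin n, p.coeff k * y ^ (k : ℕ) := by
    intro y
    rw [Polynomial.eval_eq_sum_range' hdeg, Finset.sum_range]
  have hzero : ∀ j, p.eval (X j) = 0 := by
    intro j
    rw [heval, sub_eq_zero, eq_comm, Finset.sum_eq_single j, Finset.prod_eq_one, mul_one]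
    · intro i hi
      exact Ring.mul_inverse_cancel _ (hX j i (Finset.ne_of_mem_erase hi).symm)
    · intro i _ hij
      rw [Finset.prod_eq_zero (i := j), mul_zero]
      · simp [hij.symm]
      · simp
    · simp
  have hc := eq_zero_of_interpolation hX (c := fun k => p.coeff k) fun j => by
    rw [← hsum, hzero]
  have := heval y
  rw [hsum, Finset.sum_eq_zero fun k _ => by rw [show p.coeff k = 0 from congrFun hc k, zero_mul]]
    at this
  exact (sub_eq_zero.1 this.symm)

end Interpolation

/-! ### Antiperiodic entire functions of bounded exponential type -/

section Periodic

/-- An entire function vanishing at the zeros of `g`, all of which are simple, is divisible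
by `g`. -/
theorem exists_differentiable_eq_smul {E : Type*} [NormedAddCommGroup E] [NormedSpace ℂ E]
    [CompleteSpace E] {D : ℂ → E} {g : ℂ → ℂ} (hD : Differentiable ℂ D) (hg : Differentiable ℂ g)
    (hzero : ∀ u, g u = 0 → D u = 0) (hsimple : ∀ u, g u = 0 → deriv g u ≠ 0) :
    ∃ Q : ℂ → E, Differentiable ℂ Q ∧ ∀ u, D u = g u • Q u := by
  classical
  refine ⟨fun u => if g u = 0 then (deriv g u)⁻¹ • deriv D u else (g u)⁻¹ • D u, fun u₀ => ?_,
    fun u => ?_⟩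
  · by_cases h0 : g u₀ = 0
    · have hdD : DifferentiableAt ℂ (dslope D u₀) u₀ :=
        ((Complex.differentiableOn_dslope univ_mem).2 hD.differentiableOn).differentiableAt univ_mem
      have hdg : DifferentiableAt ℂ (dslope g u₀) u₀ :=
        ((Complex.differentiableOn_dslope univ_mem).2 hg.differentiableOn).differentiableAt univ_mem
      have hne : dslope g u₀ u₀ ≠ 0 := by simpa using hsimple u₀ h0
      refine ((hdg.inv hne).smul hdD).congr_of_eventuallyEq ?_
      filter_upwards [hdg.continuousAt.eventually_ne hne] with u hu
      have e1 : g u = (u - u₀) • dslope g u₀ u := by rw [sub_smul_dslope, h0, sub_zero]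
      have e2 : D u = (u - u₀) • dslope D u₀ u := by
        rw [sub_smul_dslope, hzero u₀ h0, sub_zero]
      by_cases huu : u = u₀
      · subst huu
        simp [h0]
      · have hsub : u - u₀ ≠ 0 := sub_ne_zero.2 huu
        have hgu : g u ≠ 0 := by
          rw [e1]
          exact smul_ne_zero hsub hu
        simp only [hgu, if_false, Pi.smul_apply', Pi.inv_apply]
        rw [e1, e2, smul_eq_mul, mul_inv, smul_smul, mul_assoc, mul_comm _ (u - u₀), ← mul_assoc,
          inv_mul_cancel₀ hsub, one_mul]
    · refine ((hg u₀).inv h0 |>.smul (hD u₀)).congr_of_eventuallyEq ?_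
      filter_upwards [(hg u₀).continuousAt.eventually_ne h0] with u hu
      simp [hu]
  · by_cases h0 : g u = 0
    · simp [h0, hzero u h0]
    · simp [h0, smul_smul]

theorem exp_abs_im_le_norm_sin {z : ℂ} (hz : 1 ≤ |z.im|) : Real.exp |z.im| ≤ 4 * ‖sin z‖ := by
  have hlow : Real.exp |z.im| - Real.exp (-|z.im|) ≤ 2 * ‖sin z‖ := by
    have h1 : ‖exp (-z * I)‖ = Real.exp z.im := by
      rw [Complex.norm_exp]; simp
    have h2 : ‖exp (z * I)‖ = Real.exp (-z.im) := by
      rw [Complex.norm_exp]; simp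
    have hs : ‖sin z‖ = ‖exp (-z * I) - exp (z * I)‖ / 2 := by
      rw [Complex.sin, norm_div, norm_mul, norm_I, mul_one, Complex.norm_ofNat]
    rw [hs, mul_div_cancel₀ _ two_ne_zero]
    rcases abs_cases z.im with ⟨h, _⟩ | ⟨h, _⟩
    · rw [h, ← h1, ← h2]
      exact norm_sub_norm_le _ _
    · rw [h, neg_neg, ← h1, ← h2, norm_sub_rev]
      exact norm_sub_norm_le _ _
  have h2 : 2 ≤ Real.exp |z.im| := by
    linarith [Real.add_one_le_exp |z.im|]
  have h3 : Real.exp (-|z.im|) ≤ 1 := Real.exp_le_one_iff.2 (by linarith)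
  linarith

variable {A : Type*} [NormedCommRing A] [NormedAlgebra ℂ A] [CompleteSpace A] {n : ℕ}

/-- The exponentials `e^{πiau}` for `a = -(n-1), -(n-3), …, n-1`: those of exponential type less
than `nπ` which `u ↦ u + 1` multiplies by `(-1)^{n-1}`. -/
def wave (n : ℕ) (k : Fin n) (u : ℂ) : ℂ :=
  exp (Real.pi * I * (2 * (k : ℂ) - (n - 1)) * u)

theorem differentiable_wave (k : Fin n) : Differentiable ℂ (wave n k) := by
  unfold wave
  fun_prop

theorem wave_add_one (hn : 0 < n) (k : Fin n) (u : ℂ) :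
    wave n k (u + 1) = (-1) ^ (n - 1) * wave n k u := by
  obtain ⟨N, rfl⟩ : ∃ N, n = N + 1 := ⟨n - 1, by lia⟩
  have h1 : exp (Real.pi * I * (2 * (k : ℂ) - N)) = (-1) ^ N := by
    rw [show (Real.pi * I * (2 * (k : ℂ) - N) : ℂ) =
      ((k : ℕ) : ℂ) * (2 * Real.pi * I) + (-((N : ℂ) * (Real.pi * I))) by ring, exp_add,
      exp_nat_mul, exp_two_pi_mul_I, one_pow, one_mul, exp_neg, exp_nat_mul, exp_pi_mul_I,
      ← inv_pow]
    norm_num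
  rw [wave, wave, mul_add, exp_add, mul_comm]
  congr 1
  push_cast
  rw [mul_one, ← h1]
  congr 1
  ring

theorem norm_wave_le (k : Fin n) (u : ℂ) :
    ‖wave n k u‖ ≤ Real.exp ((n - 1) * Real.pi * |u.im|) := by
  rw [wave, Complex.norm_exp]
  refine Real.exp_le_exp.2 ?_
  have h0 : ((Real.pi * I * (2 * (k : ℂ) - (n - 1)) * u) : ℂ).re =
      (-(2 * (k : ℝ) - (n - 1))) * (Real.pi * u.im) := by
    simp
    ring
  rw [h0]
  have h1 : |(-(2 * (k : ℝ) - (n - 1)))| ≤ (n : ℝ) - 1 := by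
    have hk : (k : ℝ) + 1 ≤ n := by exact_mod_cast k.2
    have hk0 : (0 : ℝ) ≤ (k : ℕ) := Nat.cast_nonneg _
    rw [abs_neg, abs_le]
    constructor <;> linarith
  calc _ ≤ |(-(2 * (k : ℝ) - (n - 1))) * (Real.pi * u.im)| := le_abs_self _
    _ = |(-(2 * (k : ℝ) - (n - 1)))| * (Real.pi * |u.im|) := by
      rw [abs_mul, abs_mul, abs_of_pos Real.pi_pos]
    _ ≤ (n - 1) * (Real.pi * |u.im|) := by
      gcongr
    _ = _ := by ring

/-- An entire function with `f(u + 1) = (-1)^{n-1} f(u)` and growth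
`O(e^{ψ Im u + nπ |Im u|})`, where `|ψ| < π`, is a combination of `n` exponentials: after
subtracting the combination that interpolates it at the points `j/n`, it is divisible by
`sin (nπu)`, and the quotient vanishes by Liouville's theorem. -/
theorem exists_eq_sum_wave (hn : 0 < n) {f : ℂ → A} (hf : Differentiable ℂ f) {C ψ : ℝ}
    (hψ : |ψ| < Real.pi)
    (hbound : ∀ u : ℂ, ‖f u‖ ≤ C * Real.exp (ψ * u.im + n * Real.pi * |u.im|))
    (hper : ∀ u, f (u + 1) = ((-1 : ℂ) ^ (n - 1)) • f u) :
    ∃ c : Fin n → A, ∀ u, f u = ∑ k, c k * algebraMap ℂ A (wave n k u) := by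
  have hn0 : (n : ℂ) ≠ 0 := by exact_mod_cast hn.ne'
  have hpi : (Real.pi : ℂ) ≠ 0 := by exact_mod_cast Real.pi_ne_zero
  -- at `u = j/n` the combination is, up to a common factor, a polynomial in the root of unity `ζ j`
  let ζ : Fin n → ℂ := fun j => exp (2 * Real.pi * I * (j / n))
  have hζ : ∀ i j, i ≠ j → ζ i - ζ j ≠ 0 := by
    intro i j hij h
    have hpow : ∀ j, ζ j = exp (2 * Real.pi * I / n) ^ (j : ℕ) := fun j => by
      simp only [ζ]
      rw [← exp_nat_mul]
      congr 1
      ring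
    rw [sub_eq_zero, hpow, hpow] at h
    exact hij (Fin.ext ((Complex.isPrimitiveRoot_exp n hn.ne').pow_inj i.2 j.2 h))
  obtain ⟨c, hc⟩ := exists_interpolation (X := fun j => algebraMap ℂ A (ζ j))
    (fun i j hij => by
      rw [← map_sub]
      exact (isUnit_iff_ne_zero.2 (hζ i j hij)).map _)
    (fun j => algebraMap ℂ A (exp (Real.pi * I * (n - 1) * (j / n))) * f (j / n))
  refine ⟨c, ?_⟩
  let T : ℂ → A := fun u => ∑ k, c k * algebraMap ℂ A (wave n k u)
  let D : ℂ → A := fun u => f u - T u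
  have hT : Differentiable ℂ T := Differentiable.fun_sum fun k _ =>
    (differentiable_algebraMap (differentiable_wave k)).const_mul _
  have hD : Differentiable ℂ D := hf.sub hT
  have hDper : ∀ u, D (u + 1) = ((-1 : ℂ) ^ (n - 1)) • D u := by
    intro u
    simp only [D, T, hper, wave_add_one hn, map_mul, Algebra.smul_def, mul_sub, Finset.mul_sum]
    congr 1
    exact Finset.sum_congr rfl fun k _ => by ring
  have hDnorm : Function.Periodic (fun u => ‖D u‖) 1 := fun u => by
    simp [hDper, norm_smul]
  have hDnode : ∀ j : Fin n, D (j / n) = 0 := by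
    intro j
    have hw : ∀ k : Fin n, wave n k (j / n) =
        exp (-(Real.pi * I * (n - 1) * (j / n))) * ζ j ^ (k : ℕ) := by
      intro k
      rw [wave, ← exp_nat_mul, ← exp_add]
      congr 1
      ring
    simp only [D, T, hw, map_mul, map_pow]
    have : ∑ k : Fin n, c k * (algebraMap ℂ A (exp (-(Real.pi * I * (n - 1) * (j / n)))) *
        algebraMap ℂ A (ζ j) ^ (k : ℕ)) =
        algebraMap ℂ A (exp (-(Real.pi * I * (n - 1) * (j / n)))) *
        ∑ k : Fin n, c k * algebraMap ℂ A (ζ j) ^ (k : ℕ) := by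
      rw [Finset.mul_sum]
      exact Finset.sum_congr rfl fun k _ => by ring
    rw [this, hc, ← mul_assoc, ← map_mul, ← exp_add, neg_add_cancel, exp_zero, map_one, one_mul,
      sub_self]
  -- quasi-periodicity spreads the zeros `j/n` of `D` to all zeros of `sin (nπu)`
  have hsin : Differentiable ℂ fun u : ℂ => sin (n * Real.pi * u) := by fun_prop
  have hderiv : ∀ u : ℂ, deriv (fun u : ℂ => sin (n * Real.pi * u)) u =
      cos (n * Real.pi * u) * (n * Real.pi) := by
    intro u
    simpa using (((hasDerivAt_id u).const_mul ((n : ℂ) * Real.pi)).csin).deriv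
  obtain ⟨Q, hQ, hDQ⟩ := exists_differentiable_eq_smul hD hsin
    (by
      intro u hu
      obtain ⟨m, hm⟩ := Complex.sin_eq_zero_iff.1 hu
      have hu' : u = m / n := by
        field_simp
        refine mul_right_cancel₀ hpi ?_
        linear_combination hm
      let j : Fin n := ⟨(m % n).toNat, by
        have := Int.emod_lt_of_pos m (by exact_mod_cast hn : (0 : ℤ) < n)
        have := Int.emod_nonneg m (by exact_mod_cast hn.ne' : (n : ℤ) ≠ 0)
        lia⟩
      have hj : u = j / n + (m / n : ℤ) * 1 := by
        have h1 : ((j : ℕ) : ℤ) = m % n :=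
          Int.toNat_of_nonneg (Int.emod_nonneg m (by exact_mod_cast hn.ne'))
        have h2 : (m : ℂ) = ((j : ℕ) : ℂ) + n * (m / n : ℤ) := by
          have := Int.emod_add_mul_ediv m n
          rw [← h1] at this
          exact_mod_cast this.symm
        rw [hu', h2]
        field_simp
      have := (hDnorm.int_mul (m / n : ℤ)) (j / n)
      rw [← hj] at this
      simpa [hDnode] using this)
    (by
      intro u hu
      rw [hderiv]
      refine mul_ne_zero (fun hcos => ?_) (mul_ne_zero hn0 hpi)
      have := Complex.sin_sq_add_cos_sq (n * Real.pi * u)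
      simp [hu, hcos] at this)
  -- the sign of `sin (nπu)` under `u ↦ u + 1` is `(-1)^n`, that of `D` is `(-1)^{n-1}`
  have hQper : ∀ u, Q (u + 1) = -Q u := by
    have han1 : AnalyticOnNhd ℂ (fun u => Q (u + 1)) Set.univ :=
      (hQ.comp (differentiable_id.add_const 1)).differentiableOn.analyticOnNhd isOpen_univ
    have han2 : AnalyticOnNhd ℂ (fun u => -Q u) Set.univ :=
      hQ.neg.differentiableOn.analyticOnNhd isOpen_univ
    refine congrFun (han1.eq_of_eventuallyEq han2 (z₀ := 1 / (2 * n)) ?_)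
    have hne : sin (n * Real.pi * (1 / (2 * n)) : ℂ) ≠ 0 := by
      rw [show (n * Real.pi * (1 / (2 * n)) : ℂ) = Real.pi / 2 by field_simp, sin_pi_div_two]
      exact one_ne_zero
    filter_upwards [(hsin _).continuousAt.eventually_ne hne] with u hu
    have h1 := hDper u
    rw [hDQ, hDQ u, show (n * Real.pi * (u + 1) : ℂ) = n * Real.pi * u + n * Real.pi by ring,
      Complex.sin_antiperiodic.add_nat_mul_eq] at h1
    obtain ⟨N, hN⟩ : ∃ N, n = N + 1 := ⟨n - 1, by lia⟩
    have hp : (-1 : ℂ) ^ n = -(-1) ^ N := by rw [hN, pow_succ, mul_neg_one]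
    rw [hp, show n - 1 = N by lia, neg_mul, neg_smul, ← smul_smul] at h1
    have h2 := smul_right_injective A (pow_ne_zero N (by norm_num : (-1 : ℂ) ≠ 0))
      ((smul_neg _ _).trans h1)
    rw [← smul_neg] at h2
    have h3 := smul_right_injective A hu h2
    rw [← h3, neg_neg]
  -- the exponential removes the drift `e^{ψ Im u}`, so that `G` is bounded
  let G : ℂ → A := fun u => exp (I * ψ * u) • Q u
  have hG : Differentiable ℂ G := by
    have : Differentiable ℂ fun u : ℂ => exp (I * ψ * u) := by fun_prop
    exact this.smul hQ
  have hnormexp : ∀ u : ℂ, ‖exp (I * ψ * u)‖ = Real.exp (-(ψ * u.im)) := by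
    intro u
    rw [Complex.norm_exp]
    simp
  have hGper : Function.Periodic (fun u => ‖G u‖) 1 := fun u => by
    simp only [G, norm_smul, hnormexp, hQper, norm_neg]
    simp
  have hGb : Bornology.IsBounded (Set.range G) := by
    obtain ⟨C₀, hC₀⟩ := ((isCompact_Icc (a := (0 : ℝ)) (b := 1)).reProdIm
      (isCompact_Icc (a := (-1 : ℝ)) (b := 1))).exists_bound_of_continuousOn
        hG.continuous.continuousOn
    let C₁ : ℝ := C + ∑ k, ‖c k‖ * ‖(1 : A)‖
    have hDb : ∀ u, ‖D u‖ ≤ C₁ * Real.exp (ψ * u.im + n * Real.pi * |u.im|) := by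
      intro u
      refine (norm_sub_le _ _).trans ?_
      rw [add_mul]
      refine add_le_add (hbound u) ?_
      rw [Finset.sum_mul]
      refine norm_sum_le_of_le _ fun k _ => ?_
      refine (norm_mul_le _ _).trans ?_
      rw [norm_algebraMap, mul_assoc, mul_comm ‖(1 : A)‖]
      gcongr
      refine (norm_wave_le k u).trans (Real.exp_le_exp.2 ?_)
      have h1 : |ψ * u.im| ≤ Real.pi * |u.im| := by
        rw [abs_mul]
        gcongr
      linarith [neg_abs_le (ψ * u.im)]
    refine (Metric.isBounded_closedBall (x := (0 : A)) (r := max C₀ (4 * C₁))).subset ?_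
    rintro _ ⟨u, rfl⟩
    rw [mem_closedBall_zero_iff]
    rcases le_or_gt 1 |u.im| with h | h
    · refine le_max_of_le_right ?_
      have him : ((n * Real.pi * u : ℂ)).im = n * Real.pi * u.im := by
        simp
      have hnpi : 1 ≤ n * Real.pi := by
        have : (1 : ℝ) ≤ n := by exact_mod_cast hn
        nlinarith [Real.pi_gt_three]
      have habs : |((n * Real.pi * u : ℂ)).im| = n * Real.pi * |u.im| := by
        rw [him, abs_mul, abs_of_pos (by linarith)]
      have hs := exp_abs_im_le_norm_sin (z := n * Real.pi * u) (by rw [habs]; nlinarith)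
      rw [habs] at hs
      have h1 := hDb u
      rw [hDQ, norm_smul, Real.exp_add] at h1
      have hQ' : Real.exp (n * Real.pi * |u.im|) * ‖Q u‖ ≤
          Real.exp (n * Real.pi * |u.im|) * (4 * C₁ * Real.exp (ψ * u.im)) := by
        calc _ ≤ 4 * ‖sin (n * Real.pi * u)‖ * ‖Q u‖ := by gcongr
          _ = 4 * (‖sin (n * Real.pi * u)‖ * ‖Q u‖) := by ring
          _ ≤ 4 * (C₁ * (Real.exp (ψ * u.im) * Real.exp (n * Real.pi * |u.im|))) := by gcongr
          _ = _ := by ring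
      have hQ'' := le_of_mul_le_mul_left hQ' (Real.exp_pos _)
      calc ‖G u‖ = Real.exp (-(ψ * u.im)) * ‖Q u‖ := by rw [norm_smul, hnormexp]
        _ ≤ Real.exp (-(ψ * u.im)) * (4 * C₁ * Real.exp (ψ * u.im)) := by gcongr
        _ = 4 * C₁ * (Real.exp (-(ψ * u.im)) * Real.exp (ψ * u.im)) := by ring
        _ = 4 * C₁ := by rw [← Real.exp_add, neg_add_cancel, Real.exp_zero, mul_one]
    · refine le_max_of_le_left ?_
      have h1 := (hGper.int_mul (-⌊u.re⌋)) u
      rw [← h1]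
      refine hC₀ _ ⟨?_, ?_⟩
      · simp only [Set.mem_preimage, add_re, mul_one, intCast_re, Set.mem_Icc]
        push_cast
        constructor <;> linarith [Int.floor_le u.re, (Int.lt_floor_add_one u.re).le]
      · rw [abs_lt] at h
        simp only [Set.mem_preimage, add_im, mul_one, intCast_im, Set.mem_Icc]
        constructor <;> linarith
  -- so `Q` is a multiple of `e^{-iψu}`, which is not antiperiodic because `|ψ| < π`
  have hQ0 : ∀ u, Q u = 0 := by
    have hGc : ∀ u, G u = G 0 := fun u => hG.apply_eq_apply_of_bounded hGb u 0
    have hQe : ∀ u, Q u = exp (-(I * ψ * u)) • G 0 := by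
      intro u
      rw [← hGc u, smul_smul, ← exp_add, neg_add_cancel, exp_zero, one_smul]
    have h1 := hQper 0
    rw [hQe, hQe 0] at h1
    have h2 : (exp (-(I * ψ)) + 1) • G 0 = 0 := by
      rw [add_smul, one_smul]
      simpa [add_eq_zero_iff_eq_neg] using h1
    have h3 : exp (-(I * ψ)) + 1 ≠ 0 := by
      intro h
      have h4 : exp (-(I * ψ)) = exp (Real.pi * I) := by
        rw [exp_pi_mul_I]
        linear_combination h
      obtain ⟨m, hm⟩ := Complex.exp_eq_exp_iff_exists_int.1 h4
      have h5 : -ψ = Real.pi * (1 + 2 * m) := by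
        have := congrArg Complex.im hm
        simp at this
        linarith
      have h6 : |(1 + 2 * m : ℝ)| < 1 := by
        rw [← abs_neg, h5, abs_mul, abs_of_pos Real.pi_pos] at hψ
        by_contra! hcon
        nlinarith [Real.pi_pos]
      have h7 : |(1 + 2 * m : ℤ)| < 1 := by exact_mod_cast h6
      rw [Int.abs_lt_one_iff] at h7
      lia
    intro u
    rw [hQe, (smul_eq_zero.1 h2).resolve_left h3, smul_zero]
  intro u
  have := hDQ u
  rw [hQ0, smul_zero] at this
  exact sub_eq_zero.1 this

end Periodic

/-! ### Holomorphic functions glued along the imaginary axis -/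

section Gluing

variable {E : Type*} [NormedAddCommGroup E] [NormedSpace ℂ E]

/-- The integral of `f` along the boundary of the rectangle `[a, b] × [c, d]`. -/
def rectIntegral (f : ℂ → E) (a b c d : ℝ) : E :=
  (∫ x : ℝ in a..b, f (x + c * I)) - (∫ x : ℝ in a..b, f (x + d * I)) +
    I • (∫ y : ℝ in c..d, f (b + y * I)) - I • (∫ y : ℝ in c..d, f (a + y * I))

theorem rectIntegral_eq_zero {f : ℂ → E} {a b c d : ℝ}
    (hc : ContinuousOn f (Set.uIcc a b ×ℂ Set.uIcc c d))
    (hd : DifferentiableOn ℂ f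
      (Set.Ioo (min a b) (max a b) ×ℂ Set.Ioo (min c d) (max c d))) :
    rectIntegral f a b c d = 0 := by
  have := integral_boundary_rect_eq_zero_of_continuousOn_of_differentiableOn f
    (⟨a, c⟩ : ℂ) ⟨b, d⟩ hc hd
  simpa [rectIntegral] using this

theorem rectIntegral_add {f : ℂ → E} {a b c d : ℝ} (h0 : (0 : ℝ) ∈ Set.uIcc a b)
    (hc : ContinuousOn f (Set.uIcc a b ×ℂ Set.uIcc c d)) :
    rectIntegral f a 0 c d + rectIntegral f 0 b c d = rectIntegral f a b c d := by
  have hint : ∀ y ∈ Set.uIcc c d, ∀ a' ∈ Set.uIcc a b, ∀ b' ∈ Set.uIcc a b,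
      IntervalIntegrable (fun x : ℝ => f (x + y * I)) MeasureTheory.volume a' b' := by
    intro y hy a' ha' b' hb'
    refine ContinuousOn.intervalIntegrable (hc.comp (by fun_prop) fun x hx => ?_)
    refine ⟨?_, ?_⟩
    · simpa using Set.uIcc_subset_uIcc ha' hb' hx
    · simpa using hy
  rw [rectIntegral, rectIntegral, rectIntegral,
    ← intervalIntegral.integral_add_adjacent_intervals
      (hint c Set.left_mem_uIcc a Set.left_mem_uIcc 0 h0)
      (hint c Set.left_mem_uIcc 0 h0 b Set.right_mem_uIcc),
    ← intervalIntegral.integral_add_adjacent_intervals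
      (hint d Set.right_mem_uIcc a Set.left_mem_uIcc 0 h0)
      (hint d Set.right_mem_uIcc 0 h0 b Set.right_mem_uIcc)]
  abel

/-- A continuous function which is holomorphic off the imaginary axis is holomorphic, by Morera's
theorem: a rectangle meeting the axis is cut into two pieces along it. -/
theorem differentiableOn_of_continuousOn_of_re_ne_zero [CompleteSpace E] {f : ℂ → E} {U : Set ℂ}
    (hU : IsOpen U) (hc : ContinuousOn f U) (hd : DifferentiableOn ℂ f (U ∩ {w | w.re ≠ 0})) :
    DifferentiableOn ℂ f U := by
  intro w₀ hw₀
  obtain ⟨ρ, hρ, hsub⟩ := Metric.isOpen_iff.1 hU w₀ hw₀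
  have hcons : IsConservativeOn f (Metric.ball w₀ ρ) := by
    intro z w hzw
    have hrect : Set.uIcc z.re w.re ×ℂ Set.uIcc z.im w.im ⊆ U := hzw.trans hsub
    rw [← add_eq_zero_iff_eq_neg, wedgeIntegral_add_wedgeIntegral_eq]
    change rectIntegral f z.re w.re z.im w.im = 0
    have hpiece : ∀ a ∈ Set.uIcc z.re w.re, ∀ b ∈ Set.uIcc z.re w.re,
        (0 : ℝ) ∉ Set.Ioo (min a b) (max a b) → rectIntegral f a b z.im w.im = 0 := by
      intro a ha b hb h0
      have hab : Set.uIcc a b ⊆ Set.uIcc z.re w.re := Set.uIcc_subset_uIcc ha hb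
      refine rectIntegral_eq_zero (hc.mono fun x hx => hrect ⟨hab hx.1, hx.2⟩)
        (hd.mono fun x hx => ⟨hrect ⟨hab (Set.Ioo_subset_Icc_self hx.1),
          Set.Ioo_subset_Icc_self hx.2⟩, fun hx0 => h0 ?_⟩)
      have := hx.1
      rwa [Set.mem_preimage, hx0] at this
    by_cases h0 : (0 : ℝ) ∈ Set.uIcc z.re w.re
    · rw [← rectIntegral_add h0 (hc.mono hrect), hpiece _ Set.left_mem_uIcc _ h0,
        hpiece _ h0 _ Set.right_mem_uIcc, add_zero]
      · rintro ⟨h1, h2⟩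
        simp at h1 h2
        grind
      · rintro ⟨h1, h2⟩
        simp at h1 h2
        grind
    · exact hpiece _ Set.left_mem_uIcc _ Set.right_mem_uIcc fun h =>
        h0 (Set.Ioo_subset_Icc_self h)
  exact (((hcons.isExactOn_ball (hc.mono hsub)).differentiableOn
    Metric.isOpen_ball).differentiableAt (Metric.ball_mem_nhds w₀ hρ)).differentiableWithinAt

end Gluing

/-! ### The slit plane and homotopies inside its powers -/

section SlitPlane

/-- The plane slit along the two rays of the imaginary axis outside the gap
`|Im w - cπ| < π`. -/
def slitPlane (c : ℝ) : Set ℂ :=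
  {w | w.re ≠ 0 ∨ |w.im - c * Real.pi| < Real.pi}

theorem isOpen_slitPlane (c : ℝ) : IsOpen (slitPlane c) :=
  (isOpen_ne_fun Complex.continuous_re continuous_const).union
    (isOpen_lt (Complex.continuous_im.sub continuous_const).abs continuous_const)

/-- The points with all coordinates in the slit plane. -/
def slitSpace (r : ℕ) (c : ℝ) : Set (Fin r → ℂ) :=
  {w | ∀ k, w k ∈ slitPlane c}

theorem center_mem_slitSpace (r : ℕ) (c : ℝ) :
    (fun _ => ⟨0, c * Real.pi⟩ : Fin r → ℂ) ∈ slitSpace r c := fun _ =>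
  Or.inr (by simpa using Real.pi_pos)

theorem starConvex_slitSpace (r : ℕ) (c : ℝ) :
    StarConvex ℝ (fun _ => ⟨0, c * Real.pi⟩ : Fin r → ℂ) (slitSpace r c) := by
  intro w hw a b _ hb hab k
  rcases hb.eq_or_lt with rfl | hb'
  · refine Or.inr ?_
    obtain rfl : a = 1 := by linarith
    simpa using Real.pi_pos
  rcases hw k with h | h
  · left
    simpa using ⟨hb'.ne', h⟩
  · right
    have h1 : (a • (fun _ => ⟨0, c * Real.pi⟩ : Fin r → ℂ) + b • w) k =
        a • (⟨0, c * Real.pi⟩ : ℂ) + b • w k := rfl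
    have h2 : ((a • (fun _ => ⟨0, c * Real.pi⟩ : Fin r → ℂ) + b • w) k).im - c * Real.pi =
        b * ((w k).im - c * Real.pi) := by
      rw [h1]
      simp
      linear_combination (c * Real.pi) * hab
    rw [h2, abs_mul, abs_of_pos hb']
    nlinarith [abs_nonneg ((w k).im - c * Real.pi)]

/-- The points `(n - r + 1)πi + 2πiℤ` lie on the slits: their distance from the centre `(n - r)πi`
of the gap is an odd multiple of `π`. -/
theorem disjoint_poles {n r : ℕ} {w : ℂ} (hw : w ∈ slitPlane ((n : ℝ) - r)) : w ∉ poles n r := by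
  rintro ⟨N, rfl⟩
  rcases hw with h | h
  · simp at h
  · simp at h
    have h1 : (((n : ℝ) - r + 1) * Real.pi + 2 * Real.pi * N - (n - r) * Real.pi) =
        Real.pi * (1 + 2 * N) := by ring
    rw [h1, abs_mul, abs_of_pos Real.pi_pos] at h
    have h2 : |(1 + 2 * N : ℝ)| < 1 := by
      by_contra! hcon
      nlinarith [Real.pi_pos]
    have h3 : |(1 + 2 * N : ℤ)| < 1 := by exact_mod_cast h2
    rw [Int.abs_lt_one_iff] at h3
    lia

theorem IsContinuationPath.mem_slitPlane {n r : ℕ} {a b : ℝ} {γ : Path (a : ℂ) (b : ℂ)}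
    (hγ : IsContinuationPath n r γ) (t : unitInterval) : γ t ∈ slitPlane ((n : ℝ) - r) := by
  obtain ⟨ε, hε, h⟩ := hγ
  by_cases h0 : (γ t).re = 0
  · right
    rw [h t (by rwa [h0, abs_zero]), sub_self, abs_zero]
    exact Real.pi_pos
  · exact Or.inl h0

theorem concat_mem {X : Type*} [TopologicalSpace X] {S : Set X} {n : ℕ} (p : Fin (n + 1) → X)
    (F : (k : Fin n) → Path (p k.castSucc) (p k.succ)) (h0 : p 0 ∈ S) (hF : ∀ k t, F k t ∈ S)
    (t : unitInterval) : Path.concat p F t ∈ S := by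
  induction n generalizing t with
  | zero => simpa using h0
  | succ n ih =>
    rw [Path.concat_succ]
    have hm := Set.mem_range_self (f := (Path.concat (p ∘ Fin.castSucc)
      (fun k ↦ F k.castSucc)).trans (F (Fin.last n))) t
    rw [Path.trans_range] at hm
    rcases hm with ⟨s, hs⟩ | ⟨s, hs⟩
    · exact Set.mem_of_eq_of_mem hs.symm (ih (p := p ∘ Fin.castSucc) (F := fun k ↦ F k.castSucc)
        (t := s) h0 fun k t => hF k.castSucc t)
    · exact Set.mem_of_eq_of_mem hs.symm (hF _ s)

theorem concatPath_mem_slitSpace (r : ℕ) {c : ℝ} {a b : ℂ} {γ : Path a b}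
    (hγ : ∀ t, γ t ∈ slitPlane c) (t : unitInterval) : concatPath r γ t ∈ slitSpace r c := by
  have ha : a ∈ slitPlane c := by simpa using hγ 0
  have hb : b ∈ slitPlane c := by simpa using hγ 1
  refine concat_mem (S := slitSpace r c) (corner r a b) (edgePath r γ) (fun i => ?_)
    (fun k s i => ?_) t
  · simpa [corner] using ha
  · change (if i < k then b else if i = k then γ s else a) ∈ slitPlane c
    split_ifs
    · exact hb
    · exact hγ s
    · exact ha

/-- Two paths with the same end points in a star convex set are homotopic inside this set. -/
theorem exists_homotopy_of_starConvex {E : Type*} [NormedAddCommGroup E] [NormedSpace ℝ E]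
    {S : Set E} {x u v : E} (hS : StarConvex ℝ x S) (hne : S.Nonempty) (p q : Path u v)
    (hp : ∀ t, p t ∈ S) (hq : ∀ t, q t ∈ S) :
    ∃ F : Path.Homotopy p q, ∀ y, F y ∈ S := by
  have hu : u ∈ S := by simpa using hp 0
  have hv : v ∈ S := by simpa using hp 1
  let p' : Path (⟨u, hu⟩ : S) ⟨v, hv⟩ :=
    { toFun := fun t => ⟨p t, hp t⟩
      continuous_toFun := p.continuous.subtype_mk _
      source' := by simp
      target' := by simp }
  let q' : Path (⟨u, hu⟩ : S) ⟨v, hv⟩ :=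
    { toFun := fun t => ⟨q t, hq t⟩
      continuous_toFun := q.continuous.subtype_mk _
      source' := by simp
      target' := by simp }
  -- a star convex set is contractible, hence simply connected
  have := hS.contractibleSpace hne
  obtain ⟨H⟩ := SimplyConnectedSpace.paths_homotopic p' q'
  refine ⟨(H.map ⟨Subtype.val, continuous_subtype_val⟩).cast (by ext; rfl) (by ext; rfl),
    fun y => ?_⟩
  exact (H y).2

end SlitPlane

/-! ### The reciprocal Gamma function on the algebra -/

section RGamma

variable {A : Type*} [NormedCommRing A] [NormedAlgebra ℂ A]

/-- The entire function `1/Γ`, evaluated on `A`. -/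
def rGamma (a : A) : A :=
  entireEval (fun s : ℂ => (Gamma s)⁻¹) a

variable {n : ℕ}

/-- The coefficient function `∏_j 1/Γ(P_j - t) · 1/Γ(Q_j + t)` of the hypergeometric series. -/
def gammaProd (P Q : Fin n → A) (t : A) : A :=
  ∏ j, (rGamma (P j - t) * rGamma (Q j + t))

theorem gammaProd_algebraMap_eq (P Q : Fin n → A) (u : ℂ) : gammaProd P Q (algebraMap ℂ A u) =
    ∏ j, (rGamma (P j + algebraMap ℂ A (-1 * u)) * rGamma (Q j + algebraMap ℂ A (1 * u))) := by
  simp [gammaProd, sub_eq_add_neg]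

theorem exp_eq_entireEval (a : A) : NormedSpace.exp a = entireEval Complex.exp a := by
  rw [NormedSpace.exp_eq_tsum ℂ, entireEval]
  refine tsum_congr fun k => ?_
  simp [iteratedDeriv_eq_iterate]

theorem exp_algebraMap (z : ℂ) :
    NormedSpace.exp (algebraMap ℂ A z) = algebraMap ℂ A (Complex.exp z) := by
  rw [Complex.exp_eq_exp_ℂ]
  exact (NormedSpace.algebraMap_exp_comm z).symm

variable [CompleteSpace A]

theorem exp_add' (a b : A) :
    NormedSpace.exp (a + b) = NormedSpace.exp a * NormedSpace.exp b := by
  let _ : NormedAlgebra ℚ A := NormedAlgebra.restrictScalars ℚ ℂ A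
  exact NormedSpace.exp_add

theorem rGamma_algebraMap (z : ℂ) : rGamma (algebraMap ℂ A z) = algebraMap ℂ A (Gamma z)⁻¹ := by
  have h := entireEval_add_nilpotent (A := A) differentiable_one_div_Gamma (ν := 0)
    IsNilpotent.zero z
  rw [add_zero] at h
  rw [rGamma, h, nilShift, tsum_eq_single 0]
  · simp
  · intro k hk
    simp [hk]

/-- The recurrence `1/Γ(a) = a/Γ(a + 1)`. -/
theorem rGamma_eq_mul {a : A} {z : ℂ} (ha : IsNilpotent (a - algebraMap ℂ A z)) :
    rGamma a = a * rGamma (a + 1) := by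
  have h1 := entireEval_add_nilpotent differentiable_one_div_Gamma ha z
  have h2 := entireEval_add_nilpotent differentiable_one_div_Gamma ha (z + 1)
  rw [add_sub_cancel] at h1
  rw [map_add, map_one, show algebraMap ℂ A z + 1 + (a - algebraMap ℂ A z) = a + 1 by ring] at h2
  have h3 : (fun v => algebraMap ℂ A (Gamma v)⁻¹) =
      fun v => algebraMap ℂ A v * algebraMap ℂ A (Gamma (v + 1))⁻¹ := by
    funext v
    rw [← map_mul, ← inv_Gamma_eq_mul]
  have hd : Differentiable ℂ fun v : ℂ => (Gamma (v + 1))⁻¹ :=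
    differentiable_one_div_Gamma.comp (differentiable_id.add_const 1)
  have h5 := nilShift_mul ha
    (differentiable_algebraMap (A := A) (F := fun v => v) differentiable_id)
    (differentiable_algebraMap hd) z
  rw [rGamma, rGamma, h1, h2, h3, h5, nilShift_algebraMap, add_sub_cancel, ← h3]
  congr 1
  have h4 := nilShift_comp_affine (ν := a - algebraMap ℂ A z)
    (f := fun v => algebraMap ℂ A (Gamma v)⁻¹)
    (differentiable_algebraMap differentiable_one_div_Gamma) 1 1 z
  simpa using h4

/-- Growth of a product of two reciprocal Gamma functions with parameters in `A`; it follows from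
the scalar bound by Cauchy's estimates for the derivatives in the Taylor expansions. -/
theorem exists_norm_rGamma_mul_le {P Q : A} {p q : ℂ} (hP : IsNilpotent (P - algebraMap ℂ A p))
    (hQ : IsNilpotent (Q - algebraMap ℂ A q)) (hpq : 6 ≤ (p + q).re) :
    ∃ C : ℝ, 0 ≤ C ∧ ∀ u : ℂ,
      ‖rGamma (P + algebraMap ℂ A (-1 * u)) * rGamma (Q + algebraMap ℂ A (1 * u))‖ ≤
        C * (Real.exp (Real.pi * |u.im|) / (1 + ‖u‖ ^ 2)) := by
  have hG := differentiable_one_div_Gamma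
  obtain ⟨C₁, hC₁, h₁⟩ := exists_norm_nilShift_le hP
  obtain ⟨C₂, hC₂, h₂⟩ := exists_norm_nilShift_le hQ
  obtain ⟨C₃, hC₃, h₃⟩ := exists_norm_inv_Gamma_mul_le_decay (‖p + q‖ + 2)
  refine ⟨C₁ * C₂ * C₃ * Real.exp (Real.pi * (|q.im| + 1)) * (2 * (1 + (‖p‖ + 1) ^ 2)),
    by positivity, fun u => ?_⟩
  -- each factor is bounded by a constant times a value of `1/Γ` on a unit circle
  have hmax : ∀ z : ℂ, ∃ z' ∈ Metric.sphere z 1, ∀ v ∈ Metric.sphere z 1,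
      ‖(Gamma v)⁻¹‖ ≤ ‖(Gamma z')⁻¹‖ := fun z =>
    (isCompact_sphere z 1).exists_isMaxOn (NormedSpace.sphere_nonempty.2 zero_le_one)
      hG.continuous.norm.continuousOn
  obtain ⟨p', hp', hpm⟩ := hmax (-1 * u + p)
  obtain ⟨q', hq', hqm⟩ := hmax (1 * u + q)
  have e₁ := h₁ _ hG _ _ hpm
  have e₂ := h₂ _ hG _ _ hqm
  rw [← entireEval_affine_eq hG hP] at e₁
  rw [← entireEval_affine_eq hG hQ] at e₂
  rw [mem_sphere_iff_norm] at hp' hq'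
  have hdiff : ‖(p' + q') - (p + q)‖ ≤ 2 := by
    rw [show (p' + q') - (p + q) = (p' - (-1 * u + p)) + (q' - (1 * u + q)) by ring]
    exact (norm_add_le _ _).trans (by linarith)
  have e₃ := h₃ p' q' (by
      have := (Complex.abs_re_le_norm _).trans hdiff
      rw [sub_re, abs_le] at this
      linarith [this.1])
    (by linarith [norm_le_norm_add_norm_sub' (p' + q') (p + q)])
  have hexp : Real.exp (Real.pi * |q'.im|) ≤
      Real.exp (Real.pi * (|q.im| + 1)) * Real.exp (Real.pi * |u.im|) := by
    rw [← Real.exp_add, ← mul_add]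
    have h := (Complex.abs_im_le_norm _).trans hq'.le
    have h' : q'.im = (q' - (1 * u + q)).im + (u.im + q.im) := by simp
    have : |q'.im| ≤ |q.im| + 1 + |u.im| := by
      rw [h']
      refine (abs_add_le _ _).trans ?_
      linarith [abs_add_le u.im q.im]
    gcongr
  have hu : ‖u‖ ≤ ‖p'‖ + (‖p‖ + 1) := by
    have : u = (p' - (-1 * u + p)) - p' + p := by ring
    calc ‖u‖ = ‖(p' - (-1 * u + p)) - p' + p‖ := by rw [← this]
      _ ≤ ‖p' - (-1 * u + p)‖ + ‖p'‖ + ‖p‖ :=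
        (norm_add_le _ _).trans (by gcongr; exact norm_sub_le _ _)
      _ = _ := by rw [hp']; ring
  have hden : 1 + ‖u‖ ^ 2 ≤ 2 * (1 + (‖p‖ + 1) ^ 2) * (1 + ‖p'‖ ^ 2) := by
    have h1 : ‖u‖ ^ 2 ≤ (‖p'‖ + (‖p‖ + 1)) ^ 2 := by gcongr
    nlinarith [sq_nonneg (‖p'‖ - (‖p‖ + 1)), sq_nonneg (‖p'‖ * (‖p‖ + 1)),
      sq_nonneg ‖p'‖, sq_nonneg (‖p‖ + 1)]
  calc _ ≤ (C₁ * ‖(Gamma p')⁻¹‖) * (C₂ * ‖(Gamma q')⁻¹‖) :=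
        (norm_mul_le _ _).trans (mul_le_mul e₁ e₂ (norm_nonneg _) (by positivity))
    _ = C₁ * C₂ * (‖(Gamma p')⁻¹‖ * ‖(Gamma q')⁻¹‖) := by ring
    _ ≤ C₁ * C₂ * (C₃ * Real.exp (Real.pi * |q'.im|) / (1 + ‖p'‖ ^ 2)) := by gcongr
    _ ≤ C₁ * C₂ * (C₃ * (Real.exp (Real.pi * (|q.im| + 1)) * Real.exp (Real.pi * |u.im|)) /
          ((1 + ‖u‖ ^ 2) / (2 * (1 + (‖p‖ + 1) ^ 2)))) := by
        gcongr
        rw [div_le_iff₀ (by positivity)]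
        linarith
    _ = _ := by field_simp

section
variable {P Q : Fin n → A} {p q : Fin n → ℂ}
  (hP : ∀ j, IsNilpotent (P j - algebraMap ℂ A (p j)))
  (hQ : ∀ j, IsNilpotent (Q j - algebraMap ℂ A (q j)))
include hP hQ

theorem differentiable_gammaProd :
    Differentiable ℂ fun u => gammaProd P Q (algebraMap ℂ A u) := by
  simp only [gammaProd_algebraMap_eq]
  exact Differentiable.fun_finsetProd fun j _ =>
    (differentiable_entireEval_affine differentiable_one_div_Gamma (hP j) (-1)).mul
      (differentiable_entireEval_affine differentiable_one_div_Gamma (hQ j) 1)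

theorem nilShift_gammaProd {ν : A} (hν : IsNilpotent ν) (u : ℂ) :
    nilShift ν (fun v => gammaProd P Q (algebraMap ℂ A v)) u =
      gammaProd P Q (algebraMap ℂ A u + ν) := by
  have h1 : ∀ j, Differentiable ℂ fun v => rGamma (P j + algebraMap ℂ A (-1 * v)) := fun j =>
    differentiable_entireEval_affine differentiable_one_div_Gamma (hP j) (-1)
  have h2 : ∀ j, Differentiable ℂ fun v => rGamma (Q j + algebraMap ℂ A (1 * v)) := fun j =>
    differentiable_entireEval_affine differentiable_one_div_Gamma (hQ j) 1
  simp only [gammaProd_algebraMap_eq]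
  rw [nilShift_prod hν _ fun j => (h1 j).fun_mul (h2 j), gammaProd]
  refine Finset.prod_congr rfl fun j _ => ?_
  rw [nilShift_mul hν (h1 j) (h2 j)]
  simp only [rGamma]
  rw [nilShift_entireEval_affine differentiable_one_div_Gamma (hP j) hν,
    nilShift_entireEval_affine differentiable_one_div_Gamma (hQ j) hν, one_smul, neg_one_smul,
    ← sub_eq_add_neg]

theorem exists_norm_gammaProd_le (hn : 0 < n) (hpq : ∀ j, 6 ≤ (p j + q j).re) :
    ∃ C : ℝ, 0 ≤ C ∧ ∀ u : ℂ, ‖gammaProd P Q (algebraMap ℂ A u)‖ ≤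
      C * (Real.exp (n * Real.pi * |u.im|) / (1 + ‖u‖ ^ 2)) := by
  choose C hC0 hC using fun j => exists_norm_rGamma_mul_le (hP j) (hQ j) (hpq j)
  have hne : (Finset.univ : Finset (Fin n)).Nonempty := ⟨⟨0, hn⟩, Finset.mem_univ _⟩
  refine ⟨∏ j, C j, Finset.prod_nonneg fun j _ => hC0 j, fun u => ?_⟩
  rw [gammaProd_algebraMap_eq]
  have h1 : (1 : ℝ) ≤ 1 + ‖u‖ ^ 2 := by nlinarith [norm_nonneg u]
  calc _ ≤ ∏ j, ‖rGamma (P j + algebraMap ℂ A (-1 * u)) * rGamma (Q j + algebraMap ℂ A (1 * u))‖ :=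
        Finset.norm_prod_le' _ hne _
    _ ≤ ∏ j, (C j * (Real.exp (Real.pi * |u.im|) / (1 + ‖u‖ ^ 2))) :=
        Finset.prod_le_prod (fun _ _ => norm_nonneg _) fun j _ => hC j u
    _ = (∏ j, C j) * (Real.exp (n * Real.pi * |u.im|) / (1 + ‖u‖ ^ 2) ^ n) := by
        rw [Finset.prod_mul_distrib, Finset.prod_const, Finset.card_univ, Fintype.card_fin, div_pow,
          ← Real.exp_nat_mul, mul_assoc (n : ℝ)]
    _ ≤ _ := by
        have : 0 ≤ ∏ j, C j := Finset.prod_nonneg fun j _ => hC0 j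
        gcongr
        exact le_self_pow₀ h1 hn.ne'

/-- On a translate `s + ℤ` the coefficients are summable. -/
theorem exists_norm_gammaProd_add_int_le (hn : 0 < n) (hpq : ∀ j, 6 ≤ (p j + q j).re)
    {s : A} {z : ℂ} (hs : IsNilpotent (s - algebraMap ℂ A z)) :
    ∃ C : ℝ, 0 ≤ C ∧ ∀ d : ℤ, ‖gammaProd P Q (s + algebraMap ℂ A d)‖ ≤ C * (1 + (d : ℝ) ^ 2)⁻¹ := by
  obtain ⟨C, hC0, hC⟩ := exists_norm_gammaProd_le (P := fun j => P j - s) (Q := fun j => Q j + s)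
    (p := fun j => p j - z) (q := fun j => q j + z)
    (fun j => by
      rw [map_sub, show P j - s - (algebraMap ℂ A (p j) - algebraMap ℂ A z) =
        (P j - algebraMap ℂ A (p j)) - (s - algebraMap ℂ A z) by ring]
      exact (Commute.all _ _).isNilpotent_sub (hP j) hs)
    (fun j => by
      rw [map_add, show Q j + s - (algebraMap ℂ A (q j) + algebraMap ℂ A z) =
        (Q j - algebraMap ℂ A (q j)) + (s - algebraMap ℂ A z) by ring]
      exact (Commute.all _ _).isNilpotent_add (hQ j) hs)
    hn (fun j => by rw [show p j - z + (q j + z) = p j + q j by ring]; exact hpq j)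
  refine ⟨C, hC0, fun d => ?_⟩
  have h := hC d
  simp only [intCast_im, abs_zero, mul_zero, Real.exp_zero, Complex.norm_intCast, sq_abs,
    one_div] at h
  convert h using 2
  simp only [gammaProd]
  refine Finset.prod_congr rfl fun j _ => ?_
  congr 2 <;> ring

end
end RGamma

/-! ### The connection formula on the boundary of the domains of convergence -/

section Boundary

variable {A : Type*} [NormedCommRing A] [NormedAlgebra ℂ A] {n r : ℕ}

/-- The summand of index `d` of the series `∑_d (-1)^{(r-1)d} e^{-w(s+d)} h(s+d)`. -/
def seriesTerm (r : ℕ) (h : A → A) (s : A) (w : ℂ) (d : ℤ) : A :=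
  ((-1 : ℂ) ^ (((r : ℤ) - 1) * d)) •
    (NormedSpace.exp (-(w • (s + algebraMap ℂ A d))) * h (s + algebraMap ℂ A d))

theorem norm_neg_one_zpow (k : ℤ) : ‖(-1 : ℂ) ^ k‖ = 1 := by
  simp [norm_zpow]

theorem seriesTerm_algebraMap (h : A → A) (u w : ℂ) (d : ℤ) :
    seriesTerm r h (algebraMap ℂ A u) w d = ((-1 : ℂ) ^ (((r : ℤ) - 1) * d)) •
      (algebraMap ℂ A (cexp (-w * (u + d))) * h (algebraMap ℂ A (u + d))) := by
  rw [seriesTerm, ← map_add, ← exp_algebraMap, Algebra.smul_def w, ← map_mul, ← map_neg, neg_mul]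

theorem summable_one_add_sq_inv : Summable fun d : ℤ => (1 + (d : ℝ) ^ 2)⁻¹ := by
  have h1 : Summable fun d : ℤ => 1 / (d : ℝ) ^ 2 :=
    Real.summable_one_div_int_pow.2 one_lt_two
  have h2 : Summable fun d : ℤ => if d = 0 then (1 : ℝ) else 0 :=
    (hasSum_ite_eq 0 (1 : ℝ)).summable
  refine Summable.of_nonneg_of_le (fun d => by positivity) (fun d => ?_) (h1.add h2)
  by_cases hd : d = 0
  · simp [hd]
  · have hd' : (0 : ℝ) < (d : ℝ) ^ 2 := by positivity
    simp only [hd, if_false, add_zero, one_div]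
    exact inv_anti₀ hd' (by linarith)

theorem inv_one_add_norm_sq_le {u : ℂ} {R : ℝ} (hu : ‖u‖ ≤ R) (d : ℤ) :
    (1 + ‖u + d‖ ^ 2)⁻¹ ≤ 2 * (1 + R ^ 2) * (1 + (d : ℝ) ^ 2)⁻¹ := by
  have h1 : |(d : ℝ)| ≤ ‖u + d‖ + R := by
    have h := norm_sub_le (u + d) u
    rw [add_sub_cancel_left, Complex.norm_intCast] at h
    linarith
  have h2 : (d : ℝ) ^ 2 ≤ (‖u + d‖ + R) ^ 2 := by
    rw [← sq_abs]
    gcongr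
  rw [← div_eq_mul_inv, le_div_iff₀ (by positivity), inv_mul_le_iff₀ (by positivity)]
  nlinarith [sq_nonneg (‖u + d‖ - R), sq_nonneg (‖u + d‖ * R), sq_nonneg R, sq_nonneg ‖u + d‖]

theorem exp_smul_pow [CompleteSpace A] (c : ℂ) (s : A) (k : ℕ) :
    NormedSpace.exp (c • s) ^ k = NormedSpace.exp ((k * c) • s) := by
  induction k with
  | zero => simp
  | succ k ih => rw [pow_succ, ih, ← exp_add', ← add_smul]; congr 2; push_cast; ring

/-- The extension of `e^{cu}` to `A`. -/
theorem nilShift_exp [CompleteSpace A] {ν : A} (hν : IsNilpotent ν) (c u : ℂ) :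
    nilShift ν (fun v => algebraMap ℂ A (cexp (c * v))) u =
      NormedSpace.exp (c • (algebraMap ℂ A u + ν)) := by
  have h := nilShift_entireEval_affine (A := A) (P := 0) (p := 0) Complex.differentiable_exp
    (by simp) hν c u
  simpa only [zero_add, ← exp_eq_entireEval, exp_algebraMap] using h

variable [CompleteSpace A] {P Q : Fin n → A} {p q : Fin n → ℂ}
  (hP : ∀ j, IsNilpotent (P j - algebraMap ℂ A (p j)))
  (hQ : ∀ j, IsNilpotent (Q j - algebraMap ℂ A (q j)))

include hP hQ in
theorem differentiable_seriesTerm_gammaProd (w : ℂ) (d : ℤ) :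
    Differentiable ℂ fun u => seriesTerm r (gammaProd P Q) (algebraMap ℂ A u) w d := by
  simp only [seriesTerm_algebraMap]
  refine Differentiable.fun_const_smul (Differentiable.fun_mul ?_ ?_) _
  · exact differentiable_algebraMap (F := fun u => cexp (-w * (u + d))) (by fun_prop)
  · exact (differentiable_gammaProd hP hQ).comp (differentiable_id.add_const (d : ℂ))

include hP hQ in
theorem nilShift_seriesTerm_gammaProd {ν : A} (hν : IsNilpotent ν) (w u : ℂ) (d : ℤ) :
    nilShift ν (fun v => seriesTerm r (gammaProd P Q) (algebraMap ℂ A v) w d) u =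
      seriesTerm r (gammaProd P Q) (algebraMap ℂ A u + ν) w d := by
  have hd1 : Differentiable ℂ fun v => algebraMap ℂ A (cexp (-w * v)) :=
    differentiable_algebraMap (F := fun u => cexp (-w * u)) (by fun_prop)
  have hd2 := differentiable_gammaProd hP hQ
  have hd := hd1.fun_mul hd2
  have h0 : (fun v => seriesTerm r (gammaProd P Q) (algebraMap ℂ A v) w d) = fun v =>
      algebraMap ℂ A ((-1 : ℂ) ^ (((r : ℤ) - 1) * d)) * (algebraMap ℂ A (cexp (-w * (1 * v + d))) *
        gammaProd P Q (algebraMap ℂ A (1 * v + d))) := by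
    funext v
    rw [seriesTerm_algebraMap, Algebra.smul_def, one_mul]
  have hcomp : Differentiable ℂ fun v => algebraMap ℂ A (cexp (-w * (1 * v + d))) *
      gammaProd P Q (algebraMap ℂ A (1 * v + d)) :=
    hd.comp (by fun_prop : Differentiable ℂ fun v : ℂ => 1 * v + (d : ℂ))
  have hshift := nilShift_comp_affine (ν := ν) hd 1 d u
  rw [h0, nilShift_const_mul hν _ hcomp, hshift, one_smul,
    nilShift_mul hν hd1 hd2, nilShift_exp hν, nilShift_gammaProd hP hQ hν, seriesTerm,
    Algebra.smul_def ((-1 : ℂ) ^ (((r : ℤ) - 1) * d)), one_mul, map_add, neg_smul,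
    show algebraMap ℂ A u + algebraMap ℂ A d + ν = algebraMap ℂ A u + ν + algebraMap ℂ A d by ring]

section
variable (hn : 0 < n) (hpq : ∀ j, 6 ≤ (p j + q j).re)
include hP hQ hn hpq

theorem exists_norm_seriesTerm_le {w : ℂ} (hw : w.re = 0) : ∃ C : ℝ, 0 ≤ C ∧ ∀ (u : ℂ) (d : ℤ),
    ‖seriesTerm r (gammaProd P Q) (algebraMap ℂ A u) w d‖ ≤
      C * Real.exp (w.im * u.im + n * Real.pi * |u.im|) * (1 + ‖u + d‖ ^ 2)⁻¹ := by
  obtain ⟨C, hC0, hC⟩ := exists_norm_gammaProd_le hP hQ hn hpq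
  refine ⟨‖(1 : A)‖ * C, by positivity, fun u d => ?_⟩
  rw [seriesTerm_algebraMap, norm_smul, norm_neg_one_zpow, one_mul]
  refine (norm_mul_le _ _).trans ?_
  have h1 : ‖algebraMap ℂ A (cexp (-w * (u + d)))‖ = Real.exp (w.im * u.im) * ‖(1 : A)‖ := by
    rw [norm_algebraMap, Complex.norm_exp]
    simp [hw]
  rw [h1, Real.exp_add]
  calc _ ≤ Real.exp (w.im * u.im) * ‖(1 : A)‖ *
        (C * (Real.exp (n * Real.pi * |(u + d).im|) / (1 + ‖u + d‖ ^ 2))) := by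
        gcongr
        exact hC _
    _ = _ := by
        simp only [add_im, intCast_im, add_zero]
        ring

theorem locallyDominated_seriesTerm_boundary {w : ℂ} (hw : w.re = 0) :
    LocallyDominated Set.univ fun (d : ℤ) u =>
      seriesTerm r (gammaProd P Q) (algebraMap ℂ A u) w d := by
  obtain ⟨C, hC0, hC⟩ := exists_norm_seriesTerm_le (r := r) hP hQ hn hpq hw
  intro w₀ _
  set R := ‖w₀‖ + 1 with hR
  refine ⟨1, one_pos, fun d => C * Real.exp (|w.im| * R + n * Real.pi * R) *
    (2 * (1 + R ^ 2) * (1 + (d : ℝ) ^ 2)⁻¹),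
    (summable_one_add_sq_inv.mul_left _).mul_left _, fun d u hu => (hC u d).trans ?_⟩
  have huR : ‖u‖ ≤ R := by
    rw [mem_ball_iff_norm] at hu
    linarith [norm_le_norm_add_norm_sub' u w₀]
  have him : |u.im| ≤ R := (Complex.abs_im_le_norm u).trans huR
  have h1 : w.im * u.im ≤ |w.im| * R := by
    refine (le_abs_self _).trans ?_
    rw [abs_mul]
    gcongr
  have h2 := inv_one_add_norm_sq_le huR d
  dsimp only
  gcongr

/-- Along `Re w = 0`, inside the gap, the two-sided series is a combination of `n` exponentials
in `s`. -/
theorem exists_expansion_of_re_eq_zero {w : ℂ} (hw : w.re = 0)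
    (hw' : |w.im - ((n : ℝ) - r) * Real.pi| < Real.pi) :
    ∃ c : Fin n → A, ∀ (s : A) (z : ℂ), IsNilpotent (s - algebraMap ℂ A z) →
      NormedSpace.exp ((((n : ℂ) - r + (n - 1)) * (Real.pi * I)) • s) *
        ∑' d, seriesTerm r (gammaProd P Q) s w d =
          ∑ k : Fin n, c k * NormedSpace.exp ((2 * Real.pi * I) • s) ^ (k : ℕ) := by
  -- `Φ` is the series as a function of a complex exponent `u`
  set f : ℤ → ℂ → A := fun d u => seriesTerm r (gammaProd P Q) (algebraMap ℂ A u) w d with hf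
  have hfd : ∀ d, Differentiable ℂ (f d) := differentiable_seriesTerm_gammaProd hP hQ w
  have hLD : LocallyDominated Set.univ f :=
    locallyDominated_seriesTerm_boundary hP hQ hn hpq hw
  obtain ⟨C, hC0, hC⟩ := exists_norm_seriesTerm_le (r := r) hP hQ hn hpq hw
  set Φ : ℂ → A := fun u => ∑' d, f d u with hΦ
  have hΦd : Differentiable ℂ Φ := differentiableOn_univ.1
    (hLD.differentiableOn_tsum isOpen_univ fun d => (hfd d).differentiableOn)
  have hΦper : ∀ u, Φ (u + 1) = ((-1 : ℂ) ^ ((r : ℤ) - 1)) • Φ u := by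
    intro u
    simp only [hΦ]
    rw [← tsum_const_smul'' , ← (Equiv.addRight (1 : ℤ)).tsum_eq (fun d => _ • f d u)]
    refine tsum_congr fun d => ?_
    simp only [hf, seriesTerm_algebraMap, Equiv.coe_addRight, smul_smul]
    rw [← zpow_add₀ (by norm_num)]
    have h1 : ((r : ℤ) - 1) + ((r : ℤ) - 1) * (d + 1) = ((r : ℤ) - 1) * d + 2 * ((r : ℤ) - 1) := by
      ring
    rw [h1, zpow_add₀ (by norm_num), zpow_mul _ 2]
    rw [show u + 1 + (d : ℂ) = u + ((d + 1 : ℤ) : ℂ) by push_cast; ring]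
    norm_num
  set S : ℝ := ∑' d : ℤ, 4 * (1 + (d : ℝ) ^ 2)⁻¹ with hS
  have hsumS : Summable fun d : ℤ => 4 * (1 + (d : ℝ) ^ 2)⁻¹ := summable_one_add_sq_inv.mul_left 4
  have hbound0 : ∀ u : ℂ, 0 ≤ u.re → u.re ≤ 1 →
      ‖Φ u‖ ≤ C * S * Real.exp (w.im * u.im + n * Real.pi * |u.im|) := by
    intro u h0 h1
    have hd : ∀ d : ℤ, ‖f d u‖ ≤ C * Real.exp (w.im * u.im + n * Real.pi * |u.im|) *
        (4 * (1 + (d : ℝ) ^ 2)⁻¹) := by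
      intro d
      refine (hC u d).trans ?_
      have hre : (1 + ‖u + d‖ ^ 2)⁻¹ ≤ 4 * (1 + (d : ℝ) ^ 2)⁻¹ := by
        have h2 := inv_one_add_norm_sq_le (u := (u.re : ℂ)) (R := 1)
          (by rw [Complex.norm_real, Real.norm_of_nonneg h0]; exact h1) d
        norm_num at h2
        refine le_trans ?_ h2
        refine inv_anti₀ (by positivity) ?_
        gcongr
        have h3 : ((u.re : ℂ) + d) = (((u + d).re : ℝ) : ℂ) := by
          simp
        rw [h3, Complex.norm_real]
        exact Complex.abs_re_le_norm _
      gcongr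
    have hs := (hsumS.mul_left (C * Real.exp (w.im * u.im + n * Real.pi * |u.im|)))
    refine (tsum_of_norm_bounded hs.hasSum hd).trans_eq ?_
    rw [tsum_mul_left]
    ring
  have hper : Function.Periodic (fun u => ‖Φ u‖) 1 := fun u => by
    simp only [hΦper, norm_smul, norm_neg_one_zpow, one_mul]
  have hbound : ∀ u : ℂ, ‖Φ u‖ ≤ C * S * Real.exp (w.im * u.im + n * Real.pi * |u.im|) := by
    intro u
    have h1 : ‖Φ (u + (-⌊u.re⌋ : ℤ) * 1)‖ = ‖Φ u‖ := (hper.int_mul (-⌊u.re⌋)) u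
    have h2 := hbound0 (u + (-⌊u.re⌋ : ℤ) * 1)
      (by simp only [add_re, mul_one, intCast_re]; push_cast; linarith [Int.floor_le u.re])
      (by simp only [add_re, mul_one, intCast_re]; push_cast; linarith [Int.lt_floor_add_one u.re])
    rw [h1] at h2
    simpa using h2
  -- multiplication by `e^{κu}` moves the centre of the gap to `0` and makes the sign `(-1)^{n-1}`
  set κ : ℂ := ((n : ℂ) - r) * (Real.pi * I) with hκ
  have hκd : Differentiable ℂ fun u => algebraMap ℂ A (cexp (κ * u)) :=
    differentiable_algebraMap (F := fun u => cexp (κ * u)) (by fun_prop)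
  obtain ⟨c, hc⟩ := exists_eq_sum_wave (f := fun u => algebraMap ℂ A (cexp (κ * u)) * Φ u)
    (C := ‖(1 : A)‖ * (C * S)) (ψ := w.im - ((n : ℝ) - r) * Real.pi) hn (hκd.fun_mul hΦd)
    hw' (by
      intro u
      refine (norm_mul_le _ _).trans ?_
      have h1 : ‖algebraMap ℂ A (cexp (κ * u))‖ =
          Real.exp (-(((n : ℝ) - r) * Real.pi * u.im)) * ‖(1 : A)‖ := by
        rw [norm_algebraMap, Complex.norm_exp, hκ]
        simp
      rw [h1]
      calc _ ≤ Real.exp (-(((n : ℝ) - r) * Real.pi * u.im)) * ‖(1 : A)‖ *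
            (C * S * Real.exp (w.im * u.im + n * Real.pi * |u.im|)) := by
            gcongr
            exact hbound u
        _ = ‖(1 : A)‖ * (C * S) * (Real.exp (-(((n : ℝ) - r) * Real.pi * u.im)) *
              Real.exp (w.im * u.im + n * Real.pi * |u.im|)) := by ring
        _ = _ := by
            rw [← Real.exp_add]
            congr 2
            ring)
    (by
      intro u
      have h1 : cexp κ = (-1) ^ ((n : ℤ) - r) := by
        have h2 := Complex.exp_int_mul (Real.pi * I) ((n : ℤ) - r)
        rw [exp_pi_mul_I] at h2
        rw [← h2, hκ]
        push_cast
        rfl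
      rw [hΦper, mul_add, mul_one, Complex.exp_add, h1, map_mul, mul_assoc, Algebra.smul_def,
        Algebra.smul_def]
      have h2 : ((-1 : ℂ) ^ ((n : ℤ) - r)) * (-1) ^ ((r : ℤ) - 1) = (-1) ^ (n - 1) := by
        rw [← zpow_add₀ (by norm_num), ← zpow_natCast]
        congr 1
        push_cast [Nat.cast_sub hn]
        ring
      rw [← h2, map_mul]
      ring)
  refine ⟨c, fun s z hs => ?_⟩
  -- translation by the nilpotent part of `s` turns the identity at complex `u` into one at `s`
  have hL : nilShift (s - algebraMap ℂ A z) (fun u => algebraMap ℂ A (cexp (κ * u)) * Φ u) z =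
      NormedSpace.exp (κ • s) * ∑' d, seriesTerm r (gammaProd P Q) s w d := by
    rw [nilShift_mul hs hκd hΦd, nilShift_exp hs, add_sub_cancel, hΦ,
      ← (nilShift_tsum hs hfd hLD z).tsum_eq]
    congr 1
    refine tsum_congr fun d => ?_
    rw [hf, nilShift_seriesTerm_gammaProd hP hQ hs, add_sub_cancel]
  have hR : nilShift (s - algebraMap ℂ A z)
      (fun u => ∑ k, c k * algebraMap ℂ A (wave n k u)) z =
      ∑ k : Fin n, c k * NormedSpace.exp ((Real.pi * I * (2 * (k : ℂ) - (n - 1))) • s) := by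
    rw [nilShift_sum hs _ fun k =>
      (differentiable_algebraMap (differentiable_wave k)).const_mul (c k)]
    refine Finset.sum_congr rfl fun k _ => ?_
    rw [nilShift_const_mul hs _ (differentiable_algebraMap (differentiable_wave k))]
    unfold wave
    rw [nilShift_exp hs, add_sub_cancel]
  have main := (hL.symm.trans (congrArg (fun g => nilShift (s - algebraMap ℂ A z) g z)
    (funext hc))).trans hR
  rw [show ((n : ℂ) - r + (n - 1)) * (Real.pi * I) = (n - 1) * (Real.pi * I) + κ by rw [hκ]; ring,
    add_smul, exp_add', mul_assoc, main, Finset.mul_sum]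
  refine Finset.sum_congr rfl fun k _ => ?_
  rw [exp_smul_pow, mul_left_comm, ← exp_add', ← add_smul]
  congr 3
  ring

/-- The coefficients of the connection formula, in exponential form. -/
def connection (r : ℕ) (s : A) (b : Fin n → A) (j : Fin n) : A :=
  NormedSpace.exp (-((((n : ℂ) - r + (n - 1)) * (Real.pi * I)) • (s - b j))) *
    ∏ i ∈ Finset.univ.erase j,
      ((NormedSpace.exp ((2 * Real.pi * I) • s) - NormedSpace.exp ((2 * Real.pi * I) • b i)) *
        Ring.inverse (NormedSpace.exp ((2 * Real.pi * I) • b j) -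
          NormedSpace.exp ((2 * Real.pi * I) • b i)))

/-- The connection formula for `Re w = 0`: the value of the series at `s` is obtained from its
values at `b_1, …, b_n` by Lagrange interpolation. -/
theorem tsum_seriesTerm_eq_of_re_eq_zero {w : ℂ} (hw : w.re = 0)
    (hw' : |w.im - ((n : ℝ) - r) * Real.pi| < Real.pi) {s : A} {z : ℂ}
    (hs : IsNilpotent (s - algebraMap ℂ A z)) {b : Fin n → A} {β : Fin n → ℂ}
    (hb : ∀ j, IsNilpotent (b j - algebraMap ℂ A (β j)))
    (hX : ∀ i j, i ≠ j → IsUnit (NormedSpace.exp ((2 * Real.pi * I) • b i) -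
      NormedSpace.exp ((2 * Real.pi * I) • b j))) :
    ∑' d, seriesTerm r (gammaProd P Q) s w d =
      ∑ j, connection r s b j * ∑' d, seriesTerm r (gammaProd P Q) (b j) w d := by
  obtain ⟨c, hc⟩ := exists_expansion_of_re_eq_zero (r := r) hP hQ hn hpq hw hw'
  have h1 := hc s z hs
  rw [lagrange_interpolation hX] at h1
  simp only [← hc _ _ (hb _)] at h1
  set α : ℂ := ((n : ℂ) - r + (n - 1)) * (Real.pi * I) with hα
  have hcancel : NormedSpace.exp (-(α • s)) * NormedSpace.exp (α • s) = 1 := by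
    rw [← exp_add', neg_add_cancel, NormedSpace.exp_zero]
  rw [← one_mul (∑' d, seriesTerm r (gammaProd P Q) s w d), ← hcancel, mul_assoc, h1,
    Finset.mul_sum]
  refine Finset.sum_congr rfl fun j _ => ?_
  rw [connection, ← hα, smul_sub, neg_sub, sub_eq_add_neg, exp_add']
  ring

end
end Boundary

/-! ### Analytic continuation of the one-variable series -/

section Continuation

variable {A : Type*} [NormedCommRing A] [NormedAlgebra ℂ A] [CompleteSpace A] {n r : ℕ}

theorem hasDerivAt_seriesTerm (h : A → A) (s : A) (w : ℂ) (d : ℤ) :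
    HasDerivAt (fun w => seriesTerm r h s w d)
      (-((s + algebraMap ℂ A d) * seriesTerm r h s w d)) w := by
  have h1 := hasDerivAt_exp_smul_const (𝕂 := ℂ) (-(s + algebraMap ℂ A d)) w
  simp only [smul_neg] at h1
  have h2 := (h1.mul_const (h (s + algebraMap ℂ A d))).const_smul
    ((-1 : ℂ) ^ (((r : ℤ) - 1) * d))
  refine h2.congr_deriv ?_
  simp only [seriesTerm, Algebra.smul_def]
  ring

theorem differentiable_seriesTerm (h : A → A) (s : A) (d : ℤ) :
    Differentiable ℂ fun w => seriesTerm r h s w d := fun w =>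
  (hasDerivAt_seriesTerm h s w d).differentiableAt

theorem seriesTerm_affine_mul (κ : A) (e : ℂ) (h : A → A) (s : A) (w : ℂ) (d : ℤ) :
    seriesTerm r (fun t => (κ + e • t) * h t) s w d =
      κ * seriesTerm r h s w d - e • deriv (fun w => seriesTerm r h s w d) w := by
  rw [(hasDerivAt_seriesTerm h s w d).deriv]
  simp only [seriesTerm, Algebra.smul_def]
  ring

section Support

variable {h : A → A} {s : A} {C L : ℝ} {S : Set ℂ}

/-- If the coefficients decay quadratically along `s + ℤ` and vanish on the side where `e^{-wd}`
grows, the series is dominated on bounded subsets of `S`, including boundary points. -/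
theorem exists_summable_bound_seriesTerm
    (hh : ∀ d : ℤ, ‖h (s + algebraMap ℂ A d)‖ ≤ C * (1 + (d : ℝ) ^ 2)⁻¹) (hL : 0 ≤ L)
    (hS : ∀ w ∈ S, ∀ d : ℤ, h (s + algebraMap ℂ A d) ≠ 0 → -(w.re * d) ≤ |w.re| * L) (R : ℝ) :
    ∃ b : ℤ → ℝ, Summable b ∧ ∀ d, ∀ w ∈ S, ‖w‖ ≤ R → ‖seriesTerm r h s w d‖ ≤ b d := by
  have hcont : Continuous fun w : ℂ => NormedSpace.exp (w • -s) :=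
    continuous_iff_continuousAt.2 fun w =>
      (hasDerivAt_exp_smul_const (𝕂 := ℂ) (-s) w).continuousAt
  obtain ⟨M, hM⟩ := (isCompact_closedBall (0 : ℂ) R).exists_bound_of_continuousOn hcont.continuousOn
  refine ⟨fun d => M * (Real.exp (R * L) * ‖(1 : A)‖) * (C * (1 + (d : ℝ) ^ 2)⁻¹),
    (summable_one_add_sq_inv.mul_left _).mul_left _, fun d w hw hwR => ?_⟩
  have hMw := hM w (by simpa using hwR)
  have hM0 : 0 ≤ M := (norm_nonneg _).trans hMw
  have hR0 : 0 ≤ R := (norm_nonneg _).trans hwR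
  have hb0 : 0 ≤ C * (1 + (d : ℝ) ^ 2)⁻¹ := (norm_nonneg _).trans (hh d)
  by_cases h0 : h (s + algebraMap ℂ A d) = 0
  · rw [seriesTerm, h0, mul_zero, smul_zero, norm_zero]
    positivity
  · have hsplit : NormedSpace.exp (-(w • (s + algebraMap ℂ A d))) =
        NormedSpace.exp (w • -s) * algebraMap ℂ A (cexp (-(w * d))) := by
      rw [← exp_algebraMap, ← exp_add', smul_add, neg_add, smul_neg, map_neg, map_mul,
        Algebra.smul_def w (algebraMap ℂ A _)]
    have hre : Real.exp (-(w.re * d)) ≤ Real.exp (R * L) := by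
      refine Real.exp_le_exp.2 ((hS w hw d h0).trans ?_)
      have := (Complex.abs_re_le_norm w).trans hwR
      gcongr
    have hexp : ‖algebraMap ℂ A (cexp (-(w * d)))‖ ≤ Real.exp (R * L) * ‖(1 : A)‖ := by
      rw [norm_algebraMap, Complex.norm_exp]
      refine mul_le_mul_of_nonneg_right (le_trans (le_of_eq ?_) hre) (norm_nonneg _)
      simp
    rw [seriesTerm, norm_smul, norm_neg_one_zpow, one_mul, hsplit]
    refine (norm_mul_le _ _).trans (mul_le_mul ((norm_mul_le _ _).trans ?_) (hh d) (norm_nonneg _)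
      (by positivity))
    gcongr

theorem locallyDominated_seriesTerm
    (hh : ∀ d : ℤ, ‖h (s + algebraMap ℂ A d)‖ ≤ C * (1 + (d : ℝ) ^ 2)⁻¹) (hL : 0 ≤ L)
    (hS : ∀ w ∈ S, ∀ d : ℤ, h (s + algebraMap ℂ A d) ≠ 0 → -(w.re * d) ≤ |w.re| * L)
    (hopen : IsOpen S) : LocallyDominated S fun d w => seriesTerm r h s w d := by
  intro w hw
  obtain ⟨ρ, hρ, hsub⟩ := Metric.isOpen_iff.1 hopen w hw
  obtain ⟨b, hb, hbd⟩ := exists_summable_bound_seriesTerm (r := r) hh hL hS (‖w‖ + ρ)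
  refine ⟨ρ, hρ, b, hb, fun d v hv => hbd d v (hsub hv) ?_⟩
  rw [mem_ball_iff_norm] at hv
  linarith [norm_le_norm_add_norm_sub' v w]

theorem continuousOn_tsum_seriesTerm
    (hh : ∀ d : ℤ, ‖h (s + algebraMap ℂ A d)‖ ≤ C * (1 + (d : ℝ) ^ 2)⁻¹) (hL : 0 ≤ L)
    (hS : ∀ w ∈ S, ∀ d : ℤ, h (s + algebraMap ℂ A d) ≠ 0 → -(w.re * d) ≤ |w.re| * L) :
    ContinuousOn (fun w => ∑' d, seriesTerm r h s w d) S := by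
  intro w hw
  obtain ⟨b, hb, hbd⟩ := exists_summable_bound_seriesTerm (r := r) hh hL hS (‖w‖ + 1)
  have hc : ContinuousOn (fun w => ∑' d, seriesTerm r h s w d) (S ∩ Metric.ball w 1) := by
    refine continuousOn_tsum (fun d => (differentiable_seriesTerm h s d).continuous.continuousOn) hb
      fun d v hv => hbd d v hv.1 ?_
    have hv2 := hv.2
    rw [mem_ball_iff_norm] at hv2
    linarith [norm_le_norm_add_norm_sub' v w]
  exact (hc w ⟨hw, Metric.mem_ball_self one_pos⟩).mono_of_mem_nhdsWithin
    (inter_mem_nhdsWithin S (Metric.ball_mem_nhds w one_pos))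

end Support

theorem isOpen_re_neg : IsOpen {w : ℂ | w.re < 0} :=
  isOpen_lt Complex.continuous_re continuous_const

theorem isOpen_re_pos : IsOpen {w : ℂ | 0 < w.re} :=
  isOpen_lt continuous_const Complex.continuous_re

/-- The series with coefficient function `h` converges at `s` for `Re w < 0` and at every `b_j` for
`Re w > 0`, and its sum at `s` continues holomorphically across the gap of the slit plane to the
combination of its sums at the `b_j` with coefficients `K_j`. -/
structure Continues (r : ℕ) (c : ℝ) (s : A) (b K : Fin n → A) (h : A → A) : Prop where
  left : LocallyDominated {w : ℂ | w.re < 0} fun d w => seriesTerm r h s w d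
  right : ∀ j, LocallyDominated {w : ℂ | 0 < w.re} fun d w => seriesTerm r h (b j) w d
  exists_extension : ∃ G : ℂ → A, DifferentiableOn ℂ G (slitPlane c) ∧
    (∀ w : ℂ, w.re < 0 → G w = ∑' d, seriesTerm r h s w d) ∧
    ∀ w : ℂ, 0 < w.re → G w = ∑ j, K j * ∑' d, seriesTerm r h (b j) w d

section Operators

variable {c : ℝ} {s : A} {b K : Fin n → A} {h : A → A}

/-- The operator `κ - e · d/dw` can be applied termwise. -/
theorem LocallyDominated.affine {U : Set ℂ} (hU : IsOpen U) {f : ℤ → ℂ → A}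
    (hf : ∀ d, Differentiable ℂ (f d)) (h : LocallyDominated U f) (κ : A) (e : ℂ) :
    LocallyDominated U (fun d w => κ * f d w - e • _root_.deriv (f d) w) ∧
    ∀ w ∈ U, ∑' d, (κ * f d w - e • _root_.deriv (f d) w) =
      κ * ∑' d, f d w - e • _root_.deriv (fun w => ∑' d, f d w) w := by
  have hf' := fun d => (hf d).differentiableOn (s := U)
  have h' := h.of_deriv hU hf'
  refine ⟨fun w hw => ?_, fun w hw => ?_⟩
  · obtain ⟨ρ₁, hρ₁, b₁, hb₁, hfb₁⟩ := h w hw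
    obtain ⟨ρ₂, hρ₂, b₂, hb₂, hfb₂⟩ := h' w hw
    refine ⟨min ρ₁ ρ₂, lt_min hρ₁ hρ₂, fun d => ‖κ‖ * b₁ d + ‖e‖ * b₂ d,
      (hb₁.mul_left _).add (hb₂.mul_left _), fun d v hv => ?_⟩
    refine (norm_sub_le _ _).trans (add_le_add ((norm_mul_le _ _).trans ?_) ?_)
    · gcongr
      exact hfb₁ d v (Metric.ball_subset_ball (min_le_left _ _) hv)
    · rw [norm_smul]
      gcongr
      exact hfb₂ d v (Metric.ball_subset_ball (min_le_right _ _) hv)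
  · exact (((h.summable_norm hw).of_norm.hasSum.mul_left κ).sub
      ((h.hasSum_deriv hU hf' hw).const_smul e)).tsum_eq

/-- The operator `κ - e · d/dw` multiplies the coefficient function by `κ + e t`. -/
theorem Continues.affine_mul (hc : Continues r c s b K h) (κ : A) (e : ℂ) :
    Continues r c s b K fun t => (κ + e • t) * h t := by
  obtain ⟨G, hG, hGl, hGr⟩ := hc.exists_extension
  have hl := hc.left.affine isOpen_re_neg (differentiable_seriesTerm h s) κ e
  have hr := fun j => (hc.right j).affine isOpen_re_pos (differentiable_seriesTerm h (b j)) κ e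
  refine ⟨?_, fun j => ?_, fun w => κ * G w - e • deriv G w, ?_, fun w hw => ?_, fun w hw => ?_⟩
  · simpa only [seriesTerm_affine_mul] using hl.1
  · simpa only [seriesTerm_affine_mul] using (hr j).1
  · exact (hG.const_mul κ).sub ((hG.deriv (isOpen_slitPlane c)).const_smul e)
  · simp only [seriesTerm_affine_mul]
    have heq : G =ᶠ[𝓝 w] fun w => ∑' d, seriesTerm r h s w d := by
      filter_upwards [isOpen_re_neg.mem_nhds hw] with v hv using hGl v hv
    rw [hl.2 w hw, heq.deriv_eq, hGl w hw]
  · simp only [seriesTerm_affine_mul]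
    have heq : G =ᶠ[𝓝 w] fun w => ∑ j, K j * ∑' d, seriesTerm r h (b j) w d := by
      filter_upwards [isOpen_re_pos.mem_nhds hw] with v hv using hGr v hv
    have hd : ∀ j, DifferentiableAt ℂ (fun w => ∑' d, seriesTerm r h (b j) w d) w := fun j =>
      ((hc.right j).differentiableOn_tsum isOpen_re_pos fun d =>
        (differentiable_seriesTerm h (b j) d).differentiableOn).differentiableAt
          (isOpen_re_pos.mem_nhds hw)
    rw [heq.deriv_eq, hGr w hw, deriv_fun_sum fun j _ => (hd j).const_mul (K j), Finset.mul_sum,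
      Finset.smul_sum, ← Finset.sum_sub_distrib]
    refine Finset.sum_congr rfl fun j _ => ?_
    rw [(hr j).2 w hw, deriv_const_mul _ (hd j), mul_sub, mul_smul_comm, mul_left_comm]

theorem Continues.prod_mul {ι : Type*} (hc : Continues r c s b K h) (I : Finset ι) (κ : ι → A)
    (e : ι → ℂ) : Continues r c s b K fun t => (∏ i ∈ I, (κ i + e i • t)) * h t := by
  classical
  induction I using Finset.induction_on with
  | empty => simpa using hc
  | insert i I hi ih =>
    simp only [Finset.prod_insert hi, mul_assoc]
    exact ih.affine_mul (κ i) (e i)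

omit [CompleteSpace A] in
theorem Continues.congr {h' : A → A} (hc : Continues r c s b K h)
    (hs : ∀ d : ℤ, h' (s + algebraMap ℂ A d) = h (s + algebraMap ℂ A d))
    (hb : ∀ j, ∀ d : ℤ, h' (b j + algebraMap ℂ A d) = h (b j + algebraMap ℂ A d)) :
    Continues r c s b K h' := by
  have h1 : ∀ w d, seriesTerm r h' s w d = seriesTerm r h s w d := fun w d => by
    rw [seriesTerm, seriesTerm, hs]
  have h2 : ∀ j w d, seriesTerm r h' (b j) w d = seriesTerm r h (b j) w d := fun j w d => by
    rw [seriesTerm, seriesTerm, hb]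
  refine ⟨?_, ?_, ?_⟩
  · simpa only [h1] using hc.left
  · simpa only [h2] using hc.right
  · simpa only [h1, h2] using hc.exists_extension

end Operators

section GammaProd

variable {P Q : Fin n → A} {p q : Fin n → ℂ}
  (hP : ∀ j, IsNilpotent (P j - algebraMap ℂ A (p j)))
  (hQ : ∀ j, IsNilpotent (Q j - algebraMap ℂ A (q j)))
  {s : A} {z : ℂ} (hs : IsNilpotent (s - algebraMap ℂ A z))
  {b : Fin n → A} {β : Fin n → ℂ} (hb : ∀ j, IsNilpotent (b j - algebraMap ℂ A (β j)))
  (hX : ∀ i j, i ≠ j → IsUnit (NormedSpace.exp ((2 * Real.pi * I) • b i) -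
      NormedSpace.exp ((2 * Real.pi * I) • b j)))
  (hsP : ∃ (j : Fin n) (L : ℤ), P j - s = algebraMap ℂ A L)
  (hbQ : ∀ j, ∃ L : ℤ, Q j + b j = algebraMap ℂ A L)

/-- The entire function `1/Γ` vanishes at the nonpositive integers; this agrees with the conventions
`Γ(-m) = 0` and `0⁻¹ = 0`. -/
theorem rGamma_int_eq_zero {k : ℤ} (hk : k ≤ 0) : rGamma (algebraMap ℂ A k) = 0 := by
  obtain ⟨m, rfl⟩ : ∃ m : ℕ, k = -(m : ℤ) := ⟨(-k).toNat, by lia⟩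
  rw [rGamma_algebraMap]
  push_cast
  rw [Complex.Gamma_neg_nat_eq_zero, inv_zero, map_zero]

include hsP in
/-- At `s` the series runs over exponents bounded above. -/
theorem exists_forall_gammaProd_eq_zero_left :
    ∃ L : ℤ, 0 ≤ L ∧ ∀ d : ℤ, L < d → gammaProd P Q (s + algebraMap ℂ A d) = 0 := by
  obtain ⟨j, L, hL⟩ := hsP
  refine ⟨max L 0, le_max_right _ _, fun d hd => ?_⟩
  refine Finset.prod_eq_zero (Finset.mem_univ j) ?_
  have h1 : P j - (s + algebraMap ℂ A d) = algebraMap ℂ A ((L - d : ℤ) : ℂ) := by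
    rw [Int.cast_sub, map_sub, ← hL]
    ring
  rw [h1, rGamma_int_eq_zero (by lia), zero_mul]

include hbQ in
/-- At `b_j` the series runs over exponents bounded below. -/
theorem exists_forall_gammaProd_eq_zero_right (j : Fin n) :
    ∃ L : ℤ, 0 ≤ L ∧ ∀ d : ℤ, d < -L → gammaProd P Q (b j + algebraMap ℂ A d) = 0 := by
  obtain ⟨L, hL⟩ := hbQ j
  refine ⟨max L 0, le_max_right _ _, fun d hd => ?_⟩
  refine Finset.prod_eq_zero (Finset.mem_univ j) ?_
  have h1 : Q j + (b j + algebraMap ℂ A d) = algebraMap ℂ A ((L + d : ℤ) : ℂ) := by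
    rw [Int.cast_add, map_add, ← hL]
    ring
  rw [h1, rGamma_int_eq_zero (by lia), mul_zero]

include hP hQ hs hb hX hsP hbQ in
/-- If all `Re (P_j + Q_j)` are large, the series converge up to `Re w = 0`, where the connection
formula holds in the gap; so the two sides glue to a holomorphic function. -/
theorem continues_gammaProd_of_large (hn : 0 < n) (hpq : ∀ j, 6 ≤ (p j + q j).re) :
    Continues r ((n : ℝ) - r) s b (connection r s b) (gammaProd P Q) := by
  obtain ⟨C, -, hC⟩ := exists_norm_gammaProd_add_int_le hP hQ hn hpq hs
  choose C' _ hC' using fun j => exists_norm_gammaProd_add_int_le hP hQ hn hpq (hb j)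
  obtain ⟨L, hL0, hL⟩ := exists_forall_gammaProd_eq_zero_left (Q := Q) hsP
  choose L' hL0' hL' using exists_forall_gammaProd_eq_zero_right (P := P) hbQ
  have hS : ∀ w ∈ {w : ℂ | w.re ≤ 0}, ∀ d : ℤ,
      gammaProd P Q (s + algebraMap ℂ A d) ≠ 0 → -(w.re * d) ≤ |w.re| * L := by
    intro w hw d hd
    have h1 : d ≤ L := not_lt.1 fun h => hd (hL d h)
    have h2 : (d : ℝ) ≤ L := by exact_mod_cast h1
    rw [abs_of_nonpos hw]
    nlinarith [Set.mem_ofPred.1 hw]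
  have hS' : ∀ j, ∀ w ∈ {w : ℂ | 0 ≤ w.re}, ∀ d : ℤ,
      gammaProd P Q (b j + algebraMap ℂ A d) ≠ 0 → -(w.re * d) ≤ |w.re| * L' j := by
    intro j w hw d hd
    have h1 : -L' j ≤ d := not_lt.1 fun h => hd (hL' j d h)
    have h2 : -(L' j : ℝ) ≤ d := by exact_mod_cast h1
    rw [abs_of_nonneg hw]
    nlinarith [Set.mem_ofPred.1 hw]
  have hLr : (0 : ℝ) ≤ L := by exact_mod_cast hL0
  have hLr' : ∀ j, (0 : ℝ) ≤ L' j := fun j => by exact_mod_cast hL0' j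
  have hleft : LocallyDominated {w : ℂ | w.re < 0}
      fun d w => seriesTerm r (gammaProd P Q) s w d :=
    locallyDominated_seriesTerm hC hLr (fun w hw => hS w (Set.mem_ofPred.1 hw).le) isOpen_re_neg
  have hright : ∀ j, LocallyDominated {w : ℂ | 0 < w.re}
      fun d w => seriesTerm r (gammaProd P Q) (b j) w d := fun j =>
    locallyDominated_seriesTerm (hC' j) (hLr' j) (fun w hw => hS' j w (Set.mem_ofPred.1 hw).le)
      isOpen_re_pos
  classical
  set f : ℂ → A := fun w => ∑' d, seriesTerm r (gammaProd P Q) s w d with hf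
  set g : ℂ → A := fun w =>
    ∑ j, connection r s b j * ∑' d, seriesTerm r (gammaProd P Q) (b j) w d with hg
  set G : ℂ → A := fun w => if w.re ≤ 0 then f w else g w with hG
  have hGl : ∀ w : ℂ, w.re < 0 → G w = f w := fun w hw => if_pos hw.le
  have hGr : ∀ w : ℂ, 0 < w.re → G w = g w := fun w hw => if_neg (not_le.2 hw)
  refine ⟨hleft, hright, G, ?_, hGl, hGr⟩
  have hfc : ContinuousOn f {w : ℂ | w.re ≤ 0} := continuousOn_tsum_seriesTerm hC hLr hS
  have hgc : ContinuousOn g {w : ℂ | 0 ≤ w.re} := continuousOn_finsetSum _ fun j _ =>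
    continuousOn_const.mul (continuousOn_tsum_seriesTerm (hC' j) (hLr' j) (hS' j))
  refine differentiableOn_of_continuousOn_of_re_ne_zero (isOpen_slitPlane _) ?_ ?_
  · refine ContinuousOn.if ?_ (hfc.mono ?_) (hgc.mono ?_)
    · rintro w ⟨hw, hfr⟩
      rw [Complex.frontier_setOfPred_re_le] at hfr
      have hw0 : w.re = 0 := hfr
      refine tsum_seriesTerm_eq_of_re_eq_zero hP hQ hn hpq hw0 ?_ hs hb hX
      exact hw.resolve_left fun h => h hw0
    · rintro w ⟨-, hw⟩
      rwa [(isClosed_le Complex.continuous_re continuous_const).closure_eq] at hw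
    · rintro w ⟨-, hw⟩
      simp only [not_le] at hw
      rwa [Complex.closure_setOfPred_lt_re] at hw
  · rintro w ⟨-, hw⟩
    refine DifferentiableAt.differentiableWithinAt ?_
    rcases lt_or_gt_of_ne hw with h | h
    · have hfd : DifferentiableAt ℂ f w := (hleft.differentiableOn_tsum isOpen_re_neg fun d =>
        (differentiable_seriesTerm _ _ d).differentiableOn).differentiableAt
          (isOpen_re_neg.mem_nhds h)
      refine hfd.congr_of_eventuallyEq ?_
      filter_upwards [isOpen_re_neg.mem_nhds h] with v hv using hGl v hv
    · have hgd : DifferentiableAt ℂ g w := DifferentiableAt.fun_sum fun j _ =>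
        (((hright j).differentiableOn_tsum isOpen_re_pos fun d =>
          (differentiable_seriesTerm _ _ d).differentiableOn).differentiableAt
            (isOpen_re_pos.mem_nhds h)).const_mul _
      refine hgd.congr_of_eventuallyEq ?_
      filter_upwards [isOpen_re_pos.mem_nhds h] with v hv using hGr v hv

/-- The recurrence of `1/Γ`, iterated `N` times. -/
theorem rGamma_eq_prod_mul {a : A} {z : ℂ} (ha : IsNilpotent (a - algebraMap ℂ A z)) (N : ℕ) :
    rGamma a = (∏ i ∈ Finset.range N, (a + algebraMap ℂ A i)) * rGamma (a + algebraMap ℂ A N) := by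
  induction N with
  | zero => simp
  | succ N ih =>
    have h1 : rGamma (a + algebraMap ℂ A N) =
        (a + algebraMap ℂ A N) * rGamma (a + algebraMap ℂ A N + 1) :=
      rGamma_eq_mul (z := z + N) (by rwa [map_add, add_sub_add_right_eq_sub])
    rw [ih, Finset.prod_range_succ, h1, mul_assoc]
    rw [Nat.cast_succ, map_add, map_one, add_assoc]

include hP in
/-- Raising all parameters `P_j` by `N` divides the coefficient function by affine functions. -/
theorem gammaProd_eq_prod_mul (Q : Fin n → A) {t : A} {y : ℂ}
    (ht : IsNilpotent (t - algebraMap ℂ A y)) (N : ℕ) :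
    gammaProd P Q t =
      (∏ i ∈ Finset.univ ×ˢ Finset.range N, ((P i.1 + algebraMap ℂ A i.2) + (-1 : ℂ) • t)) *
        gammaProd (fun j => P j + algebraMap ℂ A N) Q t := by
  rw [Finset.prod_product, gammaProd, gammaProd, ← Finset.prod_mul_distrib]
  refine Finset.prod_congr rfl fun j _ => ?_
  have h1 : IsNilpotent (P j - t - algebraMap ℂ A (p j - y)) := by
    rw [map_sub, show P j - t - (algebraMap ℂ A (p j) - algebraMap ℂ A y) =
      (P j - algebraMap ℂ A (p j)) - (t - algebraMap ℂ A y) by ring]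
    exact (Commute.all _ _).isNilpotent_sub (hP j) ht
  rw [rGamma_eq_prod_mul h1 N, ← mul_assoc]
  have h2 : ∀ i : ℕ, P j + algebraMap ℂ A i + (-1 : ℂ) • t =
      P j - t + algebraMap ℂ A i := fun i => by
    rw [neg_one_smul]
    ring
  simp only [h2]
  rw [show P j + algebraMap ℂ A N - t = P j - t + algebraMap ℂ A N by ring]

include hP hQ hs hb hX hsP hbQ in
/-- The one-variable continuation theorem, for the coefficient functions `t^p h(t)`. The factors
by which `t^p h(t)` differs from a coefficient function with large parameters are realized by
differential operators. -/
theorem continues_pow_mul_gammaProd (hn : 0 < n) (k : ℕ) :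
    Continues r ((n : ℝ) - r) s b (connection r s b) fun t => t ^ k * gammaProd P Q t := by
  -- `N` makes all `Re (P_j + N + Q_j)` at least `6`
  obtain ⟨N, hN⟩ := exists_nat_ge (6 + ∑ j, ‖p j + q j‖)
  have hbase := continues_gammaProd_of_large (r := r) (P := fun j => P j + algebraMap ℂ A N)
    (p := fun j => p j + N) (fun j => by rw [map_add, add_sub_add_right_eq_sub]; exact hP j)
    hQ hs hb hX
    (by
      obtain ⟨j, L, hL⟩ := hsP
      refine ⟨j, L + N, ?_⟩
      rw [Int.cast_add, Int.cast_natCast, map_add, ← hL]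
      ring)
    hbQ hn (fun j => by
      have h1 : ‖p j + q j‖ ≤ ∑ j, ‖p j + q j‖ :=
        Finset.single_le_sum (f := fun j => ‖p j + q j‖) (fun _ _ => norm_nonneg _)
          (Finset.mem_univ j)
      have h2 := (abs_le.1 (Complex.abs_re_le_norm (p j + q j))).1
      simp only [add_re, natCast_re] at h2 ⊢
      linarith)
  refine ((hbase.prod_mul (Finset.univ ×ˢ Finset.range N)
    (fun i => P i.1 + algebraMap ℂ A i.2) fun _ => -1).prod_mul (Finset.range k) 0
      fun _ => 1).congr (fun d => ?_) fun j d => ?_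
  · rw [gammaProd_eq_prod_mul hP Q (y := z + d) (by rwa [map_add, add_sub_add_right_eq_sub]) N]
    simp
  · rw [gammaProd_eq_prod_mul hP Q (y := β j + d)
      (by rw [map_add, add_sub_add_right_eq_sub]; exact hb j) N]
    simp

end GammaProd
end Continuation

/-! ### Determinants of one-variable series -/

section Determinant

/-- Fubini for a product of absolutely convergent series in separate variables. -/
theorem hasSum_prod_of_summable_norm {A : Type*} [NormedCommRing A] [CompleteSpace A] {r : ℕ}
    (f : Fin r → ℤ → A) (hf : ∀ k, Summable fun d => ‖f k d‖) :
    (Summable fun d : Fin r → ℤ => ‖∏ k, f k (d k)‖) ∧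
      HasSum (fun d : Fin r → ℤ => ∏ k, f k (d k)) (∏ k, ∑' d, f k d) := by
  induction r with
  | zero =>
    refine ⟨(hasSum_fintype _).summable, ?_⟩
    simp
  | succ r ih =>
    obtain ⟨h1, h2⟩ := ih (fun k => f k.succ) fun k => hf k.succ
    have h3 := (hf 0).mul_norm h1
    have h4 := h3.of_norm.hasSum
    rw [← tsum_mul_tsum_of_summable_norm (hf 0) h1, h2.tsum_eq] at h4
    have e : ∀ d : ℤ × (Fin r → ℤ), f 0 d.1 * ∏ k : Fin r, f k.succ (d.2 k) =
        ∏ k, f k (Fin.consEquiv (fun _ => ℤ) d k) := fun d => by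
      rw [Fin.prod_univ_succ]
      simp [Fin.consEquiv]
    simp only [e] at h3 h4
    rw [Fin.prod_univ_succ]
    exact ⟨(Fin.consEquiv fun _ : Fin (r + 1) => ℤ).summable_iff.1 h3,
      (Fin.consEquiv fun _ : Fin (r + 1) => ℤ).hasSum_iff.1 h4⟩

/-- The Cauchy-Binet expansion of the determinant of a product. -/
theorem det_sum_mul {R : Type*} [CommRing R] {n r : ℕ} (K : Fin r → Fin n → R)
    (S : Fin n → Fin r → R) :
    (Matrix.of fun k p => ∑ j, K k j * S j p).det =
      ∑ f : Fin r ↪ Fin n, (∏ k, K k (f k)) * (Matrix.of fun k p => S (f k) p).det := by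
  classical
  have h1 : (Matrix.of fun k p => ∑ j, K k j * S j p).det =
      ∑ f : Fin r → Fin n, (∏ k, K k (f k)) * (Matrix.of fun k p => S (f k) p).det := by
    have h2 := (Matrix.detRowAlternating (R := R) (n := Fin r)).toMultilinearMap.map_sum
      (fun k j => K k j • S j)
    have h3 : (Matrix.of fun k p => ∑ j, K k j * S j p) = fun k => ∑ j, K k j • S j := by
      funext k p
      simp
    rw [h3]
    refine h2.trans (Finset.sum_congr rfl fun f _ => ?_)
    exact (Matrix.detRowAlternating (R := R) (n := Fin r)).toMultilinearMap.map_smul_univ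
      (fun k => K k (f k)) fun k => S (f k)
  rw [h1]
  refine (Finset.sum_of_injOn (fun f : Fin r ↪ Fin n => (f : Fin r → Fin n))
    DFunLike.coe_injective.injOn (fun _ _ => Finset.mem_coe.2 (Finset.mem_univ _))
    (fun f _ hf => ?_) fun _ _ => rfl).symm
  -- a map which is not injective gives a determinant with two equal rows
  have hinj : ¬ Function.Injective f := fun h =>
    hf ⟨⟨f, h⟩, Finset.mem_coe.2 (Finset.mem_univ _), rfl⟩
  obtain ⟨i, j, hij, hne⟩ : ∃ i j, f i = f j ∧ i ≠ j := by
    simpa [Function.Injective] using hinj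
  rw [Matrix.det_zero_of_row_eq hne (by funext p; simp [hij]), mul_zero]

variable {A : Type*} [NormedCommRing A] [NormedAlgebra ℂ A] {r : ℕ}

/-- The summand of index `d` of the `r`-variable series with coefficient function `h`: the product
of the summands of the one-variable series, times the Vandermonde product of the exponents. -/
def detTerm (h : A → A) (s : Fin r → A) (w : Fin r → ℂ) (d : Fin r → ℤ) : A :=
  (∏ k, ∏ i ∈ Finset.Iio k,
    ((s k + algebraMap ℂ A (d k)) - (s i + algebraMap ℂ A (d i)))) *
      ∏ k, seriesTerm r h (s k) (w k) (d k)

omit [NormedAlgebra ℂ A] in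
theorem prod_Iio_sub_eq_det (t : Fin r → A) :
    ∏ k, ∏ i ∈ Finset.Iio k, (t k - t i) = (Matrix.vandermonde t).det := by
  rw [Matrix.det_vandermonde]
  refine Finset.prod_comm' ?_
  simp

theorem detTerm_eq_det (h : A → A) (s : Fin r → A) (w : Fin r → ℂ) (d : Fin r → ℤ) :
    detTerm h s w d = (Matrix.of fun k p : Fin r =>
      seriesTerm r (fun t => t ^ (p : ℕ) * h t) (s k) (w k) (d k)).det := by
  rw [detTerm, prod_Iio_sub_eq_det, mul_comm, ← Matrix.det_mul_column]
  congr 1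
  ext k p
  simp only [Matrix.of_apply, Matrix.vandermonde_apply, seriesTerm, Algebra.smul_def]
  ring

/-- The `r`-variable series is the determinant of the one-variable series with coefficient functions
`t^p h(t)`. -/
theorem hasSum_detTerm [CompleteSpace A] (h : A → A) (s : Fin r → A) (w : Fin r → ℂ)
    (hs : ∀ k p : Fin r,
      Summable fun d => ‖seriesTerm r (fun t => t ^ (p : ℕ) * h t) (s k) (w k) d‖) :
    HasSum (detTerm h s w) (Matrix.of fun k p : Fin r =>
      ∑' d, seriesTerm r (fun t => t ^ (p : ℕ) * h t) (s k) (w k) d).det := by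
  have h1 : detTerm h s w = fun d => ∑ σ : Equiv.Perm (Fin r), Equiv.Perm.sign σ •
      ∏ k, seriesTerm r (fun t => t ^ ((σ k : Fin r) : ℕ) * h t) (s k) (w k) (d k) := by
    funext d
    rw [detTerm_eq_det, ← Matrix.det_transpose, Matrix.det_apply]
    rfl
  rw [h1, ← Matrix.det_transpose, Matrix.det_apply]
  refine hasSum_sum fun σ _ => ?_
  exact (hasSum_prod_of_summable_norm _ fun k => hs k (σ k)).2.const_smul _

end Determinant

/-! ### The trigonometric form of the connection coefficients -/

section Sines

variable {A : Type*} [NormedCommRing A] [NormedAlgebra ℂ A] [CompleteSpace A] {n r : ℕ}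

theorem iteratedDeriv_sin_zero (k : ℕ) :
    iteratedDeriv k Complex.sin 0 = (2 * I)⁻¹ * (I ^ k - (-I) ^ k) := by
  have h1 : Complex.sin = fun z => (2 * I)⁻¹ * (cexp (I * z) - cexp (-I * z)) := by
    funext z
    rw [Complex.sin, mul_inv, Complex.inv_I, mul_comm I z, neg_mul, neg_mul, mul_comm I z]
    ring
  have h2 : ContDiffAt ℂ k (fun z => cexp (I * z)) 0 := by fun_prop
  have h3 : ContDiffAt ℂ k (fun z => cexp (-I * z)) 0 := by fun_prop
  rw [h1, iteratedDeriv_const_mul _ (h2.sub h3), iteratedDeriv_fun_sub h2 h3,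
    iteratedDeriv_cexp_const_mul, iteratedDeriv_cexp_const_mul]
  simp

theorem sinHalf_eq (a : A) : sinHalf a = (2 * I : ℂ)⁻¹ •
    (NormedSpace.exp ((2 : ℂ)⁻¹ • a) - NormedSpace.exp (-((2 : ℂ)⁻¹ • a))) := by
  let _ : NormedAlgebra ℚ A := NormedAlgebra.restrictScalars ℚ ℂ A
  have h1 := NormedSpace.exp_series_hasSum_exp' (𝕂 := ℂ) ((2 : ℂ)⁻¹ • a)
  have h2 := NormedSpace.exp_series_hasSum_exp' (𝕂 := ℂ) (-((2 : ℂ)⁻¹ • a))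
  rw [sinHalf, entireEval, ← ((h1.sub h2).const_smul (2 * I : ℂ)⁻¹).tsum_eq]
  refine tsum_congr fun k => ?_
  rw [iteratedDeriv_sin_zero, ← neg_smul, smul_pow, smul_pow, smul_pow, ← smul_assoc, ← smul_assoc,
    ← smul_assoc, ← sub_smul, ← smul_assoc]
  congr 1
  have h3 : I ^ k * (2 * I)⁻¹ ^ k = (2 : ℂ)⁻¹ ^ k := by
    rw [← mul_pow]
    congr 1
    field_simp
  have h4 : (-I) ^ k * (2 * I)⁻¹ ^ k = (-(2 : ℂ)⁻¹) ^ k := by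
    rw [← mul_pow]
    congr 1
    field_simp
  simp only [smul_eq_mul, ← h3, ← h4]
  ring

omit [CompleteSpace A] in
theorem two_pi_I_smul_twoPiIDiv (a : A) : (2 * Real.pi * I : ℂ) • twoPiIDiv a = a := by
  rw [twoPiIDiv, smul_smul, mul_inv_cancel₀ Complex.two_pi_I_ne_zero, one_smul]

theorem exp_sub_exp (a b : A) : NormedSpace.exp (-a) - NormedSpace.exp (-b) =
    -(2 * I : ℂ) • (NormedSpace.exp (-((2 : ℂ)⁻¹ • (a + b))) * sinHalf (-b + a)) := by
  rw [sinHalf_eq, mul_smul_comm, smul_smul, neg_mul, mul_inv_cancel₀ (by simp), mul_sub, ← exp_add',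
    ← exp_add', neg_smul, one_smul, neg_sub]
  have e : ∀ c : A, c = (2 : ℂ)⁻¹ • (c + c) := fun c => by
    rw [← two_smul ℂ c, smul_smul, inv_mul_cancel₀ two_ne_zero, one_smul]
  congr 2
  · rw [← neg_add, ← smul_add, show a + b + (-b + a) = a + a by ring, ← e]
  · rw [neg_add_eq_sub, ← smul_sub, show -b + a - (a + b) = -b + -b by ring, ← e]

theorem isUnit_exp (a : A) : IsUnit (NormedSpace.exp a) := by
  refine IsUnit.of_mul_eq_one (NormedSpace.exp (-a)) ?_
  rw [← exp_add', add_neg_cancel, NormedSpace.exp_zero]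

/-- The value `F(a)` differs from the scalar `F(α)` by a nilpotent element. -/
theorem isUnit_entireEval {F : ℂ → ℂ} (hF : Differentiable ℂ F) {a : A} {α : ℂ}
    (ha : IsNilpotent (a - algebraMap ℂ A α)) (h0 : F α ≠ 0) : IsUnit (entireEval F a) := by
  have h1 := entireEval_add_nilpotent hF ha α
  rw [add_sub_cancel] at h1
  obtain ⟨N, hN⟩ := id ha
  rw [h1, nilShift_eq_sum (N := N + 1) (by rw [pow_succ, hN, zero_mul]), Finset.sum_range_succ']
  simp only [Nat.factorial_zero, Nat.cast_one, inv_one, pow_zero, iteratedDeriv_zero, one_mul,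
    one_smul, add_comm _ (algebraMap ℂ A (F α))]
  refine IsNilpotent.isUnit_add_left_of_commute ?_ ((isUnit_iff_ne_zero.2 h0).map _)
    (Commute.all _ _)
  refine isNilpotent_sum fun k _ => ?_
  rw [Algebra.smul_def, pow_succ, mul_right_comm, ← mul_assoc, ← mul_assoc]
  exact (Commute.all _ _).isNilpotent_mul_left ha

theorem isUnit_sinHalf {a : A} {α : ℂ} (ha : IsNilpotent (a - algebraMap ℂ A α))
    (h : ∀ N : ℤ, α ≠ 2 * Real.pi * I * N) : IsUnit (sinHalf a) := by
  refine isUnit_entireEval Complex.differentiable_sin (α := (2 * I : ℂ)⁻¹ * α) ?_ ?_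
  · rw [map_mul, ← Algebra.smul_def, ← smul_sub, Algebra.smul_def]
    exact (Commute.all _ _).isNilpotent_mul_left ha
  · intro h0
    obtain ⟨N, hN⟩ := Complex.sin_eq_zero_iff.1 h0
    refine h N ?_
    rw [inv_mul_eq_iff_eq_mul₀ (by simp)] at hN
    rw [hN]
    ring

theorem inverse_prod {M ι : Type*} [CommMonoidWithZero M] (S : Finset ι) (f : ι → M) :
    Ring.inverse (∏ i ∈ S, f i) = ∏ i ∈ S, Ring.inverse (f i) := by
  classical
  induction S using Finset.induction_on with
  | empty => simp
  | insert i S hi ih => rw [Finset.prod_insert hi, Finset.prod_insert hi, Ring.mul_inverse_rev, ih,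
      mul_comm]

/-- In terms of `e^{-x} - e^{-z} = -2i e^{-(x+z)/2} sin((x-z)/2i)`, the interpolation coefficients
become the factors of `C^K`: the `n - 1` exponential factors reduce `n - r + n - 1` to `n - r`. -/
theorem connection_eq (hr : r < n) (x : A) (z : Fin n → A) (j : Fin n) :
    connection r (twoPiIDiv (-x)) (fun i => twoPiIDiv (-z i)) j =
      NormedSpace.exp ((((n : ℂ) - (r : ℂ)) / 2) • (x - z j))
        * (∏ i ∈ Finset.univ.erase j, sinHalf (-z i + x))
        * Ring.inverse (∏ i ∈ Finset.univ.erase j, sinHalf (-z i + z j)) := by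
  have hfac : ∀ i, (NormedSpace.exp (-x) - NormedSpace.exp (-z i)) *
      Ring.inverse (NormedSpace.exp (-z j) - NormedSpace.exp (-z i)) =
      NormedSpace.exp (-((2 : ℂ)⁻¹ • (x - z j))) *
        (sinHalf (-z i + x) * Ring.inverse (sinHalf (-z i + z j))) := by
    intro i
    rw [exp_sub_exp, exp_sub_exp]
    set c : ℂ := -(2 * I) with hc
    have hc0 : c ≠ 0 := by simp [hc]
    have hu : IsUnit (algebraMap ℂ A c * NormedSpace.exp (-((2 : ℂ)⁻¹ • (z j + z i)))) :=
      ((isUnit_iff_ne_zero.2 hc0).map _).mul (isUnit_exp _)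
    have e1 : NormedSpace.exp (-((2 : ℂ)⁻¹ • (x + z i))) =
        NormedSpace.exp (-((2 : ℂ)⁻¹ • (x - z j))) *
          NormedSpace.exp (-((2 : ℂ)⁻¹ • (z j + z i))) := by
      rw [← exp_add', ← neg_add, ← smul_add, show x - z j + (z j + z i) = x + z i by ring]
    rw [Algebra.smul_def c, Algebra.smul_def c, ← mul_assoc (algebraMap ℂ A c),
      ← mul_assoc (algebraMap ℂ A c), Ring.mul_inverse_rev, e1]
    calc _ = NormedSpace.exp (-((2 : ℂ)⁻¹ • (x - z j))) * (sinHalf (-z i + x) *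
          Ring.inverse (sinHalf (-z i + z j))) *
          ((algebraMap ℂ A c * NormedSpace.exp (-((2 : ℂ)⁻¹ • (z j + z i)))) *
          Ring.inverse (algebraMap ℂ A c * NormedSpace.exp (-((2 : ℂ)⁻¹ • (z j + z i))))) := by ring
      _ = _ := by rw [Ring.mul_inverse_cancel _ hu, mul_one]
  rw [connection]
  simp only [two_pi_I_smul_twoPiIDiv, hfac]
  rw [Finset.prod_mul_distrib, Finset.prod_mul_distrib, inverse_prod, Finset.prod_const,
    Finset.card_erase_of_mem (Finset.mem_univ j), Finset.card_univ, Fintype.card_fin, ← smul_neg,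
    ← smul_neg, exp_smul_pow, ← mul_assoc, ← mul_assoc, ← exp_add']
  congr 3
  rw [twoPiIDiv, twoPiIDiv, ← smul_sub, ← smul_neg, smul_smul,
    show -(-x - -z j) = x - z j by ring, smul_neg, ← sub_eq_add_neg, ← sub_smul]
  congr 1
  rw [Nat.cast_sub (by lia)]
  have := Real.pi_ne_zero
  field_simp
  push_cast
  ring

/-- The quotient of sines by which `C^H` differs from `C^K` exchanges the prefactors of `H⁺` and
`H⁻`. -/
theorem CH_mul_rootFactor (hr : r < n) (x z : Fin n → A) (fm fp : Fin r → Fin n)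
    (hz : ∀ i k, i ≠ k → IsUnit (sinHalf (z (fm i) - z (fm k)))) :
    CH x z fm fp * rootFactor (fun k => -z (fm k)) = rootFactor (fun k => -x (fp k)) *
      ∏ k, connection r (twoPiIDiv (-x (fp k))) (fun i => twoPiIDiv (-z i)) (fm k) := by
  have hu : IsUnit (∏ k : Fin r, ∏ i ∈ Finset.Iio k, sinHalf (z (fm i) - z (fm k))) := by
    simp only [IsUnit.prod_iff]
    exact fun k _ i hi => hz i k (Finset.mem_Iio.1 hi).ne
  have e : ∀ y : Fin n → A, ∀ f : Fin r → Fin n, ∏ k : Fin r, ∏ i ∈ Finset.Iio k,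
      sinHalf (-y (f k) - -y (f i)) = ∏ k : Fin r, ∏ i ∈ Finset.Iio k,
        sinHalf (y (f i) - y (f k)) := fun y f => by
    simp only [neg_sub_neg]
  simp only [connection_eq hr]
  rw [CH, rootFactor, rootFactor, e, e, CK, inverse_prod]
  simp only [inverse_prod, Finset.prod_mul_distrib]
  simp only [← inverse_prod]
  rw [mul_smul_comm, smul_mul_assoc]
  congr 1
  generalize (∏ k : Fin r, ∏ i ∈ Finset.Iio k, sinHalf (z (fm i) - z (fm k))) = U at hu
  have hU := Ring.mul_inverse_cancel U hu
  generalize (∏ k : Fin r, (NormedSpace.exp (_ : A) : A)) = E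
  generalize (∏ k : Fin r, ∏ j ∈ Finset.univ.erase (fm k), sinHalf (-z j + x (fp k))) = S
  generalize Ring.inverse (∏ k : Fin r, ∏ j ∈ Finset.univ.erase (fm k), (_ : A)) = R
  generalize Ring.inverse (∏ k : Fin r, ∏ i ∈ Finset.Iio k, sinHalf (x (fp i) - x (fp k))) = T
  linear_combination E * S * R * T * hU
end Sines

/-! ### The hypergeometric functions as determinants -/

section Hypergeometric

variable {A : Type*} [NormedCommRing A] [NormedAlgebra ℂ A] {n r : ℕ}

/-- The parameters `1 - x_j/2πi + l_j` of the coefficient function. -/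
def paramP (x : Fin n → A) (l : Fin n → ℤ) (j : Fin n) : A :=
  1 - twoPiIDiv (x j) + algebraMap ℂ A (l j)

/-- The parameters `1 + z_j/2πi - m_j` of the coefficient function. -/
def paramQ (z : Fin n → A) (m : Fin n → ℤ) (j : Fin n) : A :=
  1 + twoPiIDiv (z j) - algebraMap ℂ A (m j)

theorem isNilpotent_neg_sub {a : A} {α : ℂ} (ha : IsNilpotent (a - algebraMap ℂ A α)) :
    IsNilpotent (-a - algebraMap ℂ A (-α)) := by
  rw [map_neg, neg_sub_neg, ← neg_sub]
  exact ha.neg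

theorem isNilpotent_twoPiIDiv_neg {a : A} {α : ℂ} (ha : IsNilpotent (a - algebraMap ℂ A α)) :
    IsNilpotent (twoPiIDiv (-a) - algebraMap ℂ A ((2 * Real.pi * I : ℂ)⁻¹ * -α)) := by
  rw [twoPiIDiv, map_mul, ← Algebra.smul_def, ← smul_sub, Algebra.smul_def]
  exact (Commute.all _ _).isNilpotent_mul_left (isNilpotent_neg_sub ha)

theorem twoPiIDiv_add (a b : A) : twoPiIDiv (a + b) = twoPiIDiv a + twoPiIDiv b :=
  smul_add _ _ _

theorem twoPiIDiv_sub (a b : A) : twoPiIDiv (a - b) = twoPiIDiv a - twoPiIDiv b :=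
  smul_sub _ _ _

theorem twoPiIDiv_neg (a : A) : twoPiIDiv (-a) = -twoPiIDiv a :=
  smul_neg _ _

theorem isNilpotent_paramP {x : Fin n → A} {lam : Fin n → ℂ}
    (hx : ∀ j, IsNilpotent (x j - algebraMap ℂ A (lam j))) (l : Fin n → ℤ) (j : Fin n) :
    IsNilpotent (paramP x l j -
      algebraMap ℂ A (1 + (2 * Real.pi * I : ℂ)⁻¹ * -lam j + l j)) := by
  convert isNilpotent_twoPiIDiv_neg (hx j) using 1
  rw [paramP, map_add, map_add, map_one, twoPiIDiv_neg]
  ring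

theorem isNilpotent_paramQ {z : Fin n → A} {mu : Fin n → ℂ}
    (hz : ∀ j, IsNilpotent (z j - algebraMap ℂ A (mu j))) (m : Fin n → ℤ) (j : Fin n) :
    IsNilpotent (paramQ z m j -
      algebraMap ℂ A (1 - (2 * Real.pi * I : ℂ)⁻¹ * -mu j - m j)) := by
  convert (isNilpotent_twoPiIDiv_neg (hz j)).neg using 1
  rw [paramQ, map_sub, map_sub, map_one, twoPiIDiv_neg]
  ring

theorem neg_one_zpow_sum {ι : Type*} (S : Finset ι) (f : ι → ℤ) :
    (-1 : ℂ) ^ (∑ i ∈ S, f i) = ∏ i ∈ S, (-1 : ℂ) ^ f i := by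
  classical
  induction S using Finset.induction_on with
  | empty => simp
  | insert i S hi ih =>
    rw [Finset.sum_insert hi, Finset.prod_insert hi, zpow_add₀ (by norm_num), ih]

variable [CompleteSpace A]

/-- The translation of the argument by `1 + N` may be made inside or outside the power series. -/
theorem recipGamma_eq {a : A} {α : ℂ} (ha : IsNilpotent (a - algebraMap ℂ A α)) (N : ℤ) :
    recipGamma N a = rGamma (1 + a + algebraMap ℂ A N) := by
  have hd : Differentiable ℂ fun v : ℂ => (Gamma (1 + v + N))⁻¹ :=
    differentiable_one_div_Gamma.comp (by fun_prop : Differentiable ℂ fun v : ℂ => 1 + v + (N : ℂ))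
  have h1 := entireEval_add_nilpotent hd ha α
  have h2 := entireEval_add_nilpotent differentiable_one_div_Gamma ha (α + (1 + N))
  have h3 := nilShift_comp_affine (ν := a - algebraMap ℂ A α)
    (f := fun v => algebraMap ℂ A (Gamma v)⁻¹)
    (differentiable_algebraMap differentiable_one_div_Gamma) 1 (1 + N) α
  rw [add_sub_cancel] at h1
  rw [one_smul, one_mul, ← h2] at h3
  rw [recipGamma, h1, rGamma]
  convert h3 using 2
  · funext v
    congr 3
    ring
  · rw [map_add, map_add, map_one]
    ring

section Terms

variable {x z : Fin n → A} {lam mu : Fin n → ℂ}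
  (hx : ∀ j, IsNilpotent (x j - algebraMap ℂ A (lam j)))
  (hz : ∀ j, IsNilpotent (z j - algebraMap ℂ A (mu j)))
  (l m : Fin n → ℤ)
include hx hz

/-- The coefficients of both hypergeometric functions, in terms of the exponent `t = y/2πi + d`. -/
theorem prod_recipGamma_eq {y : A} {η : ℂ} (hy : IsNilpotent (y - algebraMap ℂ A η)) (d : ℤ) :
    ∏ j, (recipGamma (l j - d) (twoPiIDiv (-y - x j)) *
      recipGamma (-m j + d) (twoPiIDiv (y + z j))) =
      gammaProd (paramP x l) (paramQ z m) (twoPiIDiv y + algebraMap ℂ A d) := by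
  refine Finset.prod_congr rfl fun j _ => ?_
  have h1 : IsNilpotent (y + x j - algebraMap ℂ A (η + lam j)) := by
    rw [map_add, add_sub_add_comm]
    exact (Commute.all _ _).isNilpotent_add hy (hx j)
  have h2 : IsNilpotent (-(y + z j) - algebraMap ℂ A (-(η + mu j))) := by
    refine isNilpotent_neg_sub ?_
    rw [map_add, add_sub_add_comm]
    exact (Commute.all _ _).isNilpotent_add hy (hz j)
  have h1' := isNilpotent_twoPiIDiv_neg h1
  have h2' := isNilpotent_twoPiIDiv_neg h2
  rw [neg_add'] at h1'
  rw [neg_neg] at h2'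
  rw [recipGamma_eq h1', recipGamma_eq h2', paramP, paramQ, twoPiIDiv_sub, twoPiIDiv_neg,
    twoPiIDiv_add, Int.cast_sub, Int.cast_add, Int.cast_neg, map_sub, map_add, map_neg]
  congr 2 <;> ring

theorem termMinus_eq {y : Fin r → A} {η : Fin r → ℂ}
    (hy : ∀ k, IsNilpotent (y k - algebraMap ℂ A (η k))) (v : Fin r → ℂ) (d : Fin r → ℤ) :
    termMinus x z l m y v d =
      detTerm (gammaProd (paramP x l) (paramQ z m)) (fun k => twoPiIDiv (y k)) (-v) d := by
  simp only [termMinus, detTerm, prod_recipGamma_eq hx hz l m (hy _), seriesTerm,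
    Finset.prod_smul, Finset.prod_mul_distrib]
  rw [Finset.mul_sum, neg_one_zpow_sum, mul_smul_comm]
  congr 1
  rw [← mul_assoc, mul_comm (∏ k, ∏ i ∈ Finset.Iio k, _) (∏ k, NormedSpace.exp _)]
  congr 2
  · refine Finset.prod_congr rfl fun k _ => ?_
    rw [qPow, Pi.neg_apply, neg_smul, neg_neg]
  · refine Finset.prod_congr rfl fun k _ => Finset.prod_congr rfl fun i _ => ?_
    rw [twoPiIDiv_sub, map_sub]
    ring

omit hx hz [CompleteSpace A] in
/-- The two hypergeometric series have the same summands, with `e = -d` and `log q_+ = -log q_-`. -/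
theorem termPlus_eq_termMinus (y : Fin r → A) (w : Fin r → ℂ) (e : Fin r → ℤ) :
    termPlus x z l m y w e = termMinus x z l m y (-w) (-e) := by
  rw [termPlus, termMinus]
  congr 1
  · rw [show ((r : ℤ) - 1) * ∑ k, (-e) k = -(((r : ℤ) - 1) * ∑ k, e k) by simp, zpow_neg,
      ← inv_zpow, inv_neg, inv_one]
  · refine Finset.prod_congr rfl fun k _ => ?_
    congr 2
    · rw [qPow, qPow, twoPiIDiv_neg, Pi.neg_apply, Pi.neg_apply, neg_smul, ← smul_neg, Int.cast_neg,
        map_neg]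
      congr 2
      ring
    · refine Finset.prod_congr rfl fun i _ => ?_
      simp
    · simp [sub_eq_add_neg]

end Terms

section Continuation

variable {x z : Fin n → A} {lam mu : Fin n → ℂ}
  (hx : ∀ j, IsNilpotent (x j - algebraMap ℂ A (lam j)))
  (hz : ∀ j, IsNilpotent (z j - algebraMap ℂ A (mu j)))
  (hmu : ∀ i j, i ≠ j → ∀ N : ℤ, mu i - mu j ≠ 2 * (Real.pi : ℂ) * I * (N : ℂ))
  (l m : Fin n → ℤ)

include hz hmu

theorem isUnit_sinHalf_sub {i j : Fin n} (hij : i ≠ j) :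
    IsUnit (sinHalf (z i - z j)) := by
  refine isUnit_sinHalf (α := mu i - mu j) ?_ (hmu i j hij)
  rw [map_sub, sub_sub_sub_comm]
  exact (Commute.all _ _).isNilpotent_sub (hz i) (hz j)

theorem isUnit_exp_sub_exp {i j : Fin n} (hij : i ≠ j) :
    IsUnit (NormedSpace.exp ((2 * Real.pi * I : ℂ) • twoPiIDiv (-z i)) -
      NormedSpace.exp ((2 * Real.pi * I : ℂ) • twoPiIDiv (-z j))) := by
  rw [two_pi_I_smul_twoPiIDiv, two_pi_I_smul_twoPiIDiv, exp_sub_exp, neg_add_eq_sub,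
    Algebra.smul_def]
  exact ((isUnit_iff_ne_zero.2 (by simp)).map _).mul
    ((isUnit_exp _).mul (isUnit_sinHalf_sub hz hmu hij))

include hx

theorem continues_hypergeometric (hr : r < n) (j : Fin n) (p : ℕ) :
    Continues r ((n : ℝ) - r) (twoPiIDiv (-x j)) (fun i => twoPiIDiv (-z i))
      (connection r (twoPiIDiv (-x j)) fun i => twoPiIDiv (-z i))
      fun t => t ^ p * gammaProd (paramP x l) (paramQ z m) t := by
  refine continues_pow_mul_gammaProd (isNilpotent_paramP hx l) (isNilpotent_paramQ hz m)
    (isNilpotent_twoPiIDiv_neg (hx j)) (fun i => isNilpotent_twoPiIDiv_neg (hz i))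
    (fun i k hik => isUnit_exp_sub_exp hz hmu hik) ⟨j, 1 + l j, ?_⟩ (fun i => ⟨1 - m i, ?_⟩)
    (by lia) p
  · rw [paramP, twoPiIDiv_neg, Int.cast_add, Int.cast_one, map_add, map_one]
    ring
  · rw [paramQ, twoPiIDiv_neg, Int.cast_sub, Int.cast_one, map_sub, map_one]
    ring

/-- The matrix of one-variable series whose determinant is the series of `H⁺` and `H⁻`. -/
def seriesMatrix (x z : Fin n → A) (l m : Fin n → ℤ) (s : Fin r → A) (w : Fin r → ℂ) :
    Matrix (Fin r) (Fin r) A :=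
  Matrix.of fun k p =>
    ∑' d, seriesTerm r (fun t => t ^ (p : ℕ) * gammaProd (paramP x l) (paramQ z m) t) (s k) (w k) d

theorem hasSum_HplusTerm (hr : r < n) (δ : Fin r → Fin n) {w : Fin r → ℂ}
    (hw : ∀ k, (w k).re < 0) : HasSum (HplusTerm x z l m δ w)
      (seriesMatrix x z l m (fun k => twoPiIDiv (-x (δ k))) w).det := by
  have h1 := hasSum_detTerm (gammaProd (paramP x l) (paramQ z m))
    (fun k => twoPiIDiv (-x (δ k))) w fun k p =>
      (continues_hypergeometric hx hz hmu l m hr (δ k) p).left.summable_norm (hw k)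
  rw [← (Equiv.neg (Fin r → ℤ)).hasSum_iff] at h1
  refine (congrArg (HasSum · _) (funext fun e => ?_)).mpr h1
  rw [HplusTerm, termPlus_eq_termMinus, termMinus_eq hx hz l m
    (fun k => isNilpotent_neg_sub (hx (δ k))), neg_neg]
  rfl

theorem hasSum_HminusTerm (hr : r < n) (δ : Fin r → Fin n) {v : Fin r → ℂ}
    (hv : ∀ k, (v k).re < 0) : HasSum (HminusTerm x z l m δ v)
      (seriesMatrix x z l m (fun k => twoPiIDiv (-z (δ k))) (-v)).det := by
  have h1 := hasSum_detTerm (gammaProd (paramP x l) (paramQ z m))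
    (fun k => twoPiIDiv (-z (δ k))) (-v) fun k p =>
      ((continues_hypergeometric hx hz hmu l m hr (δ k) p).right (δ k)).summable_norm
        (by simpa using hv k)
  refine (congrArg (HasSum · _) (funext fun d => ?_)).mpr h1
  exact termMinus_eq hx hz l m (fun k => isNilpotent_neg_sub (hz (δ k))) v d

/-- The function `H⁺` extends analytically to the product of the slit planes, and on the diagonal
over `Re u > 0` the extension is the combination of the functions `H⁻`. -/
theorem exists_analytic_extension_Hplus (hr : r < n) (δ : Fin r → Fin n) :
    ∃ G : (Fin r → ℂ) → A, (∀ w ∈ slitSpace r ((n : ℝ) - r), AnalyticAt ℂ G w) ∧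
      (∀ w : Fin r → ℂ, (∀ k, (w k).re < 0) → G w = Hplus x z l m δ w) ∧
      ∀ u : ℂ, 0 < u.re → G (fun _ => u) =
        ∑ δm : Fin r ↪ Fin n, CH x z δm δ * Hminus x z l m δm (fun _ => -u) := by
  choose g hg hgl hgr using fun k (p : Fin r) =>
    (continues_hypergeometric hx hz hmu l m hr (δ k) p).exists_extension
  refine ⟨fun w => rootFactor (fun k => -x (δ k)) * (Matrix.of fun k p => g k p (w k)).det,
    fun w hw => ?_, fun w hw => ?_, fun u hu => ?_⟩
  · simp only [Matrix.det_apply, Matrix.of_apply]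
    refine analyticAt_const.mul (Finset.analyticAt_fun_sum _ fun σ _ => ?_)
    simp only [Units.smul_def, zsmul_eq_mul]
    refine analyticAt_const.mul (Finset.analyticAt_fun_prod _ fun k _ => ?_)
    have h1 : AnalyticAt ℂ (g (σ k) k) (w (σ k)) :=
      (hg _ _).analyticAt ((isOpen_slitPlane _).mem_nhds (hw (σ k)))
    exact h1.comp (f := fun w : Fin r → ℂ => w (σ k))
      ((ContinuousLinearMap.proj (R := ℂ) (φ := fun _ : Fin r => ℂ) (σ k)).analyticAt w)
  · dsimp only
    rw [Hplus, (hasSum_HplusTerm hx hz hmu l m hr δ hw).tsum_eq, seriesMatrix]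
    simp only [hgl _ _ _ (hw _)]
  · have hneg : ∀ _ : Fin r, ((-u : ℂ)).re < 0 := fun _ => by simpa using hu
    simp only [hgr _ _ _ hu]
    rw [det_sum_mul (fun k j => connection r (twoPiIDiv (-x (δ k))) (fun i => twoPiIDiv (-z i)) j)
      (fun j p => ∑' d, seriesTerm r
        (fun t => t ^ (p : ℕ) * gammaProd (paramP x l) (paramQ z m) t) (twoPiIDiv (-z j)) u d),
      Finset.mul_sum]
    refine Finset.sum_congr rfl fun f _ => ?_
    rw [Hminus, (hasSum_HminusTerm hx hz hmu l m hr f hneg).tsum_eq, ← mul_assoc, ← mul_assoc,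
      CH_mul_rootFactor hr x z f δ fun i k hik =>
        isUnit_sinHalf_sub hz hmu fun h => hik (f.injective h)]
    congr 2
    ext k p
    simp [seriesMatrix]

end Continuation
end Hypergeometric

end

end GrassmannFlop

theorem mainTheorem5 (n r : ℕ) (hr : 0 < r) (hrn : r < n) (a b : ℝ) (ha : a < 0) (hb : 0 < b)
    (γ : Path (a : ℂ) (b : ℂ)) (hγ : GrassmannFlop.IsContinuationPath n r γ) :
    -- the path `γhat` lies in the diagonal; the homotopy `F` depends on no other data
    ∃ (γhat : Path (a : ℂ) (b : ℂ))
      (F : Path.Homotopy (GrassmannFlop.concatPath r γ) (GrassmannFlop.diagPath r γhat)),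
      GrassmannFlop.IsContinuationPath n r γhat ∧
      (∀ s t k, F (s, t) k ∉ GrassmannFlop.poles n r) ∧
      ∀ (A : Type*) [NormedCommRing A] [NormedAlgebra ℂ A] [FiniteDimensional ℂ A]
        (lam mu : Fin n → ℂ)
        (_ : ∀ i j, i ≠ j → ∀ N : ℤ, lam i - lam j ≠ 2 * (Real.pi : ℂ) * Complex.I * (N : ℂ))
        (_ : ∀ i j, i ≠ j → ∀ N : ℤ, mu i - mu j ≠ 2 * (Real.pi : ℂ) * Complex.I * (N : ℂ))
        (x z : Fin n → A)
        (_ : ∀ j, IsNilpotent (x j - algebraMap ℂ A (lam j)))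
        (_ : ∀ j, IsNilpotent (z j - algebraMap ℂ A (mu j)))
        (l m : Fin n → ℤ) (δp : Fin r ↪ Fin n),
        -- the series converge for `|q₊| < 1` and for `|q₋| < 1`
        (∀ w : Fin r → ℂ, (∀ k, (w k).re < 0) →
          Summable (GrassmannFlop.HplusTerm x z l m δp w)) ∧
        (∀ (δm : Fin r ↪ Fin n) (v : Fin r → ℂ), (∀ k, (v k).re < 0) →
          Summable (GrassmannFlop.HminusTerm x z l m δm v)) ∧
        -- `H⁺` continues analytically along all paths of the homotopy, with the same result `g`,
        -- and `g` is given on the diagonal by the continuation formula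
        (∃ g : (Fin r → ℂ) → A,
          (∀ s, GrassmannFlop.ContinuesAlong (F.eval s) (GrassmannFlop.Hplus x z l m δp) g) ∧
          ∀ᶠ u in 𝓝 (b : ℂ), g (fun _ => u) =
            ∑ δm : Fin r ↪ Fin n,
              GrassmannFlop.CH x z δm δp * GrassmannFlop.Hminus x z l m δm (fun _ => -u)) ∧
        -- the continuation along `γhat` of the restriction of `H⁺` to the diagonal
        GrassmannFlop.ContinuesAlong γhat
          (fun u => GrassmannFlop.Hplus x z l m δp (fun _ => u))
          (fun u => ∑ δm : Fin r ↪ Fin n,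
            GrassmannFlop.CH x z δm δp * GrassmannFlop.Hminus x z l m δm (fun _ => -u)) := by
  have hmem : ∀ t, γ t ∈ GrassmannFlop.slitPlane ((n : ℝ) - r) := hγ.mem_slitPlane
  -- the diagonal path follows `γ` itself
  obtain ⟨F, hF⟩ := GrassmannFlop.exists_homotopy_of_starConvex
    (GrassmannFlop.starConvex_slitSpace r ((n : ℝ) - r))
    ⟨_, GrassmannFlop.center_mem_slitSpace r _⟩
    (GrassmannFlop.concatPath r γ) (GrassmannFlop.diagPath r γ)
    (GrassmannFlop.concatPath_mem_slitSpace r hmem) fun t _ => hmem t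
  refine ⟨γ, F, hγ, fun s t k => GrassmannFlop.disjoint_poles (hF (s, t) k), ?_⟩
  intro A _ _ _ lam mu _ hmu x z hx hz l m δp
  have _ : CompleteSpace A := FiniteDimensional.complete ℂ A
  obtain ⟨G, hG, hGl, hGr⟩ :=
    GrassmannFlop.exists_analytic_extension_Hplus hx hz hmu l m hrn δp
  -- near the end points of the paths the extension is given by the two series
  have hGa : G =ᶠ[𝓝 fun _ => (a : ℂ)] GrassmannFlop.Hplus x z l m δp := by
    have hre : ∀ᶠ w : Fin r → ℂ in 𝓝 fun _ => (a : ℂ), ∀ k, (w k).re < 0 :=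
      eventually_all.2 fun k => (continuous_re.comp (continuous_apply k)).continuousAt.eventually_lt
        continuousAt_const (by simpa using ha)
    filter_upwards [hre] with w hw using hGl w hw
  have hGb : ∀ᶠ u in 𝓝 (b : ℂ), G (fun _ => u) =
      ∑ δm : Fin r ↪ Fin n,
        GrassmannFlop.CH x z δm δp * GrassmannFlop.Hminus x z l m δm (fun _ => -u) := by
    filter_upwards [GrassmannFlop.isOpen_re_pos.mem_nhds (by simpa using hb)] with u hu
      using hGr u hu
  -- one global analytic function serves as the germ at every point of every path
  refine ⟨fun w hw => (GrassmannFlop.hasSum_HplusTerm hx hz hmu l m hrn δp hw).summable,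
    fun δm v hv => (GrassmannFlop.hasSum_HminusTerm hx hz hmu l m hrn δm hv).summable,
    ⟨G, fun s => ⟨fun _ => G, fun t => hG _ (hF (s, t)), fun t => ?_, hGa, .rfl⟩, hGb⟩,
    fun _ u => G fun _ => u, fun t => ?_, fun t => ?_, ?_, hGb⟩
  · exact .of_forall fun _ => .rfl
  · exact (hG (fun _ => γ t) fun _ => hmem t).comp (f := fun u : ℂ => fun _ : Fin r => u)
      (AnalyticAt.pi fun _ => analyticAt_id)
  · exact .of_forall fun _ => .rfl
  · exact (show Continuous fun u : ℂ => fun _ : Fin r => u by fun_prop).continuousAt.eventually hGa
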